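/- **Setting.** Points of $\mathbb R\times\mathbb R^d$ are $x=(x_0,x')$, with parabolic distance $d(x,y)=\sqrt{|x_0-y_0|}+|x'-y'|$. Let $\mathcal G=\partial_{x_0}^2-\Delta_{x'}^2$, let $p_t(x,y)$ be the kernel of $e^{t\mathcal G}$, and for an integer $N\ge1$ let $Q^{(N)}_t=(-t\mathcal G)^Ne^{t\mathcal G}$ and $P^{(N)}_t=\int_t^\infty Q^{(N)}_s\frac{ds}{s}=(N-1)!\sum_{k<N}\frac{(-t\mathcal G)^k}{k!}e^{t\mathcal G}$. For $\alpha<4N$, the space $\mathcal C^\alpha$ consists of the tempered distributions $\Lambda$ with $\|\Lambda\|_{\mathcal C^\alpha}=\|P^{(N)}_1\Lambda\|_{L^\infty}+\sup_{0<t\le1}t^{-\alpha/4}\|Q^{(N)}_t\Lambda\|_{L^\infty}<\infty$. A *concrete regularity structure* $\mathscr T=(T^+,T)$ consists of: a connected graded real bialgebra $T^+=\bigoplus_{\alpha\in A^+}T^+_\alpha$ with coproduct $\Delta^+$ and counit $\mathbf 1_+'$, where $A^+\subset[0,\infty)$ is locally finite, contains $0$ and is closed under addition, and $T_0^+=\langle\mathbf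 1_+\rangle$; and a graded vector space $T=\bigoplus_{\beta\in A}T_\beta$, with $A\subset\mathbb R$ non-empty, locally finite and bounded below, with a linear map $\Delta:T\to T\otimes T^+$ such that $(\Delta\otimes\mathrm{Id})\Delta=(\mathrm{Id}\otimes\Delta^+)\Delta$, $(\mathrm{Id}\otimes\mathbf 1_+')\Delta=\mathrm{Id}$ and $\Delta T_\beta\subset\bigoplus_{\alpha\ge0}T_{\beta-\alpha}\otimes T^+_\alpha$. All $T^+_\alpha$ and $T_\beta$ are finite dimensional; $\mathcal B^+,\mathcal B$ are fixed homogeneous bases of $T^+,T$, $|\tau|$ is the homogeneity of a basis element, $\|\tau\|_\beta$ is a norm of the component of $\tau$ in $T_\beta$, $T_{<\gamma}=\bigoplus_{\beta<\gamma}T_\beta$ and $\beta_0=\min A$. Characters of $T^+$ form a group for $(g_1*g_2)=(g_1\otimes g_2)\Delta^+$; put $\widehat g=(\mathrm{Id}\otimes g)\Delta:T\to T$. A *model* $\mathsf M=(\mathsf\Pi,\mathsf g)$ consists of a map $\mathsf g$ from $\mathbb R\times\mathbb R^d$ to the characters of $T^+$ and a linear map $\mathsf\Pi:T\to\mathcal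 S'(\mathbb R\times\mathbb R^d)$ such that, with $\mathsf g_{yx}=\mathsf g_y*\mathsf g_x^{-1}$ and $\mathsf\Pi^{\mathsf g}_x=(\mathsf\Pi\otimes\mathsf g_x^{-1})\Delta$, for every $\gamma\in\mathbb R$ $$\sup_{\tau\in\mathcal B^+,|\tau|<\gamma}\ \sup_{x,y}\frac{|\mathsf g_{yx}(\tau)|}{d(y,x)^{|\tau|}}<\infty,\qquad \|\mathsf\Pi^{\mathsf g}\|_\gamma:=\sup_{\sigma\in\mathcal B,|\sigma|<\gamma}\ \sup_{x,\,0<t\le1}t^{-|\sigma|/4}\big|\langle\mathsf\Pi^{\mathsf g}_x\sigma,p_t(x,\cdot)\rangle\big|<\infty .$$ $\mathcal D^\gamma(T,\mathsf g)$ is the space of functions $f:\mathbb R\times\mathbb R^d\to T_{<\gamma}$ for which $$\max_{\beta<\gamma}\sup_x\|f(x)\|_\beta<\infty,\qquad \|f\|_{\mathcal D^\gamma}:=\max_{\beta<\gamma}\sup_{x,y}\frac{\|f(y)-\widehat{\mathsf g_{yx}}f(x)\|_\beta}{d(y,x)^{\gamma-\beta}}<\infty,$$ normed by the sum of these two quantities.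 **Theorem (Reconstruction).** Let $\mathscr T$ be a concrete regularity structure and $\gamma\in\mathbb R\setminus\{0\}$. There is a constant $C$, not depending on the model, such that for every model $\mathsf M=(\mathsf\Pi,\mathsf g)$ over $\mathscr T$ there is a continuous linear operator $$\mathbf R^{\mathsf M}:\mathcal D^\gamma(T,\mathsf g)\to\mathcal C^{\beta_0\wedge0}(\mathbb R\times\mathbb R^d)$$ with $$\big|\langle\mathbf R^{\mathsf M}f-\mathsf\Pi^{\mathsf g}_xf(x),p_t(x,\cdot)\rangle\big|\le C\,\|\mathsf\Pi^{\mathsf g}\|_\gamma\,\|f\|_{\mathcal D^\gamma}\,t^{\gamma/4}$$ for all $f\in\mathcal D^\gamma(T,\mathsf g)$, $x\in\mathbb R\times\mathbb R^d$ and $0<t\le1$. If $\gamma>0$, then for each model $\mathsf M$ there is only one continuous linear operator $\mathcal D^\gamma(T,\mathsf g)\to\mathcal C^{\beta_0\wedge0}$ that satisfies such a bound for some constant. -/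

import Mathlib

open scoped SchwartzMap TensorProduct ENNReal FourierTransform

noncomputable section

namespace RegStruct

/-! ### The parabolic space and the heat semigroup of `∂₀² - Δ'²` -/

/-- The space `ℝ × ℝᵈ`, with points `x = (x₀, x₁, …, x_d)`; the coordinate `x 0` is the time
variable and `x i.succ`, `i : Fin d`, are the space variables. -/
abbrev Spacetime (d : ℕ) : Type := EuclideanSpace ℝ (Fin (d + 1))

/-- The parabolic distance `√|x₀ - y₀| + |x' - y'|`. -/
def pdist {d : ℕ} (x y : Spacetime d) : ℝ :=
  Real.sqrt |x 0 - y 0| + Real.sqrt (∑ i : Fin d, (x i.succ - y i.succ) ^ 2)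

/-- Real tempered distributions on `ℝ × ℝᵈ`. -/
abbrev TempDist (d : ℕ) : Type := 𝓢(Spacetime d, ℝ) →L[ℝ] ℝ

/-- The Fourier symbol of `-𝒢`, where `𝒢 = ∂₀² - Δ'²`, for the Fourier transform with
character `exp (2 π i ⟨x, ξ⟩)`. -/
def symbolG {d : ℕ} (ξ : Spacetime d) : ℝ :=
  (2 * Real.pi * ξ 0) ^ 2 + (∑ i : Fin d, (2 * Real.pi * ξ i.succ) ^ 2) ^ 2

lemma coord_hasTemperateGrowth {d : ℕ} (i : Fin (d + 1)) :
    Function.HasTemperateGrowth (fun ξ : Spacetime d => ξ i) :=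
  (EuclideanSpace.proj (𝕜 := ℝ) i : Spacetime d →L[ℝ] ℝ).hasTemperateGrowth

lemma symbolG_hasTemperateGrowth (d : ℕ) :
    Function.HasTemperateGrowth (symbolG : Spacetime d → ℝ) := by
  have h (i : Fin (d + 1)) :
      Function.HasTemperateGrowth (fun ξ : Spacetime d => (2 * Real.pi * ξ i) ^ 2) :=
    ((Function.HasTemperateGrowth.const (2 * Real.pi)).mul (coord_hasTemperateGrowth i)).pow 2
  have hs : Function.HasTemperateGrowth
      (fun ξ : Spacetime d => ∑ i : Fin d, (2 * Real.pi * ξ i.succ) ^ 2) :=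
    Function.HasTemperateGrowth.sum (fun i _ => h i.succ)
  exact (h 0).add (hs.pow 2)

lemma norm_sq_le_symbolG {d : ℕ} (ξ : Spacetime d) : (1 + ‖ξ‖) ^ 2 ≤ 2 * (symbolG ξ + 2) := by
  have hn : ‖ξ‖ ^ 2 = ξ 0 ^ 2 + ∑ i : Fin d, ξ i.succ ^ 2 := by
    rw [EuclideanSpace.norm_sq_eq, Fin.sum_univ_succ]
    simp
  have hpi : (1 : ℝ) ≤ (2 * Real.pi) ^ 2 := by nlinarith [Real.pi_gt_three]
  have hr : 0 ≤ ∑ i : Fin d, ξ i.succ ^ 2 := Finset.sum_nonneg fun i _ => sq_nonneg _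
  have hs : ∑ i : Fin d, (2 * Real.pi * ξ i.succ) ^ 2
      = (2 * Real.pi) ^ 2 * ∑ i : Fin d, ξ i.succ ^ 2 := by
    rw [Finset.mul_sum]
    exact Finset.sum_congr rfl fun i _ => by ring
  have h1 : ∑ i : Fin d, ξ i.succ ^ 2 ≤ ∑ i : Fin d, (2 * Real.pi * ξ i.succ) ^ 2 := by
    rw [hs]
    exact le_mul_of_one_le_left hr hpi
  have h0 : ξ 0 ^ 2 ≤ (2 * Real.pi * ξ 0) ^ 2 := by
    rw [mul_pow]
    exact le_mul_of_one_le_left (sq_nonneg _) hpi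
  unfold symbolG
  nlinarith [sq_nonneg (∑ i : Fin d, (2 * Real.pi * ξ i.succ) ^ 2 - 1), sq_nonneg (1 - ‖ξ‖)]

lemma heatSymbol_decay {d : ℕ} {t : ℝ} (ht : 0 < t) (k n : ℕ) :
    ∃ C : ℝ, ∀ ξ : Spacetime d,
      ‖ξ‖ ^ k * ‖iteratedFDeriv ℝ n (fun η : Spacetime d => Real.exp (-t * symbolG η)) ξ‖ ≤ C := by
  have hf : Function.HasTemperateGrowth (fun η : Spacetime d => -t * symbolG η) :=
    (Function.HasTemperateGrowth.const (-t)).mul (symbolG_hasTemperateGrowth d)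
  obtain ⟨m, C, hC0, hC⟩ := hf.norm_iteratedFDeriv_le_uniform n
  let M := k + m * n
  refine ⟨n.factorial * (1 + C) ^ n * (2 ^ M * ((M.factorial : ℝ) / t ^ M * Real.exp (2 * t))),
    fun ξ => ?_⟩
  have hq : (0 : ℝ) ≤ symbolG ξ := by unfold symbolG; positivity
  have hone : (1 : ℝ) ≤ 1 + ‖ξ‖ := by linarith [norm_nonneg ξ]
  have hexp : ∀ i, i ≤ n →
      ‖iteratedFDeriv ℝ i Real.exp (-t * symbolG ξ)‖ ≤ Real.exp (-t * symbolG ξ) := by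
    intro i _
    rw [norm_iteratedFDeriv_eq_norm_iteratedDeriv, iteratedDeriv_eq_iterate, Real.iter_deriv_exp,
      Real.norm_of_nonneg (Real.exp_pos _).le]
  have hD : ∀ i, 1 ≤ i → i ≤ n →
      ‖iteratedFDeriv ℝ i (fun η : Spacetime d => -t * symbolG η) ξ‖
        ≤ ((1 + C) * (1 + ‖ξ‖) ^ m) ^ i := by
    intro i hi hin
    have hb : (1 : ℝ) ≤ (1 + C) * (1 + ‖ξ‖) ^ m :=
      one_le_mul_of_one_le_of_one_le (by linarith) (one_le_pow₀ hone)
    calc _ ≤ C * (1 + ‖ξ‖) ^ m := hC i hin ξ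
      _ ≤ (1 + C) * (1 + ‖ξ‖) ^ m := by gcongr; linarith
      _ ≤ _ := le_self_pow₀ hb (by omega)
  have hmain := norm_iteratedFDeriv_comp_le (𝕜 := ℝ) (g := Real.exp)
    (f := fun η : Spacetime d => -t * symbolG η) (n := n) (N := n)
    Real.contDiff_exp (hf.1.of_le (by exact_mod_cast le_top)) le_rfl ξ hexp hD
  have hpow : (1 + ‖ξ‖) ^ M ≤ 2 ^ M * (symbolG ξ + 2) ^ M := by
    rw [← mul_pow]
    calc (1 + ‖ξ‖) ^ M ≤ ((1 + ‖ξ‖) ^ 2) ^ M := by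
          gcongr
          exact le_self_pow₀ hone (by norm_num)
      _ ≤ _ := by gcongr; exact norm_sq_le_symbolG ξ
  have hexp2 : (symbolG ξ + 2) ^ M * Real.exp (-t * symbolG ξ)
      ≤ (M.factorial : ℝ) / t ^ M * Real.exp (2 * t) := by
    have h := Real.pow_div_factorial_le_exp (x := t * (symbolG ξ + 2)) (by positivity) M
    have hfac : (0 : ℝ) < M.factorial := by exact_mod_cast M.factorial_pos
    rw [div_le_iff₀ hfac, mul_pow] at h
    have h' : (symbolG ξ + 2) ^ M
        ≤ (M.factorial : ℝ) / t ^ M * Real.exp (t * (symbolG ξ + 2)) := by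
      rw [div_mul_eq_mul_div, le_div_iff₀ (by positivity)]
      linarith
    calc _ ≤ (M.factorial : ℝ) / t ^ M * Real.exp (t * (symbolG ξ + 2))
          * Real.exp (-t * symbolG ξ) := by gcongr
      _ = _ := by
          rw [mul_assoc, ← Real.exp_add]
          congr 2
          ring
  calc ‖ξ‖ ^ k * ‖iteratedFDeriv ℝ n (fun η : Spacetime d => Real.exp (-t * symbolG η)) ξ‖
      ≤ (1 + ‖ξ‖) ^ k * (n.factorial * Real.exp (-t * symbolG ξ)
          * ((1 + C) * (1 + ‖ξ‖) ^ m) ^ n) := by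
        gcongr
        · linarith
        · exact hmain
    _ = n.factorial * (1 + C) ^ n * ((1 + ‖ξ‖) ^ M * Real.exp (-t * symbolG ξ)) := by
        simp only [M]
        rw [mul_pow, ← pow_mul, pow_add]
        ring
    _ ≤ n.factorial * (1 + C) ^ n
          * (2 ^ M * (symbolG ξ + 2) ^ M * Real.exp (-t * symbolG ξ)) := by gcongr
    _ ≤ _ := by
        rw [mul_assoc (2 ^ M)]
        gcongr

/-- The Fourier symbol `exp (-t ((2πξ₀)² + |2πξ'|⁴))` of `exp (t𝒢)`, for `t > 0`. -/
def heatSymbol (d : ℕ) (t : ℝ) (ht : 0 < t) : 𝓢(Spacetime d, ℝ) where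
  toFun ξ := Real.exp (-t * symbolG ξ)
  smooth' := Real.contDiff_exp.comp
    (((Function.HasTemperateGrowth.const (-t)).mul (symbolG_hasTemperateGrowth d)).1)
  decay' k n := heatSymbol_decay ht k n

/-- The convolution kernel of `exp (t𝒢)`: the inverse Fourier transform of `heatSymbol`. It is an
even real function. (Only `t > 0` is meaningful; the value is `0` otherwise.) -/
def heatKernel (d : ℕ) (t : ℝ) : 𝓢(Spacetime d, ℝ) :=
  if ht : 0 < t then
    SchwartzMap.postcompCLM Complex.reCLM
      (𝓕⁻ (SchwartzMap.postcompCLM Complex.ofRealCLM (heatSymbol d t ht)) : 𝓢(Spacetime d, ℂ))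
  else 0

/-- The test function `y ↦ p_t(x, y) = p_t(y, x)`. -/
def heatAt {d : ℕ} (t : ℝ) (x : Spacetime d) : 𝓢(Spacetime d, ℝ) :=
  SchwartzMap.compSubConstCLM ℝ x (heatKernel d t)

/-- The partial derivative `∂_i` on Schwartz functions. -/
def partialD (d : ℕ) (i : Fin (d + 1)) : 𝓢(Spacetime d, ℝ) →L[ℝ] 𝓢(Spacetime d, ℝ) :=
  LineDeriv.lineDerivOpCLM ℝ 𝓢(Spacetime d, ℝ) (EuclideanSpace.single i (1 : ℝ))

/-- The Laplacian `Δ'` in the space variables. -/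
def spatialLaplacian (d : ℕ) : 𝓢(Spacetime d, ℝ) →L[ℝ] 𝓢(Spacetime d, ℝ) :=
  ∑ i : Fin d, partialD d i.succ ∘L partialD d i.succ

/-- The operator `𝒢 = ∂₀² - Δ'²`. -/
def opG (d : ℕ) : 𝓢(Spacetime d, ℝ) →L[ℝ] 𝓢(Spacetime d, ℝ) :=
  partialD d 0 ∘L partialD d 0 - spatialLaplacian d ∘L spatialLaplacian d

/-- The kernel `y ↦ q_t^{(N)}(x, y)` of `Q_t^{(N)} = (-t𝒢)^N exp (t𝒢)`. -/
def QAt {d : ℕ} (N : ℕ) (t : ℝ) (x : Spacetime d) : 𝓢(Spacetime d, ℝ) :=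
  (((-t) • opG d) ^ N) (heatAt t x)

/-- The kernel of `P_t^{(N)} = ∫_t^∞ Q_s^{(N)} ds / s`. Since
`∫_t^∞ (sλ)^N exp (-sλ) ds / s = (N-1)! (∑_{k < N} (tλ)^k / k!) exp (-tλ)` for `λ > 0`, this is
the polynomial `(N-1)! ∑_{k < N} u^k / k!` of `u = -t𝒢`, composed with `exp (t𝒢)`. -/
def PAt {d : ℕ} (N : ℕ) (t : ℝ) (x : Spacetime d) : 𝓢(Spacetime d, ℝ) :=
  ∑ k ∈ Finset.range N, (((N - 1).factorial : ℝ) / (k.factorial : ℝ)) • QAt k t x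

/-! ### Hölder spaces -/

/-- The `𝒞^α` norm of a tempered distribution, with values in `[0, ∞]`. The functions
`x ↦ ⟨Λ, q_t^{(N)}(x, ·)⟩` are continuous, so their `L^∞` norms are suprema. -/
def holderENorm {d : ℕ} (N : ℕ) (α : ℝ) (Λ : TempDist d) : ℝ≥0∞ :=
  (⨆ x : Spacetime d, ‖Λ (PAt N 1 x)‖ₑ) +
    ⨆ t ∈ Set.Ioc (0 : ℝ) 1,
      ENNReal.ofReal (t ^ (-α / 4)) * ⨆ x : Spacetime d, ‖Λ (QAt N t x)‖ₑ

lemma holderENorm_add_le {d : ℕ} (N : ℕ) (α : ℝ) (Λ Λ' : TempDist d) :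
    holderENorm N α (Λ + Λ') ≤ holderENorm N α Λ + holderENorm N α Λ' := by
  unfold holderENorm
  rw [add_add_add_comm]
  refine add_le_add (iSup_le fun x => ?_) (iSup₂_le fun t ht => ?_)
  · exact (enorm_add_le _ _).trans (add_le_add
      (le_iSup (fun x => ‖Λ (PAt N 1 x)‖ₑ) x) (le_iSup (fun x => ‖Λ' (PAt N 1 x)‖ₑ) x))
  · refine le_trans ?_ (add_le_add
      (le_iSup₂ (f := fun t (_ : t ∈ Set.Ioc (0 : ℝ) 1) =>
        ENNReal.ofReal (t ^ (-α / 4)) * ⨆ x : Spacetime d, ‖Λ (QAt N t x)‖ₑ) t ht)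
      (le_iSup₂ (f := fun t (_ : t ∈ Set.Ioc (0 : ℝ) 1) =>
        ENNReal.ofReal (t ^ (-α / 4)) * ⨆ x : Spacetime d, ‖Λ' (QAt N t x)‖ₑ) t ht))
    rw [← mul_add]
    refine mul_le_mul_right (iSup_le fun x => ?_) _
    exact (enorm_add_le _ _).trans (add_le_add
      (le_iSup (fun x => ‖Λ (QAt N t x)‖ₑ) x) (le_iSup (fun x => ‖Λ' (QAt N t x)‖ₑ) x))

lemma holderENorm_smul {d : ℕ} (N : ℕ) (α : ℝ) (c : ℝ) (Λ : TempDist d) :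
    holderENorm N α (c • Λ) = ‖c‖ₑ * holderENorm N α Λ := by
  unfold holderENorm
  simp only [smul_apply, enorm_smul, ← ENNReal.mul_iSup, mul_add]
  simp only [mul_left_comm _ ‖c‖ₑ, ← ENNReal.mul_iSup]

/-- The distributions with finite `𝒞^α` norm. -/
def holderSubmodule (d N : ℕ) (α : ℝ) : Submodule ℝ (TempDist d) where
  carrier := {Λ | holderENorm N α Λ < ⊤}
  add_mem' ha hb := (holderENorm_add_le N α _ _).trans_lt (ENNReal.add_lt_top.2 ⟨ha, hb⟩)
  zero_mem' := by
    have h := holderENorm_smul N α (0 : ℝ) (0 : TempDist d)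
    simp only [zero_smul, enorm_zero, zero_mul] at h
    simp [h]
  smul_mem' c Λ h := by
    change holderENorm N α Λ < ⊤ at h
    change holderENorm N α (c • Λ) < ⊤
    rw [holderENorm_smul]
    exact ENNReal.mul_lt_top enorm_lt_top h

/-- The Hölder space `𝒞^α(ℝ × ℝᵈ)`, `α < 4N`. -/
def HolderSpace (d N : ℕ) (α : ℝ) : Type := holderSubmodule d N α

namespace HolderSpace

instance (d N : ℕ) (α : ℝ) : AddCommGroup (HolderSpace d N α) :=
  inferInstanceAs (AddCommGroup (holderSubmodule d N α))

instance (d N : ℕ) (α : ℝ) : Module ℝ (HolderSpace d N α) :=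
  inferInstanceAs (Module ℝ (holderSubmodule d N α))

/-- The underlying distribution. -/
def toDist {d N : ℕ} {α : ℝ} (Λ : HolderSpace d N α) : TempDist d := Subtype.val Λ

instance (d N : ℕ) (α : ℝ) : Norm (HolderSpace d N α) where
  norm Λ := (holderENorm N α Λ.toDist).toReal

lemma normCore (d N : ℕ) (α : ℝ) : SeminormedSpace.Core ℝ (HolderSpace d N α) where
  norm_nonneg _ := ENNReal.toReal_nonneg
  norm_smul c Λ := by
    change (holderENorm N α (c • Λ.toDist)).toReal = ‖c‖ * (holderENorm N α Λ.toDist).toReal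
    rw [holderENorm_smul, ENNReal.toReal_mul, toReal_enorm]
  norm_triangle Λ Λ' := by
    change (holderENorm N α (Λ.toDist + Λ'.toDist)).toReal
      ≤ (holderENorm N α Λ.toDist).toReal + (holderENorm N α Λ'.toDist).toReal
    have h : holderENorm N α Λ.toDist < ⊤ := Subtype.property Λ
    have h' : holderENorm N α Λ'.toDist < ⊤ := Subtype.property Λ'
    rw [← ENNReal.toReal_add h.ne h'.ne]
    exact ENNReal.toReal_mono (ENNReal.add_lt_top.2 ⟨h, h'⟩).ne (holderENorm_add_le N α _ _)

instance (d N : ℕ) (α : ℝ) : SeminormedAddCommGroup (HolderSpace d N α) :=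
  SeminormedAddCommGroup.ofCore (normCore d N α)

instance (d N : ℕ) (α : ℝ) : NormedSpace ℝ (HolderSpace d N α) where
  norm_smul_le c Λ := ((normCore d N α).norm_smul c Λ).le

end HolderSpace

/-! ### Concrete regularity structures -/

/-- The homogeneous component of degree `α` of the vector space `V` that is graded by giving a
degree to each element of a basis. -/
def gradedPart {V I : Type*} [AddCommGroup V] [Module ℝ V] (b : Module.Basis I ℝ V) (deg : I → ℝ)
    (α : ℝ) : Submodule ℝ V :=
  Submodule.span ℝ (b '' {i | deg i = α})

/-- A concrete regularity structure `((T⁺, Δ⁺), (T, Δ))`, with homogeneous bases `𝓑⁺` of `T⁺`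
(indexed by `Bp`) and `𝓑` of `T` (indexed by `B`). The coproduct `Δ⁺` and the counit are those of
the bialgebra `Tp`. -/
structure ConcreteRegularityStructure (Tp T Bp B : Type*) [Ring Tp] [Bialgebra ℝ Tp]
    [AddCommGroup T] [Module ℝ T] where
  /-- the grading of `T⁺` -/
  Ap : Set ℝ
  Ap_nonneg : ∀ α ∈ Ap, 0 ≤ α
  Ap_locallyFinite : ∀ a b : ℝ, (Ap ∩ Set.Icc a b).Finite
  zero_mem_Ap : (0 : ℝ) ∈ Ap
  add_mem_Ap : ∀ α ∈ Ap, ∀ β ∈ Ap, α + β ∈ Ap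
  /-- the basis `𝓑⁺` -/
  basisp : Module.Basis Bp ℝ Tp
  /-- the homogeneity of the elements of `𝓑⁺` -/
  degp : Bp → ℝ
  degp_mem : ∀ i, degp i ∈ Ap
  /-- each `T⁺_α` is finite dimensional -/
  degp_finite : ∀ α : ℝ, {i | degp i = α}.Finite
  /-- connectedness, `T⁺_0 = ⟨𝟏₊⟩` -/
  connected : gradedPart basisp degp 0 = Submodule.span ℝ {(1 : Tp)}
  mul_graded : ∀ α β : ℝ, ∀ σ ∈ gradedPart basisp degp α, ∀ τ ∈ gradedPart basisp degp β,
    σ * τ ∈ gradedPart basisp degp (α + β)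
  comul_graded : ∀ α : ℝ, ∀ τ ∈ gradedPart basisp degp α,
    (Coalgebra.comul (R := ℝ) τ : Tp ⊗[ℝ] Tp) ∈ ⨆ (μ : ℝ) (ν : ℝ) (_ : μ + ν = α),
      LinearMap.range
        (TensorProduct.mapIncl (gradedPart basisp degp μ) (gradedPart basisp degp ν))
  /-- the index set of the grading of `T` -/
  A : Set ℝ
  A_nonempty : A.Nonempty
  A_bddBelow : BddBelow A
  A_locallyFinite : ∀ a b : ℝ, (A ∩ Set.Icc a b).Finite
  /-- the basis `𝓑` -/
  basis : Module.Basis B ℝ T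
  /-- the homogeneity of the elements of `𝓑` -/
  deg : B → ℝ
  deg_mem : ∀ i, deg i ∈ A
  /-- each `T_β` is finite dimensional -/
  deg_finite : ∀ β : ℝ, {i | deg i = β}.Finite
  /-- the splitting map `Δ : T → T ⊗ T⁺` -/
  split : T →ₗ[ℝ] T ⊗[ℝ] Tp
  /-- `(Δ ⊗ Id) Δ = (Id ⊗ Δ⁺) Δ` -/
  split_coassoc : (TensorProduct.assoc ℝ T Tp Tp).toLinearMap ∘ₗ split.rTensor Tp ∘ₗ split
    = (Coalgebra.comul (R := ℝ) (A := Tp)).lTensor T ∘ₗ split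
  /-- `(Id ⊗ 𝟏₊') Δ = Id` -/
  split_counit : (TensorProduct.rid ℝ T).toLinearMap ∘ₗ
    (Coalgebra.counit (R := ℝ) (A := Tp)).lTensor T ∘ₗ split = LinearMap.id
  split_graded : ∀ β : ℝ, ∀ τ ∈ gradedPart basis deg β,
    split τ ∈ ⨆ (α : ℝ) (_ : 0 ≤ α), LinearMap.range
      (TensorProduct.mapIncl (gradedPart basis deg (β - α)) (gradedPart basisp degp α))

section

variable {Tp T Bp B : Type*} [Ring Tp] [Bialgebra ℝ Tp] [AddCommGroup T] [Module ℝ T]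

namespace ConcreteRegularityStructure

variable (𝒯 : ConcreteRegularityStructure Tp T Bp B)

/-- `β₀ = min A`. -/
def minHom : ℝ := sInf 𝒯.A

/-- `T_{<γ}`. -/
def TLt (γ : ℝ) : Submodule ℝ T := ⨆ (β : ℝ) (_ : β < γ), gradedPart 𝒯.basis 𝒯.deg β

/-- `‖τ‖_β`, the maximum norm in the basis of the component of `τ` in `T_β`. -/
def compENorm (β : ℝ) (τ : T) : ℝ≥0∞ := ⨆ (i : B) (_ : 𝒯.deg i = β), ‖𝒯.basis.repr τ i‖ₑ

/-- The map `ĝ = (Id ⊗ g) Δ : T → T` of a linear functional `g` on `T⁺`. -/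
def hat (g : Tp →ₗ[ℝ] ℝ) : T →ₗ[ℝ] T :=
  (TensorProduct.rid ℝ T).toLinearMap ∘ₗ g.lTensor T ∘ₗ 𝒯.split

lemma compENorm_add_le (β : ℝ) (σ τ : T) :
    𝒯.compENorm β (σ + τ) ≤ 𝒯.compENorm β σ + 𝒯.compENorm β τ := by
  refine iSup₂_le fun i hi => ?_
  rw [map_add, Finsupp.add_apply]
  exact (enorm_add_le _ _).trans (add_le_add
    (le_iSup₂ (f := fun i (_ : 𝒯.deg i = β) => ‖𝒯.basis.repr σ i‖ₑ) i hi)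
    (le_iSup₂ (f := fun i (_ : 𝒯.deg i = β) => ‖𝒯.basis.repr τ i‖ₑ) i hi))

lemma compENorm_smul (β c : ℝ) (τ : T) :
    𝒯.compENorm β (c • τ) = ‖c‖ₑ * 𝒯.compENorm β τ := by
  unfold compENorm
  simp only [map_smul, Finsupp.smul_apply, enorm_smul, ← ENNReal.mul_iSup]

end ConcreteRegularityStructure

/-! ### Characters and models -/

/-- The inverse `g⁻¹` of a character of `T⁺` for the convolution `(g₁ * g₂) τ = (g₁ ⊗ g₂) Δ⁺ τ`,
taken in the convolution algebra of all linear functionals on `T⁺`. -/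
def charInv (g : Tp →ₐ[ℝ] ℝ) : Tp →ₗ[ℝ] ℝ :=
  (Ring.inverse (WithConv.toConv g.toLinearMap)).ofConv

/-- `g_{yx} = g_y * g_x⁻¹`. -/
def transition {d : ℕ} (g : Spacetime d → Tp →ₐ[ℝ] ℝ) (y x : Spacetime d) : Tp →ₗ[ℝ] ℝ :=
  (WithConv.toConv (g y).toLinearMap * WithConv.toConv (charInv (g x))).ofConv

namespace ConcreteRegularityStructure

variable (𝒯 : ConcreteRegularityStructure Tp T Bp B)

/-- `‖g‖_γ`. (On the diagonal the quotient is `0 / 0 = 0`, or has denominator `1` for elements of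
homogeneity `0`.) -/
def gENorm {d : ℕ} (g : Spacetime d → Tp →ₐ[ℝ] ℝ) (γ : ℝ) : ℝ≥0∞ :=
  ⨆ (i : Bp) (_ : 𝒯.degp i < γ) (x : Spacetime d) (y : Spacetime d),
    ‖transition g y x (𝒯.basisp i)‖ₑ / ENNReal.ofReal (pdist y x ^ 𝒯.degp i)

/-- `Π_x^g = (Π ⊗ g_x⁻¹) Δ`. -/
def PiAt {d : ℕ} (g : Spacetime d → Tp →ₐ[ℝ] ℝ) (P : T →ₗ[ℝ] TempDist d) (x : Spacetime d) :
    T →ₗ[ℝ] TempDist d :=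
  (TensorProduct.rid ℝ (TempDist d)).toLinearMap ∘ₗ
    TensorProduct.map P (charInv (g x)) ∘ₗ 𝒯.split

/-- `‖Π^g‖_γ`. -/
def PiENorm {d : ℕ} (g : Spacetime d → Tp →ₐ[ℝ] ℝ) (P : T →ₗ[ℝ] TempDist d) (γ : ℝ) : ℝ≥0∞ :=
  ⨆ (i : B) (_ : 𝒯.deg i < γ) (x : Spacetime d) (t : ℝ) (_ : t ∈ Set.Ioc (0 : ℝ) 1),
    ENNReal.ofReal (t ^ (-𝒯.deg i / 4)) * ‖𝒯.PiAt g P x (𝒯.basis i) (heatAt t x)‖ₑ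

end ConcreteRegularityStructure

/-- A model `(Π, g)` over a regularity structure. -/
structure Model (d : ℕ) (𝒯 : ConcreteRegularityStructure Tp T Bp B) where
  /-- the map `g : ℝ × ℝᵈ → G⁺` -/
  g : Spacetime d → Tp →ₐ[ℝ] ℝ
  /-- the map `Π : T → 𝒮'` -/
  P : T →ₗ[ℝ] TempDist d
  g_bound : ∀ γ : ℝ, 𝒯.gENorm g γ < ⊤
  P_bound : ∀ γ : ℝ, 𝒯.PiENorm g P γ < ⊤

/-! ### Modelled distributions -/

namespace ConcreteRegularityStructure

variable (𝒯 : ConcreteRegularityStructure Tp T Bp B)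

/-- `⟦f⟧_{𝒟^γ} = max_{β < γ} sup_x ‖f(x)‖_β`. -/
def supENorm {d : ℕ} (γ : ℝ) (f : Spacetime d → T) : ℝ≥0∞ :=
  ⨆ (β : ℝ) (_ : β < γ) (x : Spacetime d), 𝒯.compENorm β (f x)

/-- `‖f‖_{𝒟^γ}`, the supremum of `‖f(y) - ĝ_{yx} f(x)‖_β / d(y, x)^{γ - β}`. (On the diagonal the
quotient is `0 / 0 = 0`.) -/
def incrENorm {d : ℕ} (g : Spacetime d → Tp →ₐ[ℝ] ℝ) (γ : ℝ) (f : Spacetime d → T) : ℝ≥0∞ :=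
  ⨆ (β : ℝ) (_ : β < γ) (x : Spacetime d) (y : Spacetime d),
    𝒯.compENorm β (f y - 𝒯.hat (transition g y x) (f x)) / ENNReal.ofReal (pdist y x ^ (γ - β))

lemma supENorm_add_le {d : ℕ} (γ : ℝ) (f h : Spacetime d → T) :
    𝒯.supENorm γ (f + h) ≤ 𝒯.supENorm γ f + 𝒯.supENorm γ h := by
  refine iSup₂_le fun β hβ => iSup_le fun x => ?_
  refine (𝒯.compENorm_add_le β (f x) (h x)).trans (add_le_add ?_ ?_)
  · exact le_iSup₂_of_le (f := fun β (_ : β < γ) => ⨆ x, 𝒯.compENorm β (f x)) β hβ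
      (le_iSup (fun x => 𝒯.compENorm β (f x)) x)
  · exact le_iSup₂_of_le (f := fun β (_ : β < γ) => ⨆ x, 𝒯.compENorm β (h x)) β hβ
      (le_iSup (fun x => 𝒯.compENorm β (h x)) x)

lemma supENorm_smul {d : ℕ} (γ c : ℝ) (f : Spacetime d → T) :
    𝒯.supENorm γ (c • f) = ‖c‖ₑ * 𝒯.supENorm γ f := by
  unfold supENorm
  simp only [Pi.smul_apply, compENorm_smul, ← ENNReal.mul_iSup]

lemma incrENorm_add_le {d : ℕ} (g : Spacetime d → Tp →ₐ[ℝ] ℝ) (γ : ℝ) (f h : Spacetime d → T) :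
    𝒯.incrENorm g γ (f + h) ≤ 𝒯.incrENorm g γ f + 𝒯.incrENorm g γ h := by
  refine iSup₂_le fun β hβ => iSup₂_le fun x y => ?_
  have key (k : Spacetime d → T) :
      𝒯.compENorm β (k y - 𝒯.hat (transition g y x) (k x)) / ENNReal.ofReal (pdist y x ^ (γ - β))
        ≤ 𝒯.incrENorm g γ k :=
    le_iSup₂_of_le (f := fun β (_ : β < γ) => ⨆ (x) (y),
      𝒯.compENorm β (k y - 𝒯.hat (transition g y x) (k x))
        / ENNReal.ofReal (pdist y x ^ (γ - β))) β hβ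
      (le_iSup₂ (f := fun x y => 𝒯.compENorm β (k y - 𝒯.hat (transition g y x) (k x))
        / ENNReal.ofReal (pdist y x ^ (γ - β))) x y)
  refine le_trans ?_ (add_le_add (key f) (key h))
  rw [← ENNReal.add_div]
  refine ENNReal.div_le_div_right ?_ _
  have e : (f + h) y - 𝒯.hat (transition g y x) ((f + h) x)
      = (f y - 𝒯.hat (transition g y x) (f x)) + (h y - 𝒯.hat (transition g y x) (h x)) := by
    simp only [Pi.add_apply, map_add]
    abel
  rw [e]
  exact 𝒯.compENorm_add_le β _ _

lemma incrENorm_smul {d : ℕ} (g : Spacetime d → Tp →ₐ[ℝ] ℝ) (γ c : ℝ) (f : Spacetime d → T) :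
    𝒯.incrENorm g γ (c • f) = ‖c‖ₑ * 𝒯.incrENorm g γ f := by
  unfold incrENorm
  simp only [Pi.smul_apply, map_smul, ← smul_sub, compENorm_smul, mul_div_assoc,
    ← ENNReal.mul_iSup]

/-- The functions with values in `T_{<γ}` for which both `𝒟^γ` norms are finite. -/
def modelledSubmodule {d : ℕ} (g : Spacetime d → Tp →ₐ[ℝ] ℝ) (γ : ℝ) :
    Submodule ℝ (Spacetime d → T) where
  carrier := {f | (∀ x, f x ∈ 𝒯.TLt γ) ∧ 𝒯.supENorm γ f < ⊤ ∧ 𝒯.incrENorm g γ f < ⊤}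
  add_mem' ha hb :=
    ⟨fun x => add_mem (ha.1 x) (hb.1 x),
      (𝒯.supENorm_add_le γ _ _).trans_lt (ENNReal.add_lt_top.2 ⟨ha.2.1, hb.2.1⟩),
      (𝒯.incrENorm_add_le g γ _ _).trans_lt (ENNReal.add_lt_top.2 ⟨ha.2.2, hb.2.2⟩)⟩
  zero_mem' := by
    have h := 𝒯.supENorm_smul γ 0 (0 : Spacetime d → T)
    have h' := 𝒯.incrENorm_smul g γ 0 (0 : Spacetime d → T)
    simp only [zero_smul, enorm_zero, zero_mul] at h h'
    exact ⟨fun x => zero_mem _, by simp [h], by simp [h']⟩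
  smul_mem' c f hf :=
    ⟨fun x => Submodule.smul_mem _ c (hf.1 x),
      by rw [supENorm_smul]; exact ENNReal.mul_lt_top enorm_lt_top hf.2.1,
      by rw [incrENorm_smul]; exact ENNReal.mul_lt_top enorm_lt_top hf.2.2⟩

end ConcreteRegularityStructure

/-- The space `𝒟^γ(T, g)` of modelled distributions. -/
def ModelledDistribution {d : ℕ} (𝒯 : ConcreteRegularityStructure Tp T Bp B)
    (g : Spacetime d → Tp →ₐ[ℝ] ℝ) (γ : ℝ) : Type _ := 𝒯.modelledSubmodule g γ

namespace ModelledDistribution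

variable {d : ℕ} {𝒯 : ConcreteRegularityStructure Tp T Bp B} {g : Spacetime d → Tp →ₐ[ℝ] ℝ}
  {γ : ℝ}

instance : AddCommGroup (ModelledDistribution 𝒯 g γ) :=
  inferInstanceAs (AddCommGroup (𝒯.modelledSubmodule g γ))

instance : Module ℝ (ModelledDistribution 𝒯 g γ) :=
  inferInstanceAs (Module ℝ (𝒯.modelledSubmodule g γ))

/-- The underlying `T`-valued function. -/
def toFun (f : ModelledDistribution 𝒯 g γ) : Spacetime d → T := Subtype.val f

/-- The seminorm `‖f‖_{𝒟^γ}`. -/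
def incrNorm (f : ModelledDistribution 𝒯 g γ) : ℝ := (𝒯.incrENorm g γ f.toFun).toReal

/-- The norm `⟦f⟧_{𝒟^γ} + ‖f‖_{𝒟^γ}`, which gives `𝒟^γ(T, g)` its topology. -/
instance : Norm (ModelledDistribution 𝒯 g γ) where
  norm f := (𝒯.supENorm γ f.toFun).toReal + f.incrNorm

lemma normCore : SeminormedSpace.Core ℝ (ModelledDistribution 𝒯 g γ) where
  norm_nonneg _ := add_nonneg ENNReal.toReal_nonneg ENNReal.toReal_nonneg
  norm_smul c f := by
    change (𝒯.supENorm γ (c • f.toFun)).toReal + (𝒯.incrENorm g γ (c • f.toFun)).toReal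
      = ‖c‖ * ((𝒯.supENorm γ f.toFun).toReal + (𝒯.incrENorm g γ f.toFun).toReal)
    rw [𝒯.supENorm_smul, 𝒯.incrENorm_smul, ENNReal.toReal_mul, ENNReal.toReal_mul, toReal_enorm,
      mul_add]
  norm_triangle f h := by
    change (𝒯.supENorm γ (f.toFun + h.toFun)).toReal
        + (𝒯.incrENorm g γ (f.toFun + h.toFun)).toReal
      ≤ ((𝒯.supENorm γ f.toFun).toReal + (𝒯.incrENorm g γ f.toFun).toReal)
        + ((𝒯.supENorm γ h.toFun).toReal + (𝒯.incrENorm g γ h.toFun).toReal)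
    have hf : 𝒯.supENorm γ f.toFun < ⊤ ∧ 𝒯.incrENorm g γ f.toFun < ⊤ := (Subtype.property f).2
    have hh : 𝒯.supENorm γ h.toFun < ⊤ ∧ 𝒯.incrENorm g γ h.toFun < ⊤ := (Subtype.property h).2
    rw [add_add_add_comm, ← ENNReal.toReal_add hf.1.ne hh.1.ne,
      ← ENNReal.toReal_add hf.2.ne hh.2.ne]
    exact add_le_add
      (ENNReal.toReal_mono (ENNReal.add_lt_top.2 ⟨hf.1, hh.1⟩).ne (𝒯.supENorm_add_le γ _ _))
      (ENNReal.toReal_mono (ENNReal.add_lt_top.2 ⟨hf.2, hh.2⟩).ne (𝒯.incrENorm_add_le g γ _ _))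

instance : SeminormedAddCommGroup (ModelledDistribution 𝒯 g γ) :=
  SeminormedAddCommGroup.ofCore normCore

instance : NormedSpace ℝ (ModelledDistribution 𝒯 g γ) where
  norm_smul_le c f := (normCore.norm_smul c f).le

end ModelledDistribution

/-! ### Reconstruction -/

namespace Model

variable {d : ℕ} {𝒯 : ConcreteRegularityStructure Tp T Bp B}

/-- `Π_x^g` for the model `M = (Π, g)`. -/
def PiX (M : Model d 𝒯) (x : Spacetime d) : T →ₗ[ℝ] TempDist d := 𝒯.PiAt M.g M.P x

/-- `‖Π^g‖_γ`, as a (finite) real number. -/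
def PiNorm (M : Model d 𝒯) (γ : ℝ) : ℝ := (𝒯.PiENorm M.g M.P γ).toReal

/-- The bound `|⟨R f - Π_x^g f(x), p_t(x, ·)⟩| ≤ C ‖Π^g‖_γ ‖f‖_{𝒟^γ} t^{γ/4}` for all modelled
distributions `f`, all points `x` and all `0 < t ≤ 1`. -/
def ReconstructionBound (M : Model d 𝒯) {γ : ℝ} {N : ℕ} {α : ℝ}
    (R : ModelledDistribution 𝒯 M.g γ →L[ℝ] HolderSpace d N α) (C : ℝ) : Prop :=
  ∀ (f : ModelledDistribution 𝒯 M.g γ) (x : Spacetime d) (t : ℝ), 0 < t → t ≤ 1 →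
    |((R f).toDist - M.PiX x (f.toFun x)) (heatAt t x)|
      ≤ C * M.PiNorm γ * f.incrNorm * t ^ (γ / 4)

end Model

end

end RegStruct

end

/-!
The identity `Π_y ĝ_{yx} = Π_x` turns a modelled distribution `f` into a coherent germ
`Λ_x = Π_x f(x)`: tested against `p_s(y, ·)`, the distributions `Λ_y` and `Λ_x` differ by at most a
sum of terms `s^(β/4) d(y, x)^(γ - β)` with `β < γ`. It remains to reconstruct coherent germs.

A distribution is recovered from its heat flow at times in `(0, 1]` by the Taylor expansion of
`t ↦ p_t` at time `t + 1`, whose integral remainder, when the order is large, converges although the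
flow of a distribution of regularity `α` is only of size `s^(α/4)`. The same formula attaches a
distribution to any family of functions `(G_s)` of size `s^(α/4)`, and its heat flow is `(G_s)` if
this family is propagated by the heat semigroup.

Let `F_s(x) = ⟨Λ_x, p_s(x, ·)⟩`. If `γ > 0`, coherence bounds the distance between
`p_{s - 2⁻ⁿ} ⋆ F_{2⁻ⁿ}` and its successor by a multiple of `2^(-nγ/4)`, so that these functions
converge, and their limits are propagated by the heat semigroup. If `γ < 0` they diverge, but the
formula can be applied to `G_s = p_{s/2} ⋆ F_{s/2}` itself: the error against `Λ_x` is an expansion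
with terms of size `t^(γ/4)`, and its remainder is of that size as well because `γ` is negative.

For `γ > 0` the heat flow of the difference of two reconstructions is of size `t^(γ/4)`. Since it
also tends to the difference as `t → 0`, the difference vanishes.
-/

open scoped SchwartzMap TensorProduct ENNReal FourierTransform

noncomputable section

namespace RegStruct

open MeasureTheory LineDeriv

/-! ### Schwartz functions and tempered distributions -/

section Translation

variable {E F : Type*} [NormedAddCommGroup E] [NormedSpace ℝ E]
  [NormedAddCommGroup F] [NormedSpace ℝ F]

/-- The translate `z ↦ φ (z - y)` of a Schwartz function. -/
abbrev translate (y : E) (φ : 𝓢(E, F)) : 𝓢(E, F) := SchwartzMap.compSubConstCLM ℝ y φ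

lemma translate_apply (y : E) (φ : 𝓢(E, F)) (z : E) : translate y φ z = φ (z - y) := rfl

lemma translate_zero (φ : 𝓢(E, F)) : translate 0 φ = φ := by
  ext z
  rw [translate_apply, sub_zero]

lemma lineDerivOp_translate (m y : E) (φ : 𝓢(E, F)) :
    ∂_{m} (translate y φ) = translate y (∂_{m} φ) := by
  ext x
  rw [translate_apply, SchwartzMap.lineDerivOp_apply_eq_fderiv,
    SchwartzMap.lineDerivOp_apply_eq_fderiv]
  exact DFunLike.congr_fun (fderiv_comp_sub (𝕜 := ℝ) (f := φ) y) m

lemma iteratedFDeriv_translate (n : ℕ) (y z : E) (φ : 𝓢(E, F)) :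
    iteratedFDeriv ℝ n (translate y φ) z = iteratedFDeriv ℝ n φ (z - y) :=
  iteratedFDeriv_comp_sub (𝕜 := ℝ) (f := φ) n y z

lemma exists_decay_bound (φ : 𝓢(E, F)) (k n : ℕ) :
    ∃ C : ℝ, 0 ≤ C ∧ ∀ w, (1 + ‖w‖) ^ k * ‖iteratedFDeriv ℝ n φ w‖ ≤ C :=
  ⟨_, by positivity, fun w => SchwartzMap.one_add_le_sup_seminorm_apply (𝕜 := ℝ) (m := (k, n))
    le_rfl le_rfl φ w⟩

lemma exists_seminorm_translate_le (φ : 𝓢(E, F)) (k n : ℕ) :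
    ∃ C : ℝ, 0 ≤ C ∧ ∀ y, SchwartzMap.seminorm ℝ k n (translate y φ) ≤ C * (1 + ‖y‖) ^ k := by
  obtain ⟨C, hC0, hC⟩ := exists_decay_bound φ k n
  refine ⟨C, hC0, fun y => SchwartzMap.seminorm_le_bound ℝ k n _ (by positivity) fun z => ?_⟩
  have hz : ‖z‖ ≤ (1 + ‖z - y‖) * (1 + ‖y‖) := by
    nlinarith [norm_le_norm_sub_add z y, norm_nonneg (z - y), norm_nonneg y]
  rw [iteratedFDeriv_translate]
  calc ‖z‖ ^ k * ‖iteratedFDeriv ℝ n φ (z - y)‖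
      ≤ ((1 + ‖z - y‖) * (1 + ‖y‖)) ^ k * ‖iteratedFDeriv ℝ n φ (z - y)‖ := by gcongr
    _ = ((1 + ‖z - y‖) ^ k * ‖iteratedFDeriv ℝ n φ (z - y)‖) * (1 + ‖y‖) ^ k := by
      rw [mul_pow]; ring
    _ ≤ C * (1 + ‖y‖) ^ k := by gcongr; exact hC _

lemma one_add_norm_le_of_mem_segment {y y' z w : E} (hw : w ∈ segment ℝ (z - y') (z - y)) :
    1 + ‖z‖ ≤ (1 + ‖w‖) * (1 + ‖y‖ + ‖y'‖) := by
  have hwz : dist w z ≤ max (dist (z - y') z) (dist (z - y) z) :=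
    (convexOn_dist z convex_univ).le_max_of_mem_segment trivial trivial hw
  have hmax : max (dist (z - y') z) (dist (z - y) z) ≤ ‖y‖ + ‖y'‖ := by
    simp
  have hz : ‖z‖ ≤ ‖w‖ + dist w z := by
    rw [dist_eq_norm]
    exact norm_le_insert w z
  nlinarith [norm_nonneg w, norm_nonneg y, norm_nonneg y']

lemma norm_iteratedFDeriv_sub_sub_le {φ : 𝓢(E, F)} {k n : ℕ} {C : ℝ}
    (hC : ∀ w, (1 + ‖w‖) ^ k * ‖iteratedFDeriv ℝ (n + 1) φ w‖ ≤ C) (y y' z : E) :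
    (1 + ‖z‖) ^ k * ‖iteratedFDeriv ℝ n φ (z - y) - iteratedFDeriv ℝ n φ (z - y')‖
      ≤ C * (1 + ‖y‖ + ‖y'‖) ^ k * ‖y - y'‖ := by
  have hdiff : Differentiable ℝ (iteratedFDeriv ℝ n φ) :=
    (φ.smooth ⊤).differentiable_iteratedFDeriv (mod_cast ENat.natCast_lt_top n)
  have hderiv (w : E) (hw : w ∈ segment ℝ (z - y') (z - y)) :
      ‖fderiv ℝ (iteratedFDeriv ℝ n φ) w‖ ≤ C * (1 + ‖y‖ + ‖y'‖) ^ k / (1 + ‖z‖) ^ k := by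
    rw [norm_fderiv_iteratedFDeriv, le_div_iff₀ (by positivity)]
    calc ‖iteratedFDeriv ℝ (n + 1) φ w‖ * (1 + ‖z‖) ^ k
        ≤ ‖iteratedFDeriv ℝ (n + 1) φ w‖ * ((1 + ‖w‖) * (1 + ‖y‖ + ‖y'‖)) ^ k := by
          gcongr
          exact one_add_norm_le_of_mem_segment hw
      _ = (1 + ‖w‖) ^ k * ‖iteratedFDeriv ℝ (n + 1) φ w‖ * (1 + ‖y‖ + ‖y'‖) ^ k := by
          rw [mul_pow]; ring
      _ ≤ C * (1 + ‖y‖ + ‖y'‖) ^ k := by gcongr; exact hC w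
  have hmean := (convex_segment (z - y') (z - y)).norm_image_sub_le_of_norm_fderiv_le (𝕜 := ℝ)
    (fun w _ => hdiff w) hderiv (left_mem_segment ℝ _ _) (right_mem_segment ℝ _ _)
  rwa [sub_sub_sub_cancel_left, norm_sub_rev y', div_mul_eq_mul_div, le_div_iff₀' (by positivity)]
    at hmean

lemma exists_seminorm_translate_sub_le (φ : 𝓢(E, F)) (k n : ℕ) :
    ∃ C : ℝ, 0 ≤ C ∧ ∀ y y', SchwartzMap.seminorm ℝ k n (translate y φ - translate y' φ)
      ≤ C * (1 + ‖y‖ + ‖y'‖) ^ k * ‖y - y'‖ := by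
  obtain ⟨C, hC0, hC⟩ := exists_decay_bound φ k (n + 1)
  refine ⟨C, hC0, fun y y' => SchwartzMap.seminorm_le_bound ℝ k n _ (by positivity) fun z => ?_⟩
  have hsub : iteratedFDeriv ℝ n (translate y φ - translate y' φ : 𝓢(E, F)) z
      = iteratedFDeriv ℝ n φ (z - y) - iteratedFDeriv ℝ n φ (z - y') := by
    rw [← iteratedFDeriv_translate, ← iteratedFDeriv_translate]
    exact iteratedFDeriv_sub_apply ((translate y φ).smooth n).contDiffAt
      ((translate y' φ).smooth n).contDiffAt
  rw [hsub]
  refine le_trans ?_ (norm_iteratedFDeriv_sub_sub_le hC y y' z)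
  gcongr
  linarith

end Translation

lemma continuous_of_local_lipschitz_bound {X Y : Type*} [SeminormedAddCommGroup X]
    [SeminormedAddCommGroup Y] {h : X → Y} {C : ℝ} {k : ℕ}
    (hh : ∀ y y', ‖h y - h y'‖ ≤ C * (1 + ‖y‖ + ‖y'‖) ^ k * ‖y - y'‖) : Continuous h := by
  refine continuous_iff_continuousAt.2 fun y' => tendsto_iff_norm_sub_tendsto_zero.2 ?_
  have hlim : Filter.Tendsto (fun y => C * (1 + ‖y‖ + ‖y'‖) ^ k * ‖y - y'‖) (nhds y') (nhds 0) := by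
    have : Continuous fun y => C * (1 + ‖y‖ + ‖y'‖) ^ k * ‖y - y'‖ := by fun_prop
    simpa using this.tendsto y'
  exact squeeze_zero (fun _ => norm_nonneg _) (fun y => hh y y') hlim

lemma exists_uniform_weighted_bound {ι X : Type*} [Finite ι] {a : ι → X → ℝ} {k : ι → ℕ}
    {w b : X → ℝ} (hw : ∀ x, 1 ≤ w x) (hb : ∀ x, 0 ≤ b x)
    (h : ∀ i, ∃ C : ℝ, 0 ≤ C ∧ ∀ x, a i x ≤ C * w x ^ k i * b x) :
    ∃ (C : ℝ) (m : ℕ), 0 ≤ C ∧ ∀ x i, a i x ≤ C * w x ^ m * b x := by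
  have := Fintype.ofFinite ι
  choose C hC0 hC using h
  refine ⟨∑ i, C i, Finset.univ.sup k, Finset.sum_nonneg fun i _ => hC0 i, fun x i => ?_⟩
  refine (hC i x).trans (mul_le_mul_of_nonneg_right ?_ (hb x))
  have hw0 : 0 ≤ w x := zero_le_one.trans (hw x)
  gcongr
  · exact Finset.sum_nonneg fun i _ => hC0 i
  · exact Finset.single_le_sum (fun i _ => hC0 i) (Finset.mem_univ i)
  · exact hw x
  · exact Finset.le_sup (Finset.mem_univ i)

lemma exists_extension_of_bound {𝕜 V W : Type*} [RCLike 𝕜] [AddCommGroup V] [Module 𝕜 V]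
    [SeminormedAddCommGroup W] [NormedSpace 𝕜 W] (J : V →ₗ[𝕜] W) (Λ : V →ₗ[𝕜] 𝕜) (C : ℝ)
    (h : ∀ φ, ‖Λ φ‖ ≤ C * ‖J φ‖) : ∃ L : W →L[𝕜] 𝕜, ∀ φ, L (J φ) = Λ φ := by
  have hker : LinearMap.ker J ≤ LinearMap.ker Λ := fun φ hφ => by
    have hΛφ := h φ
    rw [LinearMap.mem_ker.1 hφ, norm_zero, mul_zero] at hΛφ
    exact norm_le_zero_iff.1 hΛφ
  let Λ' : LinearMap.range J →ₗ[𝕜] 𝕜 :=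
    (LinearMap.ker J).liftQ Λ hker ∘ₗ J.quotKerEquivRange.symm.toLinearMap
  have hΛ' (φ : V) : Λ' ⟨J φ, LinearMap.mem_range_self J φ⟩ = Λ φ := by
    simp [Λ', LinearMap.quotKerEquivRange_symm_apply_image]
  have hbound (w : LinearMap.range J) : ‖Λ' w‖ ≤ C * ‖w‖ := by
    obtain ⟨_, φ, rfl⟩ := w
    rw [hΛ']
    exact h φ
  obtain ⟨L, hL, -⟩ := exists_extension_norm_eq (LinearMap.range J) (Λ'.mkContinuous C hbound)
  exact ⟨L, fun φ => (hL ⟨J φ, LinearMap.mem_range_self J φ⟩).trans (hΛ' φ)⟩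

section WeightedJet

variable {E F : Type*} [NormedAddCommGroup E] [NormedSpace ℝ E]
  [NormedAddCommGroup F] [NormedSpace ℝ F]

/-- The bounded continuous functions on `E` with values in the `n`-linear maps to `F`, as a type
synonym on which every instance is derived from the norm. -/
def BoundedForms (E F : Type*) [NormedAddCommGroup E] [NormedSpace ℝ E] [NormedAddCommGroup F]
    [NormedSpace ℝ F] (n : ℕ) : Type _ :=
  BoundedContinuousFunction E (E [×n]→L[ℝ] F)

namespace BoundedForms

instance (n : ℕ) : NormedAddCommGroup (BoundedForms E F n) :=
  inferInstanceAs (NormedAddCommGroup (BoundedContinuousFunction E (E [×n]→L[ℝ] F)))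

instance (n : ℕ) : NormedSpace ℝ (BoundedForms E F n) :=
  inferInstanceAs (NormedSpace ℝ (BoundedContinuousFunction E (E [×n]→L[ℝ] F)))

instance [CompleteSpace F] (n : ℕ) : CompleteSpace (BoundedForms E F n) :=
  inferInstanceAs (CompleteSpace (BoundedContinuousFunction E (E [×n]→L[ℝ] F)))

/-- Evaluation at the point `z` and the vectors `m`. -/
def eval {n : ℕ} (z : E) (m : Fin n → E) : BoundedForms E F n →L[ℝ] F :=
  (ContinuousMultilinearMap.apply ℝ (fun _ : Fin n => E) F m ∘L
    BoundedContinuousFunction.evalCLM ℝ z :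
      BoundedContinuousFunction E (E [×n]→L[ℝ] F) →L[ℝ] F)

lemma ext_eval {n : ℕ} {f g : BoundedForms E F n} (h : ∀ z m, eval z m f = eval z m g) : f = g :=
  BoundedContinuousFunction.ext fun z => ContinuousMultilinearMap.ext fun m => h z m

end BoundedForms

/-- The weighted derivative `z ↦ ‖z‖ᵏ Dⁿφ(z)` of a Schwartz function, as a bounded continuous
function. Its norm is the Schwartz seminorm of index `(k, n)`. -/
def weightedDeriv (k n : ℕ) :
    𝓢(E, F) →ₗ[ℝ] BoundedForms E F n where
  toFun φ := BoundedContinuousFunction.ofNormedAddCommGroup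
    (fun z => ‖z‖ ^ k • iteratedFDeriv ℝ n φ z)
    ((continuous_norm.pow k).smul ((φ.smooth n).continuous_iteratedFDeriv le_rfl))
    (SchwartzMap.seminorm ℝ k n φ) fun z => by
      rw [norm_smul, norm_pow, norm_norm]
      exact SchwartzMap.le_seminorm ℝ k n φ z
  map_add' φ χ := by
    refine BoundedContinuousFunction.ext fun z => ?_
    have hadd : iteratedFDeriv ℝ n (φ + χ : 𝓢(E, F)) z
        = iteratedFDeriv ℝ n φ z + iteratedFDeriv ℝ n χ z :=
      iteratedFDeriv_add_apply (φ.smooth n).contDiffAt (χ.smooth n).contDiffAt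
    exact (congrArg (‖z‖ ^ k • ·) hadd).trans (smul_add _ _ _)
  map_smul' c φ := by
    refine BoundedContinuousFunction.ext fun z => ?_
    have hsmul : iteratedFDeriv ℝ n (c • φ : 𝓢(E, F)) z = c • iteratedFDeriv ℝ n φ z :=
      iteratedFDeriv_const_smul_apply (φ.smooth n).contDiffAt
    exact (congrArg (‖z‖ ^ k • ·) hsmul).trans (smul_comm _ _ _)

lemma eval_weightedDeriv {n : ℕ} (k : ℕ) (φ : 𝓢(E, F)) (z : E) (m : Fin n → E) :
    BoundedForms.eval z m (weightedDeriv k n φ) = ‖z‖ ^ k • iteratedFDeriv ℝ n φ z m := rfl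

lemma norm_weightedDeriv (k n : ℕ) (φ : 𝓢(E, F)) :
    ‖weightedDeriv k n φ‖ = SchwartzMap.seminorm ℝ k n φ := by
  let f : BoundedContinuousFunction E (E [×n]→L[ℝ] F) := weightedDeriv k n φ
  have hnorm (z : E) : ‖f z‖ = ‖z‖ ^ k * ‖iteratedFDeriv ℝ n φ z‖ := by
    change ‖‖z‖ ^ k • iteratedFDeriv ℝ n φ z‖ = _
    rw [norm_smul, norm_pow, norm_norm]
  change ‖f‖ = _
  apply le_antisymm
  · refine (BoundedContinuousFunction.norm_le (apply_nonneg _ _)).2 fun z => ?_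
    rw [hnorm]
    exact SchwartzMap.le_seminorm ℝ k n φ z
  · refine SchwartzMap.seminorm_le_bound ℝ k n φ (norm_nonneg f) fun z => ?_
    rw [← hnorm]
    exact f.norm_coe_le_norm z

/-- The tuple of the weighted derivatives with indices in `s`. It maps Schwartz functions to a
Banach space, in which Bochner integrals and the Hahn-Banach theorem are available. -/
def weightedJet (s : Finset (ℕ × ℕ)) :
    𝓢(E, F) →ₗ[ℝ] (i : s) → BoundedForms E F i.1.2 :=
  LinearMap.pi fun i => weightedDeriv i.1.1 i.1.2

lemma weightedJet_apply (s : Finset (ℕ × ℕ)) (φ : 𝓢(E, F)) (i : s) :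
    weightedJet s φ i = weightedDeriv i.1.1 i.1.2 φ := rfl

lemma exists_weightedJet_extension (Λ : 𝓢(E, F) →L[ℝ] ℝ) :
    ∃ (s : Finset (ℕ × ℕ)) (L : ((i : s) → BoundedForms E F i.1.2) →L[ℝ] ℝ),
      ∀ φ, L (weightedJet s φ) = Λ φ := by
  obtain ⟨s, C, -, hC⟩ := Seminorm.bound_of_continuous (schwartz_withSeminorms ℝ E F)
    ((normSeminorm ℝ ℝ).comp Λ.toLinearMap) Λ.continuous.norm
  refine ⟨s, exists_extension_of_bound (weightedJet s) Λ.toLinearMap C fun φ => (hC φ).trans ?_⟩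
  refine mul_le_mul_of_nonneg_left ?_ C.2
  refine Seminorm.finset_sup_apply_le (norm_nonneg _) fun i hi => ?_
  exact (norm_weightedDeriv i.1 i.2 φ).symm.trans_le (norm_le_pi_norm (weightedJet s φ) ⟨i, hi⟩)

lemma exists_norm_weightedJet_translate_le (s : Finset (ℕ × ℕ)) (φ : 𝓢(E, F)) :
    ∃ (C : ℝ) (k : ℕ), 0 ≤ C ∧ ∀ y, ‖weightedJet s (translate y φ)‖ ≤ C * (1 + ‖y‖) ^ k := by
  obtain ⟨C, k, hC0, hC⟩ := exists_uniform_weighted_bound (X := E) (w := fun y => 1 + ‖y‖)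
    (b := 1) (a := fun (i : s) y => ‖weightedJet s (translate y φ) i‖) (k := fun i => i.1.1)
    (fun y => le_add_of_nonneg_right (norm_nonneg y)) (fun _ => zero_le_one) fun i => by
      simpa only [weightedJet_apply, norm_weightedDeriv, Pi.one_apply, mul_one]
        using exists_seminorm_translate_le φ i.1.1 i.1.2
  simp only [Pi.one_apply, mul_one] at hC
  exact ⟨C, k, hC0, fun y => (pi_norm_le_iff_of_nonneg (by positivity)).2 (hC y)⟩

lemma exists_norm_weightedJet_translate_sub_le (s : Finset (ℕ × ℕ)) (φ : 𝓢(E, F)) :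
    ∃ (C : ℝ) (k : ℕ), 0 ≤ C ∧ ∀ y y',
      ‖weightedJet s (translate y φ) - weightedJet s (translate y' φ)‖
        ≤ C * (1 + ‖y‖ + ‖y'‖) ^ k * ‖y - y'‖ := by
  obtain ⟨C, k, hC0, hC⟩ := exists_uniform_weighted_bound (X := E × E)
    (w := fun y => 1 + ‖y.1‖ + ‖y.2‖) (b := fun y => ‖y.1 - y.2‖)
    (a := fun (i : s) y => ‖weightedJet s (translate y.1 φ - translate y.2 φ) i‖)
    (k := fun i => i.1.1) (fun y => by linarith [norm_nonneg y.1, norm_nonneg y.2])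
    (fun _ => norm_nonneg _) fun i => by
      simpa only [weightedJet_apply, norm_weightedDeriv, Prod.forall]
        using exists_seminorm_translate_sub_le φ i.1.1 i.1.2
  refine ⟨C, k, hC0, fun y y' => ?_⟩
  rw [← map_sub]
  exact (pi_norm_le_iff_of_nonneg (by positivity)).2 (hC (y, y'))

lemma continuous_weightedJet_translate (s : Finset (ℕ × ℕ)) (φ : 𝓢(E, F)) :
    Continuous fun y => weightedJet s (translate y φ) := by
  obtain ⟨C, k, -, hC⟩ := exists_norm_weightedJet_translate_sub_le s φ
  exact continuous_of_local_lipschitz_bound hC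

lemma exists_translate_bound (Λ : 𝓢(E, F) →L[ℝ] ℝ) (φ : 𝓢(E, F)) :
    ∃ (C : ℝ) (k : ℕ), 0 ≤ C ∧ ∀ y, |Λ (translate y φ)| ≤ C * (1 + ‖y‖) ^ k := by
  obtain ⟨s, L, hL⟩ := exists_weightedJet_extension Λ
  obtain ⟨C, k, hC0, hC⟩ := exists_norm_weightedJet_translate_le s φ
  refine ⟨‖L‖ * C, k, by positivity, fun y => ?_⟩
  rw [← hL, mul_assoc]
  exact L.le_opNorm_of_le (hC y)

lemma exists_translate_sub_bound (Λ : 𝓢(E, F) →L[ℝ] ℝ) (φ : 𝓢(E, F)) :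
    ∃ (C : ℝ) (k : ℕ), 0 ≤ C ∧ ∀ y y', |Λ (translate y φ) - Λ (translate y' φ)|
      ≤ C * (1 + ‖y‖ + ‖y'‖) ^ k * ‖y - y'‖ := by
  obtain ⟨s, L, hL⟩ := exists_weightedJet_extension Λ
  obtain ⟨C, k, hC0, hC⟩ := exists_norm_weightedJet_translate_sub_le s φ
  refine ⟨‖L‖ * C, k, by positivity, fun y y' => ?_⟩
  rw [← hL, ← hL, ← map_sub L, mul_assoc, mul_assoc, ← mul_assoc C]
  exact L.le_opNorm_of_le (hC y y')

lemma continuous_apply_translate (Λ : 𝓢(E, F) →L[ℝ] ℝ) (φ : 𝓢(E, F)) :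
    Continuous fun y => Λ (translate y φ) := by
  obtain ⟨s, L, hL⟩ := exists_weightedJet_extension Λ
  exact (L.continuous.comp (continuous_weightedJet_translate s φ)).congr fun y => hL _

end WeightedJet

section Integrability

variable {E F X : Type*} [NormedAddCommGroup E] [NormedSpace ℝ E] [MeasurableSpace E]
  [BorelSpace E] [SecondCountableTopology E] {μ : Measure E} [hμ : μ.HasTemperateGrowth]
  [NormedAddCommGroup F] [NormedSpace ℝ F] [NormedAddCommGroup X] [NormedSpace ℝ X]

lemma integrable_one_add_norm_pow_mul (φ : 𝓢(E, F)) (k : ℕ) :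
    Integrable (fun y => (1 + ‖y‖) ^ k * ‖φ y‖) μ := by
  have h : ∀ j ∈ Finset.range (k + 1),
      Integrable (fun y : E => (k.choose j : ℝ) * (‖y‖ ^ j * ‖φ y‖)) μ := fun j _ =>
    (φ.integrable_pow_mul μ j).const_mul _
  refine (integrable_finsetSum _ h).congr (Filter.Eventually.of_forall fun y => ?_)
  simp only [add_comm (1 : ℝ), add_pow, one_pow, mul_one, Finset.sum_mul]
  exact Finset.sum_congr rfl fun j _ => by ring

lemma integrable_mul_of_poly_bound (φ : 𝓢(E, ℝ)) {h : E → X} (hh : AEStronglyMeasurable h μ)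
    {C : ℝ} {k : ℕ} (hb : ∀ y, ‖h y‖ ≤ C * (1 + ‖y‖) ^ k) : Integrable (fun y => φ y • h y) μ := by
  refine ((integrable_one_add_norm_pow_mul φ k).const_mul C).mono'
    (φ.continuous.aestronglyMeasurable.smul hh) (Filter.Eventually.of_forall fun y => ?_)
  calc ‖φ y • h y‖ ≤ ‖φ y‖ * (C * (1 + ‖y‖) ^ k) := by
        rw [norm_smul]
        gcongr
        exact hb y
    _ = C * ((1 + ‖y‖) ^ k * ‖φ y‖) := by ring

end Integrability

section Complexify

variable {E : Type*} [NormedAddCommGroup E] [NormedSpace ℝ E]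

/-- The inclusion of real into complex Schwartz functions, through which the Fourier transform and
the convolution of Schwartz functions become available for real ones. -/
def complexify : 𝓢(E, ℝ) →L[ℝ] 𝓢(E, ℂ) := SchwartzMap.postcompCLM Complex.ofRealCLM

lemma complexify_apply (φ : 𝓢(E, ℝ)) (x : E) : complexify φ x = (φ x : ℂ) := rfl

lemma complexify_injective : Function.Injective (complexify (E := E)) := fun φ χ h => by
  ext x
  exact Complex.ofReal_injective (DFunLike.congr_fun h x)

lemma lineDerivOp_postcompCLM {F G : Type*} [NormedAddCommGroup F] [NormedSpace ℝ F]
    [NormedAddCommGroup G] [NormedSpace ℝ G] (L : F →L[ℝ] G) (m : E) (f : 𝓢(E, F)) :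
    ∂_{m} (SchwartzMap.postcompCLM L f) = SchwartzMap.postcompCLM L (∂_{m} f) := by
  ext x
  rw [SchwartzMap.postcompCLM_apply, SchwartzMap.lineDerivOp_apply_eq_fderiv,
    SchwartzMap.lineDerivOp_apply_eq_fderiv]
  exact DFunLike.congr_fun (L.hasFDerivAt.comp x (f.hasFDerivAt x)).fderiv m

lemma lineDerivOp_complexify (m : E) (φ : 𝓢(E, ℝ)) :
    ∂_{m} (complexify φ) = complexify (∂_{m} φ) :=
  lineDerivOp_postcompCLM _ m φ

end Complexify

section Convolution

variable {E : Type*} [NormedAddCommGroup E] [InnerProductSpace ℝ E] [FiniteDimensional ℝ E]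
  [MeasurableSpace E] [BorelSpace E]

/-- The convolution of real Schwartz functions, the real part of the complex convolution. -/
def conv (p φ : 𝓢(E, ℝ)) : 𝓢(E, ℝ) :=
  SchwartzMap.postcompCLM Complex.reCLM
    (SchwartzMap.convolution (ContinuousLinearMap.mul ℂ ℂ) (complexify p) (complexify φ))

lemma convolution_complexify_apply (p φ : 𝓢(E, ℝ)) (x : E) :
    SchwartzMap.convolution (ContinuousLinearMap.mul ℂ ℂ) (complexify p) (complexify φ) x
      = ((∫ y, p y * φ (x - y) : ℝ) : ℂ) := by
  rw [SchwartzMap.convolution_apply, MeasureTheory.convolution_def, ← integral_complex_ofReal]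
  refine integral_congr_ae (Filter.Eventually.of_forall fun y => ?_)
  simp [complexify_apply]

lemma conv_apply (p φ : 𝓢(E, ℝ)) (x : E) : conv p φ x = ∫ y, p y * φ (x - y) := by
  rw [conv, SchwartzMap.postcompCLM_apply, convolution_complexify_apply, Complex.reCLM_apply,
    Complex.ofReal_re]

lemma complexify_conv (p φ : 𝓢(E, ℝ)) : complexify (conv p φ)
    = SchwartzMap.convolution (ContinuousLinearMap.mul ℂ ℂ) (complexify p) (complexify φ) := by
  ext x
  rw [complexify_apply, conv_apply, convolution_complexify_apply]

lemma conv_comm (p φ : 𝓢(E, ℝ)) : conv p φ = conv φ p := by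
  ext x
  rw [conv_apply, conv_apply, ← integral_sub_left_eq_self _ _ x]
  refine integral_congr_ae (Filter.Eventually.of_forall fun y => ?_)
  simp [mul_comm]

lemma fourier_complexify_conv (p φ : 𝓢(E, ℝ)) (ξ : E) :
    𝓕 (complexify (conv p φ)) ξ = 𝓕 (complexify p) ξ * 𝓕 (complexify φ) ξ := by
  rw [complexify_conv, SchwartzMap.fourier_convolution, SchwartzMap.pairing_apply_apply]
  rfl

lemma fourier_complexify_lineDerivOp (m : E) (φ : 𝓢(E, ℝ)) (ξ : E) :
    𝓕 (complexify (∂_{m} φ)) ξ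
      = (2 * Real.pi * Complex.I) * ((inner ℝ ξ m : ℝ) : ℂ) * 𝓕 (complexify φ) ξ := by
  have hm : (inner ℝ · m : E → ℝ).HasTemperateGrowth :=
    ((innerSL ℝ).flip m).hasTemperateGrowth
  rw [← lineDerivOp_complexify, SchwartzMap.fourier_lineDerivOp_eq]
  simp [SchwartzMap.smulLeftCLM_apply_apply hm, mul_assoc]

lemma fourier_complexify_sub (φ χ : 𝓢(E, ℝ)) (ξ : E) :
    𝓕 (complexify (φ - χ)) ξ = 𝓕 (complexify φ) ξ - 𝓕 (complexify χ) ξ := by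
  rw [map_sub]
  exact DFunLike.congr_fun (map_sub (FourierTransform.fourierCLM ℂ 𝓢(E, ℂ)) _ _) ξ

lemma fourier_complexify_sum {ι : Type*} (s : Finset ι) (φ : ι → 𝓢(E, ℝ)) (ξ : E) :
    𝓕 (complexify (∑ i ∈ s, φ i)) ξ = ∑ i ∈ s, 𝓕 (complexify (φ i)) ξ := by
  rw [map_sum, ← sum_apply]
  exact DFunLike.congr_fun (map_sum (FourierTransform.fourierCLM ℂ 𝓢(E, ℂ)) _ s) ξ

lemma fourier_complexify_injective {φ χ : 𝓢(E, ℝ)}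
    (h : ∀ ξ, 𝓕 (complexify φ) ξ = 𝓕 (complexify χ) ξ) : φ = χ := by
  have hcongr := congrArg (fun f : 𝓢(E, ℂ) => (𝓕⁻ f : 𝓢(E, ℂ))) (SchwartzMap.ext h)
  apply complexify_injective
  simpa only [FourierTransform.fourierInv_fourier_eq] using hcongr

lemma lineDerivOp_conv (m : E) (p φ : 𝓢(E, ℝ)) : ∂_{m} (conv p φ) = conv p (∂_{m} φ) := by
  refine fourier_complexify_injective fun ξ => ?_
  rw [fourier_complexify_lineDerivOp, fourier_complexify_conv, fourier_complexify_conv,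
    fourier_complexify_lineDerivOp]
  ring

lemma iteratedLineDerivOp_conv {n : ℕ} (m : Fin n → E) (p φ : 𝓢(E, ℝ)) :
    ∂^{m} (conv p φ) = conv p (∂^{m} φ) := by
  induction n with
  | zero => simp
  | succ n ih => rw [iteratedLineDerivOp_succ_left, iteratedLineDerivOp_succ_left, ih,
      lineDerivOp_conv]

lemma integrable_smul_weightedJet_translate (s : Finset (ℕ × ℕ)) (p φ : 𝓢(E, ℝ)) :
    Integrable fun y => p y • weightedJet s (translate y φ) := by
  obtain ⟨C, k, -, hC⟩ := exists_norm_weightedJet_translate_le s φ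
  exact integrable_mul_of_poly_bound p
    (continuous_weightedJet_translate s φ).aestronglyMeasurable hC

lemma iteratedFDeriv_conv_apply {n : ℕ} (p φ : 𝓢(E, ℝ)) (z : E) (m : Fin n → E) :
    iteratedFDeriv ℝ n (conv p φ) z m
      = ∫ y, p y * iteratedFDeriv ℝ n (translate y φ) z m := by
  rw [← SchwartzMap.iteratedLineDerivOp_eq_iteratedFDeriv, iteratedLineDerivOp_conv, conv_apply]
  simp only [SchwartzMap.iteratedLineDerivOp_eq_iteratedFDeriv, iteratedFDeriv_translate]

lemma weightedJet_conv (s : Finset (ℕ × ℕ)) (p φ : 𝓢(E, ℝ)) :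
    weightedJet s (conv p φ) = ∫ y, p y • weightedJet s (translate y φ) := by
  funext i
  refine BoundedForms.ext_eval fun z m => ?_
  let ev : ((i : s) → BoundedForms E ℝ i.1.2) →L[ℝ] ℝ :=
    BoundedForms.eval z m ∘L ContinuousLinearMap.proj i
  have hev (φ : 𝓢(E, ℝ)) : ev (weightedJet s φ) = ‖z‖ ^ i.1.1 * iteratedFDeriv ℝ i.1.2 φ z m :=
    eval_weightedDeriv i.1.1 φ z m
  change ev (weightedJet s (conv p φ)) = ev (∫ y, p y • weightedJet s (translate y φ))
  rw [← ev.integral_comp_comm (integrable_smul_weightedJet_translate s p φ), hev,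
    iteratedFDeriv_conv_apply, ← integral_const_mul]
  refine integral_congr_ae (Filter.Eventually.of_forall fun y => ?_)
  simp only [map_smul, hev, smul_eq_mul]
  ring

theorem apply_conv (Λ : 𝓢(E, ℝ) →L[ℝ] ℝ) (p φ : 𝓢(E, ℝ)) :
    Λ (conv p φ) = ∫ y, p y * Λ (translate y φ) := by
  obtain ⟨s, L, hL⟩ := exists_weightedJet_extension Λ
  rw [← hL, weightedJet_conv, ← L.integral_comp_comm (integrable_smul_weightedJet_translate s p φ)]
  simp only [map_smul, hL, smul_eq_mul]

end Convolution

variable {d : ℕ}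

/-! ### The derivatives of the heat kernel -/

lemma symbolG_nonneg (ξ : Spacetime d) : 0 ≤ symbolG ξ := by unfold symbolG; positivity

lemma symbolG_neg (ξ : Spacetime d) : symbolG (-ξ) = symbolG ξ := by simp [symbolG]

lemma continuous_symbolG : Continuous (symbolG : Spacetime d → ℝ) :=
  (symbolG_hasTemperateGrowth d).1.continuous

lemma partialD_apply (i : Fin (d + 1)) (φ : 𝓢(Spacetime d, ℝ)) :
    partialD d i φ = ∂_{EuclideanSpace.single i (1 : ℝ)} φ := rfl

lemma fourier_partialD (i : Fin (d + 1)) (φ : 𝓢(Spacetime d, ℝ)) (ξ : Spacetime d) :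
    𝓕 (complexify (partialD d i φ)) ξ
      = (2 * Real.pi * Complex.I) * (ξ i : ℂ) * 𝓕 (complexify φ) ξ := by
  rw [partialD_apply, fourier_complexify_lineDerivOp]
  simp [EuclideanSpace.inner_single_right]

lemma fourier_spatialLaplacian (φ : 𝓢(Spacetime d, ℝ)) (ξ : Spacetime d) :
    𝓕 (complexify (spatialLaplacian d φ)) ξ
      = -((∑ i : Fin d, (2 * Real.pi * ξ i.succ) ^ 2 : ℝ) : ℂ) * 𝓕 (complexify φ) ξ := by
  have h : spatialLaplacian d φ = ∑ i : Fin d, partialD d i.succ (partialD d i.succ φ) := by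
    simp [spatialLaplacian]
  rw [h, fourier_complexify_sum]
  push_cast
  rw [← Finset.sum_neg_distrib, Finset.sum_mul]
  refine Finset.sum_congr rfl fun i _ => ?_
  rw [fourier_partialD, fourier_partialD]
  ring_nf
  rw [Complex.I_sq]
  ring

lemma fourier_opG (φ : 𝓢(Spacetime d, ℝ)) (ξ : Spacetime d) :
    𝓕 (complexify (opG d φ)) ξ = ((-symbolG ξ : ℝ) : ℂ) * 𝓕 (complexify φ) ξ := by
  have h : opG d φ = partialD d 0 (partialD d 0 φ)
      - spatialLaplacian d (spatialLaplacian d φ) := rfl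
  rw [h, fourier_complexify_sub, fourier_partialD, fourier_partialD, fourier_spatialLaplacian,
    fourier_spatialLaplacian, symbolG]
  push_cast
  ring_nf
  rw [Complex.I_sq]
  ring

lemma fourier_opG_pow (j : ℕ) (φ : 𝓢(Spacetime d, ℝ)) (ξ : Spacetime d) :
    𝓕 (complexify ((opG d ^ j) φ)) ξ = (((-symbolG ξ) ^ j : ℝ) : ℂ) * 𝓕 (complexify φ) ξ := by
  induction j with
  | zero => simp
  | succ j ih =>
    have h : (opG d ^ (j + 1)) φ = opG d ((opG d ^ j) φ) := by rw [pow_succ']; rfl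
    rw [h, fourier_opG, ih]
    push_cast
    ring

/-- The kernel of `𝒢ʲ exp (t𝒢)`, that is, `𝒢ʲ pₜ = ∂ₜʲ pₜ`. -/
def heatDeriv (d j : ℕ) (t : ℝ) : 𝓢(Spacetime d, ℝ) := (opG d ^ j) (heatKernel d t)

lemma heatKernel_of_nonpos {t : ℝ} (ht : t ≤ 0) : heatKernel d t = 0 := by
  rw [heatKernel, dif_neg ht.not_gt]

lemma heatDeriv_zero (t : ℝ) : heatDeriv d 0 t = heatKernel d t := rfl

lemma heatDeriv_of_nonpos {t : ℝ} (ht : t ≤ 0) (j : ℕ) : heatDeriv d j t = 0 := by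
  rw [heatDeriv, heatKernel_of_nonpos ht, map_zero]

lemma conj_fourierInv_of_even {f : Spacetime d → ℝ} (hf : ∀ ξ, f (-ξ) = f ξ) (x : Spacetime d) :
    (starRingEnd ℂ) (𝓕⁻ (fun ξ => (f ξ : ℂ)) x) = 𝓕⁻ (fun ξ => (f ξ : ℂ)) x := by
  rw [Real.fourierInv_eq', ← integral_conj, ← integral_neg_eq_self]
  refine integral_congr_ae (Filter.Eventually.of_forall fun ξ => ?_)
  simp only [smul_eq_mul, map_mul, Complex.conj_ofReal, hf, ← Complex.exp_conj, Complex.conj_I]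
  congr 2
  simp [inner_neg_left]

lemma complexify_heatKernel {t : ℝ} (ht : 0 < t) : complexify (heatKernel d t)
    = (𝓕⁻ (complexify (heatSymbol d t ht)) : 𝓢(Spacetime d, ℂ)) := by
  ext x
  have heven (ξ : Spacetime d) : heatSymbol d t ht (-ξ) = heatSymbol d t ht ξ := by
    change Real.exp (-t * symbolG (-ξ)) = Real.exp (-t * symbolG ξ)
    rw [symbolG_neg]
  have hreal : (starRingEnd ℂ) ((𝓕⁻ (complexify (heatSymbol d t ht)) : 𝓢(Spacetime d, ℂ)) x)
      = (𝓕⁻ (complexify (heatSymbol d t ht)) : 𝓢(Spacetime d, ℂ)) x := by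
    rw [SchwartzMap.fourierInv_coe]
    exact conj_fourierInv_of_even heven x
  rw [complexify_apply, heatKernel, dif_pos ht]
  exact Complex.conj_eq_iff_re.1 hreal

lemma fourier_heatKernel {t : ℝ} (ht : 0 < t) (ξ : Spacetime d) :
    𝓕 (complexify (heatKernel d t)) ξ = (Real.exp (-t * symbolG ξ) : ℂ) := by
  rw [complexify_heatKernel ht, FourierTransform.fourier_fourierInv_eq]
  rfl

/-- The symbol of the Fourier multiplier `𝒢ʲ exp (t𝒢)`. -/
def heatMultiplier (j : ℕ) (t : ℝ) (ξ : Spacetime d) : ℝ :=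
  (-symbolG ξ) ^ j * Real.exp (-t * symbolG ξ)

lemma abs_heatMultiplier (j : ℕ) (t : ℝ) (ξ : Spacetime d) :
    |heatMultiplier j t ξ| = symbolG ξ ^ j * Real.exp (-t * symbolG ξ) := by
  rw [heatMultiplier, abs_mul, abs_pow, abs_neg, abs_of_nonneg (symbolG_nonneg ξ), Real.abs_exp]

lemma abs_heatMultiplier_anti (j : ℕ) (ξ : Spacetime d) :
    Antitone fun t => |heatMultiplier j t ξ| := fun s t hst => by
  have hsymbol := symbolG_nonneg ξ
  simp only [abs_heatMultiplier]
  gcongr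

lemma heatMultiplier_mul (i j : ℕ) (s t : ℝ) (ξ : Spacetime d) :
    heatMultiplier i s ξ * heatMultiplier j t ξ = heatMultiplier (i + j) (s + t) ξ := by
  simp only [heatMultiplier, neg_add, add_mul, Real.exp_add, pow_add]
  ring

lemma continuous_heatMultiplier (j : ℕ) :
    Continuous fun p : ℝ × Spacetime d => heatMultiplier j p.1 p.2 := by
  have := continuous_symbolG (d := d)
  unfold heatMultiplier
  fun_prop

lemma hasDerivAt_heatMultiplier (j : ℕ) (t : ℝ) (ξ : Spacetime d) :
    HasDerivAt (fun s => heatMultiplier j s ξ) (heatMultiplier (j + 1) t ξ) t := by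
  refine ((((hasDerivAt_neg t).mul_const (symbolG ξ)).exp).const_mul
    ((-symbolG ξ) ^ j)).congr_deriv ?_
  rw [heatMultiplier]
  ring

lemma fourier_heatDeriv (j : ℕ) {t : ℝ} (ht : 0 < t) (ξ : Spacetime d) :
    𝓕 (complexify (heatDeriv d j t)) ξ = (heatMultiplier j t ξ : ℂ) := by
  rw [heatDeriv, fourier_opG_pow, fourier_heatKernel ht, heatMultiplier, Complex.ofReal_mul]

lemma conv_heatDeriv (i j : ℕ) {s t : ℝ} (hs : 0 < s) (ht : 0 < t) :
    conv (heatDeriv d i s) (heatDeriv d j t) = heatDeriv d (i + j) (s + t) := by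
  refine fourier_complexify_injective fun ξ => ?_
  rw [fourier_complexify_conv, fourier_heatDeriv _ hs, fourier_heatDeriv _ ht,
    fourier_heatDeriv _ (add_pos hs ht), ← Complex.ofReal_mul, heatMultiplier_mul]

/-- The inverse Fourier transform of `heatMultiplier`, which is even, as a cosine integral; for
`t > 0` this is `𝒢ʲ pₜ`. Unlike `heatDeriv` it is visibly measurable and differentiable in `t`. -/
def heatCosIntegral (d j : ℕ) (t : ℝ) (y : Spacetime d) : ℝ :=
  ∫ ξ : Spacetime d, Real.cos (2 * Real.pi * inner ℝ ξ y) * heatMultiplier j t ξ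

lemma integrable_heatMultiplier (j : ℕ) {t : ℝ} (ht : 0 < t) :
    Integrable fun ξ : Spacetime d => heatMultiplier j t ξ := by
  have hfourier : ((𝓕 (complexify (heatDeriv d j t)) : 𝓢(Spacetime d, ℂ)) : Spacetime d → ℂ)
      = fun ξ => (heatMultiplier j t ξ : ℂ) := funext (fourier_heatDeriv j ht)
  have hint := SchwartzMap.integrable (𝓕 (complexify (heatDeriv d j t)) : 𝓢(Spacetime d, ℂ))
    (μ := volume)
  rw [hfourier] at hint
  simpa using hint.re

lemma integrable_exp_smul_heatMultiplier (j : ℕ) {t : ℝ} (ht : 0 < t) (y : Spacetime d) :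
    Integrable fun ξ : Spacetime d =>
      Complex.exp (((2 * Real.pi * inner ℝ ξ y : ℝ) : ℂ) * Complex.I) •
        (heatMultiplier j t ξ : ℂ) := by
  refine (integrable_heatMultiplier j ht).norm.mono' ?_ (Filter.Eventually.of_forall fun ξ => ?_)
  · refine Continuous.aestronglyMeasurable ?_
    have : Continuous fun ξ : Spacetime d => heatMultiplier j t ξ :=
      (continuous_heatMultiplier j).comp (.prodMk_right t)
    fun_prop
  · rw [norm_smul, Complex.norm_exp_ofReal_mul_I, one_mul, Complex.norm_real]

lemma complexify_heatDeriv_eq_fourierInv (j : ℕ) {t : ℝ} (ht : 0 < t) (y : Spacetime d) :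
    complexify (heatDeriv d j t) y = 𝓕⁻ (fun ξ => (heatMultiplier j t ξ : ℂ)) y := by
  have hinv : complexify (heatDeriv d j t)
      = (𝓕⁻ (𝓕 (complexify (heatDeriv d j t)) : 𝓢(Spacetime d, ℂ)) : 𝓢(Spacetime d, ℂ)) :=
    (FourierTransform.fourierInv_fourier_eq _).symm
  rw [hinv, SchwartzMap.fourierInv_coe]
  exact congrArg (fun f : Spacetime d → ℂ => 𝓕⁻ f y) (funext (fourier_heatDeriv j ht))

lemma heatDeriv_apply (j : ℕ) {t : ℝ} (ht : 0 < t) (y : Spacetime d) :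
    heatDeriv d j t y = heatCosIntegral d j t y := by
  have hre := congrArg Complex.reCLM (complexify_heatDeriv_eq_fourierInv j ht y)
  rw [Real.fourierInv_eq', ← Complex.reCLM.integral_comp_comm
    (integrable_exp_smul_heatMultiplier j ht y)] at hre
  rw [heatCosIntegral]
  simpa only [complexify_apply, Complex.reCLM_apply, Complex.ofReal_re, smul_eq_mul,
    Complex.re_mul_ofReal, Complex.exp_ofReal_mul_I_re] using hre

lemma heatCosIntegral_neg (j : ℕ) (t : ℝ) (y : Spacetime d) :
    heatCosIntegral d j t (-y) = heatCosIntegral d j t y := by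
  simp [heatCosIntegral, inner_neg_right]

lemma heatDeriv_neg (j : ℕ) (t : ℝ) (y : Spacetime d) :
    heatDeriv d j t (-y) = heatDeriv d j t y := by
  rcases le_or_gt t 0 with ht | ht
  · simp [heatDeriv_of_nonpos ht]
  · rw [heatDeriv_apply j ht, heatDeriv_apply j ht, heatCosIntegral_neg]

lemma measurable_heatCosIntegral (j : ℕ) :
    Measurable fun p : ℝ × Spacetime d => heatCosIntegral d j p.1 p.2 := by
  have hcont : Continuous fun q : (ℝ × Spacetime d) × Spacetime d =>
      Real.cos (2 * Real.pi * inner ℝ q.2 q.1.2) * heatMultiplier j q.1.1 q.2 := by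
    have := (continuous_heatMultiplier (d := d) j).comp
      (by fun_prop : Continuous fun q : (ℝ × Spacetime d) × Spacetime d => (q.1.1, q.2))
    exact Continuous.mul (by fun_prop) this
  exact (hcont.stronglyMeasurable.integral_prod_right' (ν := volume)).measurable

lemma measurable_heatDeriv (j : ℕ) :
    Measurable fun p : ℝ × Spacetime d => heatDeriv d j p.1 p.2 := by
  have hindicator : (fun p : ℝ × Spacetime d => heatDeriv d j p.1 p.2)
      = {p : ℝ × Spacetime d | 0 < p.1}.indicator fun p => heatCosIntegral d j p.1 p.2 := by
    funext p
    by_cases hp : 0 < p.1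
    · rw [Set.indicator_of_mem (by exact hp), heatDeriv_apply j hp]
    · rw [Set.indicator_of_notMem (by exact hp), heatDeriv_of_nonpos (not_lt.1 hp)]
      rfl
  rw [hindicator]
  exact (measurable_heatCosIntegral j).indicator (measurableSet_lt measurable_const measurable_fst)

lemma hasDerivAt_heatCosIntegral (j : ℕ) {t : ℝ} (ht : 0 < t) (y : Spacetime d) :
    HasDerivAt (fun s => heatCosIntegral d j s y) (heatCosIntegral d (j + 1) t y) t := by
  have hmeas (i : ℕ) (s : ℝ) : AEStronglyMeasurable fun ξ : Spacetime d =>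
      Real.cos (2 * Real.pi * inner ℝ ξ y) * heatMultiplier i s ξ := by
    have : Continuous fun ξ : Spacetime d => heatMultiplier i s ξ :=
      (continuous_heatMultiplier i).comp (.prodMk_right s)
    exact Continuous.aestronglyMeasurable (by fun_prop)
  have hbound (i : ℕ) (s : ℝ) (ξ : Spacetime d) :
      ‖Real.cos (2 * Real.pi * inner ℝ ξ y) * heatMultiplier i s ξ‖ ≤ ‖heatMultiplier i s ξ‖ := by
    rw [norm_mul]
    exact mul_le_of_le_one_left (norm_nonneg _) (Real.abs_cos_le_one _)
  refine (hasDerivAt_integral_of_dominated_loc_of_deriv_le (𝕜 := ℝ)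
    (F' := fun s ξ => Real.cos (2 * Real.pi * inner ℝ ξ y) * heatMultiplier (j + 1) s ξ)
    (bound := fun ξ => ‖heatMultiplier (j + 1) (t / 2) ξ‖)
    (Ioi_mem_nhds (half_lt_self ht)) (Filter.Eventually.of_forall (hmeas j)) ?_ (hmeas (j + 1) t)
    ?_ (integrable_heatMultiplier _ (half_pos ht)).norm ?_).2
  · exact (integrable_heatMultiplier j ht).norm.mono' (hmeas j t)
      (Filter.Eventually.of_forall (hbound j t))
  · exact Filter.Eventually.of_forall fun ξ s (hs : t / 2 < s) =>
      (hbound (j + 1) s ξ).trans (abs_heatMultiplier_anti _ ξ hs.le)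
  · exact Filter.Eventually.of_forall fun ξ s _ => (hasDerivAt_heatMultiplier j s ξ).const_mul _

lemma hasDerivAt_heatDeriv (j : ℕ) {t : ℝ} (ht : 0 < t) (y : Spacetime d) :
    HasDerivAt (fun s => heatDeriv d j s y) (heatDeriv d (j + 1) t y) t := by
  rw [heatDeriv_apply _ ht]
  refine (hasDerivAt_heatCosIntegral j ht y).congr_of_eventuallyEq ?_
  filter_upwards [lt_mem_nhds ht] with s hs using heatDeriv_apply j hs y

lemma integral_heatKernel {t : ℝ} (ht : 0 < t) : ∫ y, heatKernel d t y = 1 := by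
  have h := fourier_heatKernel (d := d) ht 0
  rw [SchwartzMap.fourier_coe, Real.fourier_eq'] at h
  simp only [inner_zero_right, mul_zero, Complex.ofReal_zero, zero_mul, Complex.exp_zero,
    one_smul, complexify_apply] at h
  rw [integral_complex_ofReal] at h
  have hzero : symbolG (0 : Spacetime d) = 0 := by simp [symbolG]
  rw [hzero, mul_zero, Real.exp_zero] at h
  exact_mod_cast h

lemma opG_translate (x : Spacetime d) (φ : 𝓢(Spacetime d, ℝ)) :
    opG d (translate x φ) = translate x (opG d φ) := by
  have hp (i : Fin (d + 1)) (φ : 𝓢(Spacetime d, ℝ)) :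
      partialD d i (translate x φ) = translate x (partialD d i φ) := lineDerivOp_translate _ x φ
  have hl (φ : 𝓢(Spacetime d, ℝ)) :
      spatialLaplacian d (translate x φ) = translate x (spatialLaplacian d φ) := by
    simp only [spatialLaplacian, sum_apply, ContinuousLinearMap.comp_apply, hp, map_sum]
  simp only [opG, sub_apply, ContinuousLinearMap.comp_apply, hp, hl, map_sub]

lemma opG_pow_translate (j : ℕ) (x : Spacetime d) (φ : 𝓢(Spacetime d, ℝ)) :
    (opG d ^ j) (translate x φ) = translate x ((opG d ^ j) φ) := by
  induction j with
  | zero => simp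
  | succ j ih =>
    have h (φ : 𝓢(Spacetime d, ℝ)) : (opG d ^ (j + 1)) φ = opG d ((opG d ^ j) φ) := by
      rw [pow_succ']; rfl
    rw [h, h, ih, opG_translate]

lemma opG_pow_heatAt (j : ℕ) (t : ℝ) (x : Spacetime d) :
    (opG d ^ j) (heatAt t x) = translate x (heatDeriv d j t) :=
  opG_pow_translate j x _

lemma QAt_eq (N : ℕ) (t : ℝ) (x : Spacetime d) :
    QAt N t x = (-t) ^ N • translate x (heatDeriv d N t) := by
  rw [QAt, smul_pow, ← opG_pow_heatAt]
  rfl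

lemma abs_integral_le_of_abs_le {X : Type*} [MeasurableSpace X] {μ : Measure X} {f g : X → ℝ}
    (hg : Integrable g μ) (h : ∀ y, |f y| ≤ g y) : |∫ y, f y ∂μ| ≤ ∫ y, g y ∂μ :=
  norm_integral_le_of_norm_le (f := f) hg (Filter.Eventually.of_forall h)

/-! ### Parabolic scaling and moments of the heat kernel -/

/-- The parabolic size `√|y₀| + |y'|` of a vector. -/
def pnorm (y : Spacetime d) : ℝ :=
  Real.sqrt |y 0| + Real.sqrt (∑ i : Fin d, y i.succ ^ 2)

lemma pdist_eq (x y : Spacetime d) : pdist x y = pnorm (x - y) := by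
  simp [pdist, pnorm]

lemma pnorm_nonneg (y : Spacetime d) : 0 ≤ pnorm y := by unfold pnorm; positivity

lemma pnorm_neg (y : Spacetime d) : pnorm (-y) = pnorm y := by simp [pnorm]

lemma continuous_pnorm : Continuous (pnorm : Spacetime d → ℝ) := by
  unfold pnorm
  fun_prop

lemma norm_sq_eq (y : Spacetime d) : ‖y‖ ^ 2 = y 0 ^ 2 + ∑ i : Fin d, y i.succ ^ 2 := by
  rw [EuclideanSpace.norm_sq_eq, Fin.sum_univ_succ]
  simp

lemma pnorm_le (y : Spacetime d) : pnorm y ≤ 2 * (1 + ‖y‖) := by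
  have hsq := norm_sq_eq y
  have hspace : 0 ≤ ∑ i : Fin d, y i.succ ^ 2 := Finset.sum_nonneg fun i _ => sq_nonneg _
  have htime : |y 0| ≤ ‖y‖ := abs_le_of_sq_le_sq (by linarith) (norm_nonneg _)
  have hsqrt_time : Real.sqrt |y 0| ≤ 1 + ‖y‖ := by
    rw [Real.sqrt_le_left (by positivity)]
    nlinarith [norm_nonneg y]
  have hsqrt_space : Real.sqrt (∑ i : Fin d, y i.succ ^ 2) ≤ 1 + ‖y‖ := by
    rw [Real.sqrt_le_left (by positivity)]
    nlinarith [norm_nonneg y, sq_nonneg (y 0)]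
  unfold pnorm
  linarith

lemma norm_le_pnorm (y : Spacetime d) : ‖y‖ ≤ pnorm y ^ 2 + pnorm y := by
  set a := Real.sqrt |y 0|
  set b := Real.sqrt (∑ i : Fin d, y i.succ ^ 2)
  have ha : a ^ 2 = |y 0| := Real.sq_sqrt (abs_nonneg _)
  have hb : b ^ 2 = ∑ i : Fin d, y i.succ ^ 2 :=
    Real.sq_sqrt (Finset.sum_nonneg fun i _ => sq_nonneg _)
  have ha0 : 0 ≤ a := Real.sqrt_nonneg _
  have hb0 : 0 ≤ b := Real.sqrt_nonneg _
  have hnorm : ‖y‖ ≤ a ^ 2 + b := by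
    refine abs_le_of_sq_le_sq' ?_ (by positivity) |>.2
    rw [norm_sq_eq, ← hb, ← sq_abs (y 0), ← ha]
    nlinarith [mul_nonneg (sq_nonneg a) hb0]
  have hp : pnorm y = a + b := rfl
  rw [hp]
  nlinarith [mul_nonneg ha0 hb0, sq_nonneg b]

/-- The parabolic dilation `(y₀, y') ↦ (r² y₀, r y')`. -/
def dil (d : ℕ) (r : ℝ) : Spacetime d →ₗ[ℝ] Spacetime d where
  toFun y := WithLp.toLp 2 (Fin.cons (r ^ 2 * y 0) fun i : Fin d => r * y i.succ)
  map_add' x y := by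
    ext i
    refine Fin.cases ?_ (fun i => ?_) i <;> simp [mul_add]
  map_smul' c y := by
    ext i
    refine Fin.cases ?_ (fun i => ?_) i <;> simp [mul_left_comm]

lemma dil_zero_coord (r : ℝ) (y : Spacetime d) : dil d r y 0 = r ^ 2 * y 0 := rfl

lemma dil_succ_coord (r : ℝ) (y : Spacetime d) (i : Fin d) :
    dil d r y i.succ = r * y i.succ := rfl

lemma dil_comp_dil {r r' : ℝ} (h : r * r' = 1) : dil d r ∘ₗ dil d r' = LinearMap.id := by
  refine LinearMap.ext fun y => ?_
  ext i
  refine Fin.cases ?_ (fun i => ?_) i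
  · rw [LinearMap.comp_apply, dil_zero_coord, dil_zero_coord, ← mul_assoc, ← mul_pow, h]
    simp
  · rw [LinearMap.comp_apply, dil_succ_coord, dil_succ_coord, ← mul_assoc, h]
    simp

lemma dil_dil {r r' : ℝ} (h : r * r' = 1) (y : Spacetime d) : dil d r (dil d r' y) = y :=
  LinearMap.congr_fun (dil_comp_dil h) y

lemma symbolG_dil (r : ℝ) (ξ : Spacetime d) : symbolG (dil d r ξ) = r ^ 4 * symbolG ξ := by
  simp only [symbolG, dil_zero_coord, dil_succ_coord]
  have : ∑ i : Fin d, (2 * Real.pi * (r * ξ i.succ)) ^ 2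
      = r ^ 2 * ∑ i : Fin d, (2 * Real.pi * ξ i.succ) ^ 2 := by
    rw [Finset.mul_sum]
    exact Finset.sum_congr rfl fun i _ => by ring
  rw [this]
  ring

lemma inner_dil (r : ℝ) (ξ y : Spacetime d) :
    (inner ℝ (dil d r ξ) y : ℝ) = inner ℝ ξ (dil d r y) := by
  simp only [PiLp.inner_apply, Fin.sum_univ_succ, dil_zero_coord, dil_succ_coord]
  simp only [RCLike.inner_apply, conj_trivial]
  congr 1
  · ring
  · exact Finset.sum_congr rfl fun i _ => by ring

lemma pnorm_dil {r : ℝ} (hr : 0 ≤ r) (y : Spacetime d) : pnorm (dil d r y) = r * pnorm y := by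
  simp only [pnorm, dil_zero_coord, dil_succ_coord]
  have : ∑ i : Fin d, (r * y i.succ) ^ 2 = r ^ 2 * ∑ i : Fin d, y i.succ ^ 2 := by
    rw [Finset.mul_sum]
    exact Finset.sum_congr rfl fun i _ => by ring
  rw [this, abs_mul, abs_of_nonneg (sq_nonneg r), Real.sqrt_mul (sq_nonneg r),
    Real.sqrt_mul (sq_nonneg r), Real.sqrt_sq hr]
  ring

lemma det_dil_mul {r r' : ℝ} (h : r * r' = 1) :
    LinearMap.det (dil d r) * LinearMap.det (dil d r') = 1 := by
  rw [← LinearMap.det_comp, dil_comp_dil h, LinearMap.det_id]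

lemma det_dil_ne_zero {r : ℝ} (hr : r ≠ 0) : LinearMap.det (dil d r) ≠ 0 :=
  left_ne_zero_of_mul_eq_one (det_dil_mul (mul_inv_cancel₀ hr))

lemma abs_det_dil_inv_mul {r : ℝ} (hr : r ≠ 0) :
    |(LinearMap.det (dil d r))⁻¹| * |(LinearMap.det (dil d r⁻¹))⁻¹| = 1 := by
  rw [← abs_mul, ← mul_inv, det_dil_mul (mul_inv_cancel₀ hr), inv_one, abs_one]

lemma integral_comp_linearMap {E F : Type*} [NormedAddCommGroup E] [NormedSpace ℝ E]
    [FiniteDimensional ℝ E] [MeasurableSpace E] [BorelSpace E]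
    [NormedAddCommGroup F] [NormedSpace ℝ F] (μ : Measure E) [μ.IsAddHaarMeasure]
    {L : E →ₗ[ℝ] E} (hL : LinearMap.det L ≠ 0) (f : E → F) :
    ∫ y, f (L y) ∂μ = |(LinearMap.det L)⁻¹| • ∫ y, f y ∂μ := by
  have hmap := (LinearEquiv.ofIsUnitDet (f := L) (v := Module.finBasis ℝ E)
    (v' := Module.finBasis ℝ E)
    (by simpa using hL)).toContinuousLinearEquiv.toHomeomorph.measurableEmbedding.integral_map
    (μ := μ) f
  rw [← ENNReal.toReal_ofReal (abs_nonneg (LinearMap.det L)⁻¹), ← integral_smul_measure,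
    ← Measure.map_linearMap_addHaar_eq_smul_addHaar μ hL]
  exact hmap.symm

lemma heatCosIntegral_scaling (j : ℕ) {r : ℝ} (hr : r ≠ 0) (y : Spacetime d) :
    heatCosIntegral d j (r ^ 4) y
      = |(LinearMap.det (dil d r))⁻¹|
        * ((r ^ 4)⁻¹ ^ j * heatCosIntegral d j 1 (dil d r⁻¹ y)) := by
  have hchange := integral_comp_linearMap volume (det_dil_ne_zero (d := d) hr) fun η =>
    (r ^ 4)⁻¹ ^ j * (Real.cos (2 * Real.pi * inner ℝ η (dil d r⁻¹ y)) * heatMultiplier j 1 η)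
  rw [smul_eq_mul] at hchange
  rw [heatCosIntegral, heatCosIntegral, ← integral_const_mul, ← hchange]
  refine integral_congr_ae (Filter.Eventually.of_forall fun ξ => ?_)
  have hpow : (r ^ 4)⁻¹ ^ j * (-(r ^ 4 * symbolG ξ)) ^ j = (-symbolG ξ) ^ j := by
    rw [← mul_pow]
    congr 1
    field_simp
  simp only [heatMultiplier, inner_dil, dil_dil (mul_inv_cancel₀ hr), symbolG_dil, ← hpow]
  ring_nf

/-- The absolute moments of `𝒢ʲ p₁` with respect to `pnorm`. -/
def heatMoment (d j : ℕ) (a : ℝ) : ℝ := ∫ y, |heatDeriv d j 1 y| * pnorm y ^ a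

lemma heatMoment_nonneg (j : ℕ) (a : ℝ) : 0 ≤ heatMoment d j a :=
  integral_nonneg fun y => mul_nonneg (abs_nonneg _) (Real.rpow_nonneg (pnorm_nonneg y) a)

lemma heatDeriv_mul_pnorm_scaling (j : ℕ) (a : ℝ) {r : ℝ} (hr : 0 < r) (y : Spacetime d) :
    |heatDeriv d j (r ^ 4) y| * pnorm y ^ a
      = |(LinearMap.det (dil d r))⁻¹| * ((r ^ 4)⁻¹ ^ j * r ^ a)
        * (|heatDeriv d j 1 (dil d r⁻¹ y)| * pnorm (dil d r⁻¹ y) ^ a) := by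
  have hpnorm : pnorm y = r * pnorm (dil d r⁻¹ y) := by
    rw [← pnorm_dil hr.le, dil_dil (mul_inv_cancel₀ hr.ne')]
  rw [heatDeriv_apply j (by positivity), heatDeriv_apply j one_pos,
    heatCosIntegral_scaling j hr.ne', abs_mul, abs_mul, abs_abs, hpnorm,
    Real.mul_rpow hr.le (pnorm_nonneg _), abs_of_nonneg (a := _ ^ j) (by positivity)]
  ring

lemma integral_heatDeriv_pnorm (j : ℕ) (a : ℝ) {t : ℝ} (ht : 0 < t) :
    ∫ y, |heatDeriv d j t y| * pnorm y ^ a = heatMoment d j a * t ^ (a / 4 - j) := by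
  obtain ⟨r, hr, rfl⟩ : ∃ r : ℝ, 0 < r ∧ r ^ 4 = t :=
    ⟨t ^ (1 / 4 : ℝ), by positivity, by
      rw [← Real.rpow_natCast, ← Real.rpow_mul ht.le]
      norm_num⟩
  have hpow : (r ^ 4) ^ (a / 4 - j) = (r ^ 4)⁻¹ ^ j * r ^ a := by
    rw [Real.rpow_sub ht, Real.rpow_natCast, ← Real.rpow_natCast r 4, ← Real.rpow_mul hr.le,
      Nat.cast_ofNat, mul_div_cancel₀ a four_ne_zero, inv_pow, div_eq_inv_mul]
  simp_rw [heatDeriv_mul_pnorm_scaling j a hr]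
  rw [integral_const_mul, integral_comp_linearMap volume (det_dil_ne_zero (inv_pos.2 hr).ne')
    fun y => |heatDeriv d j 1 y| * pnorm y ^ a, smul_eq_mul, hpow]
  change _ * (_ * heatMoment d j a) = _
  linear_combination
    ((r ^ 4)⁻¹ ^ j * r ^ a * heatMoment d j a) * abs_det_dil_inv_mul (d := d) hr.ne'

lemma pnorm_rpow_le {a : ℝ} (ha : 0 ≤ a) (y : Spacetime d) :
    pnorm y ^ a ≤ 2 ^ ⌈a⌉₊ * (1 + ‖y‖) ^ ⌈a⌉₊ := by
  have hone : (1 : ℝ) ≤ 2 * (1 + ‖y‖) := by linarith [norm_nonneg y]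
  calc pnorm y ^ a ≤ (2 * (1 + ‖y‖)) ^ a :=
        Real.rpow_le_rpow (pnorm_nonneg y) (pnorm_le y) ha
    _ ≤ (2 * (1 + ‖y‖)) ^ (⌈a⌉₊ : ℝ) := Real.rpow_le_rpow_of_exponent_le hone (Nat.le_ceil a)
    _ = _ := by rw [Real.rpow_natCast, mul_pow]

lemma continuous_pnorm_rpow {a : ℝ} (ha : 0 ≤ a) :
    Continuous fun y : Spacetime d => pnorm y ^ a :=
  continuous_pnorm.rpow_const fun _ => Or.inr ha

lemma integrable_mul_pnorm_rpow (φ : 𝓢(Spacetime d, ℝ)) {a : ℝ} (ha : 0 ≤ a) :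
    Integrable fun y => |φ y| * pnorm y ^ a := by
  have hnonneg (y : Spacetime d) : 0 ≤ pnorm y ^ a := Real.rpow_nonneg (pnorm_nonneg y) a
  have hint := (integrable_mul_of_poly_bound (μ := volume) φ (h := fun y => pnorm y ^ a)
    (continuous_pnorm_rpow ha).aestronglyMeasurable fun y => by
      rw [Real.norm_of_nonneg (hnonneg y)]
      exact pnorm_rpow_le ha y).norm
  refine hint.congr (Filter.Eventually.of_forall fun y => ?_)
  simp only [norm_smul, Real.norm_eq_abs, abs_of_nonneg (hnonneg y)]

/-! ### Convolution of a Schwartz function with a function of polynomial growth -/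

section PolynomialGrowth

/-- Measurable functions of polynomial growth, which every Schwartz function can be convolved
with. -/
def PolyBdd {E : Type*} [NormedAddCommGroup E] [MeasurableSpace E] (v : E → ℝ) : Prop :=
  Measurable v ∧ ∃ (C : ℝ) (k : ℕ), ∀ y, |v y| ≤ C * (1 + ‖y‖) ^ k

lemma PolyBdd.of_bounded {E : Type*} [NormedAddCommGroup E] [MeasurableSpace E] {v : E → ℝ}
    (hv : Measurable v) {C : ℝ} (h : ∀ y, |v y| ≤ C) : PolyBdd v := ⟨hv, C, 0, by simpa using h⟩

lemma polyBdd_apply_translate {E F : Type*} [NormedAddCommGroup E] [NormedSpace ℝ E]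
    [MeasurableSpace E] [BorelSpace E] [NormedAddCommGroup F] [NormedSpace ℝ F]
    (Λ : 𝓢(E, F) →L[ℝ] ℝ) (φ : 𝓢(E, F)) : PolyBdd fun y => Λ (translate y φ) := by
  obtain ⟨C, k, -, hC⟩ := exists_translate_bound Λ φ
  exact ⟨(continuous_apply_translate Λ φ).measurable, C, k, hC⟩

/-- The reflected translate `y ↦ χ (x - y)`. -/
def reflect {E : Type*} [NormedAddCommGroup E] [NormedSpace ℝ E] (x : E) (χ : 𝓢(E, ℝ)) :
    𝓢(E, ℝ) :=
  translate x (SchwartzMap.compCLMOfContinuousLinearEquiv ℝ (ContinuousLinearEquiv.neg ℝ) χ)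

lemma reflect_apply {E : Type*} [NormedAddCommGroup E] [NormedSpace ℝ E] (x : E) (χ : 𝓢(E, ℝ))
    (y : E) : reflect x χ y = χ (x - y) := by
  rw [reflect, translate_apply, SchwartzMap.compCLMOfContinuousLinearEquiv_apply,
    Function.comp_apply, ContinuousLinearEquiv.neg_apply, neg_sub]

variable {E : Type*} [NormedAddCommGroup E] [InnerProductSpace ℝ E] [FiniteDimensional ℝ E]
  [MeasurableSpace E] [BorelSpace E]

/-- The convolution `χ ⋆ v` of a Schwartz function with a function that need not be Schwartz. -/
def sconv (χ : 𝓢(E, ℝ)) (v : E → ℝ) (x : E) : ℝ := ∫ y, χ (x - y) * v y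

lemma PolyBdd.integrable_mul {v : E → ℝ} (hv : PolyBdd v) (χ : 𝓢(E, ℝ)) :
    Integrable fun y => χ y * v y := by
  obtain ⟨hvm, C, k, hC⟩ := hv
  simpa only [smul_eq_mul] using integrable_mul_of_poly_bound χ hvm.aestronglyMeasurable hC

lemma PolyBdd.integrable_sconv {v : E → ℝ} (hv : PolyBdd v) (χ : 𝓢(E, ℝ))
    (x : E) : Integrable fun y => χ (x - y) * v y := by
  simpa only [reflect_apply] using hv.integrable_mul (reflect x χ)

lemma sconv_add {v w : E → ℝ} (hv : PolyBdd v) (hw : PolyBdd w)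
    (χ : 𝓢(E, ℝ)) (x : E) :
    sconv χ (fun y => v y + w y) x = sconv χ v x + sconv χ w x := by
  simp only [sconv, mul_add]
  exact integral_add (hv.integrable_sconv χ x) (hw.integrable_sconv χ x)

lemma sconv_sub {v w : E → ℝ} (hv : PolyBdd v) (hw : PolyBdd w)
    (χ : 𝓢(E, ℝ)) (x : E) :
    sconv χ (fun y => v y - w y) x = sconv χ v x - sconv χ w x := by
  simp only [sconv, mul_sub]
  exact integral_sub (hv.integrable_sconv χ x) (hw.integrable_sconv χ x)

lemma sconv_const_mul (c : ℝ) (v : E → ℝ) (χ : 𝓢(E, ℝ)) (x : E) :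
    sconv χ (fun y => c * v y) x = c * sconv χ v x := by
  simp only [sconv, ← integral_const_mul]
  exact integral_congr_ae (Filter.Eventually.of_forall fun y => by ring)

lemma abs_sconv_le {v : E → ℝ} {C : ℝ} (h : ∀ y, |v y| ≤ C)
    (χ : 𝓢(E, ℝ)) (x : E) : |sconv χ v x| ≤ C * ∫ y, |χ y| := by
  have hint : Integrable fun y => C * |χ (x - y)| := by
    simpa only [reflect_apply, Real.norm_eq_abs] using
      ((reflect x χ).integrable (μ := volume)).norm.const_mul C
  rw [← integral_sub_left_eq_self (fun y => |χ y|) volume x, ← integral_const_mul]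
  refine abs_integral_le_of_abs_le hint fun y => ?_
  rw [abs_mul, mul_comm]
  exact mul_le_mul_of_nonneg_right (h y) (abs_nonneg _)

lemma measurable_sconv {v : E → ℝ} (hv : Measurable v) (χ : 𝓢(E, ℝ)) :
    Measurable (sconv χ v) := by
  have h : StronglyMeasurable fun q : E × E => χ (q.1 - q.2) * v q.2 :=
    ((χ.continuous.measurable.comp (measurable_fst.sub measurable_snd)).mul
      (hv.comp measurable_snd)).stronglyMeasurable
  exact (h.integral_prod_right' (ν := volume)).measurable

lemma one_add_norm_le_mul_mul {G : Type*} [SeminormedAddCommGroup G] (x y z : G) :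
    1 + ‖z‖ ≤ (1 + ‖x‖) * ((1 + ‖x - y‖) * (1 + ‖y - z‖)) := by
  have htriangle : ‖z‖ ≤ ‖x‖ + (‖x - y‖ + ‖y - z‖) := by
    calc ‖z‖ = ‖x - ((x - y) + (y - z))‖ := by congr 1; abel
      _ ≤ ‖x‖ + ‖(x - y) + (y - z)‖ := norm_sub_le _ _
      _ ≤ _ := by gcongr; exact norm_add_le _ _
  have hprod : 1 + (‖x - y‖ + ‖y - z‖) ≤ (1 + ‖x - y‖) * (1 + ‖y - z‖) := by
    nlinarith [mul_nonneg (norm_nonneg (x - y)) (norm_nonneg (y - z))]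
  have hsum : 0 ≤ ‖x - y‖ + ‖y - z‖ := by positivity
  nlinarith [norm_nonneg x]

lemma PolyBdd.integrable_prod {v : E → ℝ} (hv : PolyBdd v) (χ₁ χ₂ : 𝓢(E, ℝ)) (x : E) :
    Integrable (fun p : E × E => χ₁ (x - p.2) * χ₂ (p.2 - p.1) * v p.1)
      (volume.prod volume) := by
  obtain ⟨hvm, C, k, hC⟩ := hv
  have hC0 : 0 ≤ C := by simpa using (abs_nonneg _).trans (hC 0)
  have h₁ : Integrable fun y => (1 + ‖x - y‖) ^ k * ‖χ₁ (x - y)‖ :=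
    (integrable_one_add_norm_pow_mul χ₁ k).comp_sub_left x
  have h₂ : Integrable fun y : E => (1 + ‖-y‖) ^ k * ‖χ₂ (-y)‖ :=
    (integrable_one_add_norm_pow_mul χ₂ k).comp_neg
  refine ((h₁.convolution_integrand (ContinuousLinearMap.mul ℝ ℝ) h₂).const_mul
    (C * (1 + ‖x‖) ^ k)).mono' ?_ (Filter.Eventually.of_forall fun ⟨z, y⟩ => ?_)
  · refine (Measurable.mul (Measurable.mul ?_ ?_) (hvm.comp measurable_fst)).aestronglyMeasurable
    · exact χ₁.continuous.measurable.comp (measurable_const.sub measurable_snd)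
    · exact χ₂.continuous.measurable.comp (measurable_snd.sub measurable_fst)
  · simp only [ContinuousLinearMap.mul_apply', neg_sub, Real.norm_eq_abs, abs_mul]
    calc |χ₁ (x - y)| * |χ₂ (y - z)| * |v z|
        ≤ |χ₁ (x - y)| * |χ₂ (y - z)| *
          (C * ((1 + ‖x‖) * ((1 + ‖x - y‖) * (1 + ‖y - z‖))) ^ k) := by
            gcongr
            exact (hC z).trans (by gcongr; exact one_add_norm_le_mul_mul x y z)
      _ = _ := by rw [mul_pow, mul_pow]; ring

lemma sconv_sconv {v : E → ℝ} (hv : PolyBdd v) (χ₁ χ₂ : 𝓢(E, ℝ)) (x : E) :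
    sconv χ₁ (sconv χ₂ v) x = sconv (conv χ₁ χ₂) v x := by
  have hconv (z : E) :
      conv χ₁ χ₂ (x - z) * v z = ∫ y, χ₁ (x - y) * χ₂ (y - z) * v z := by
    rw [conv_apply, integral_mul_const, ← integral_sub_left_eq_self _ _ x]
    congr 2
    funext y
    congr 2
    abel
  simp only [sconv, hconv, ← integral_const_mul]
  rw [integral_integral_swap]
  · simp only [mul_assoc]
  · convert (hv.integrable_prod χ₁ χ₂ x).swap using 1
    funext p
    simp only [Function.uncurry, Function.comp_apply, Prod.fst_swap, Prod.snd_swap, mul_assoc]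

lemma conv_translate (x : E) (p φ : 𝓢(E, ℝ)) :
    conv (translate x p) φ = translate x (conv p φ) := by
  ext z
  rw [translate_apply, conv_apply, conv_apply,
    ← integral_add_right_eq_self _ x]
  refine integral_congr_ae (Filter.Eventually.of_forall fun y => ?_)
  simp only [translate_apply, add_sub_cancel_right]
  congr 2
  abel

lemma abs_apply_conv_le (Λ : 𝓢(E, ℝ) →L[ℝ] ℝ) (φ ψ : 𝓢(E, ℝ)) {B : ℝ}
    (hB : ∀ y, |Λ (translate y ψ)| ≤ B) : |Λ (conv φ ψ)| ≤ B * ∫ y, |φ y| := by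
  rw [apply_conv, ← integral_const_mul]
  refine abs_integral_le_of_abs_le ((φ.integrable (μ := volume)).norm.const_mul B) fun y => ?_
  rw [abs_mul, mul_comm]
  exact mul_le_mul_of_nonneg_right (hB y) (abs_nonneg _)

end PolynomialGrowth

lemma heatDeriv_sub_comm (j : ℕ) (t : ℝ) (x y : Spacetime d) :
    heatDeriv d j t (x - y) = heatDeriv d j t (y - x) := by
  rw [← heatDeriv_neg, neg_sub]

lemma apply_translate_heatDeriv (Λ : TempDist d) (j : ℕ) {t s : ℝ} (ht : 0 < t) (hs : 0 < s)
    (x : Spacetime d) : Λ (translate x (heatDeriv d j (t + s)))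
      = sconv (heatDeriv d j t) (fun y => Λ (heatAt s y)) x := by
  have hsemigroup := conv_heatDeriv (d := d) j 0 ht hs
  rw [add_zero] at hsemigroup
  rw [← hsemigroup, ← conv_translate, apply_conv]
  refine integral_congr_ae (Filter.Eventually.of_forall fun y => ?_)
  simp only [translate_apply, heatDeriv_sub_comm j t x y]
  rfl

lemma apply_heatAt_add (Λ : TempDist d) {t s : ℝ} (ht : 0 < t) (hs : 0 < s)
    (x : Spacetime d) : Λ (heatAt (t + s) x)
      = sconv (heatDeriv d 0 t) (fun y => Λ (heatAt s y)) x :=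
  apply_translate_heatDeriv Λ 0 ht hs x

lemma heatAt_of_nonpos {t : ℝ} (ht : t ≤ 0) (x : Spacetime d) : heatAt t x = 0 := by
  rw [heatAt, heatKernel_of_nonpos ht, map_zero]

lemma measurable_heatDeriv_comp {X : Type*} [MeasurableSpace X] (j : ℕ) {τ : X → ℝ}
    (hτ : Measurable τ) {x : X → Spacetime d} (hx : Measurable x) :
    Measurable fun p => heatDeriv d j (τ p) (x p) :=
  (measurable_heatDeriv j).comp (hτ.prodMk hx)

lemma measurable_sconv_heatDeriv {X : Type*} [MeasurableSpace X] (j : ℕ) {τ : X → ℝ}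
    (hτ : Measurable τ) {x : X → Spacetime d} (hx : Measurable x) {v : X → Spacetime d → ℝ}
    (hv : Measurable (Function.uncurry v)) :
    Measurable fun p => sconv (heatDeriv d j (τ p)) (v p) (x p) := by
  have h : StronglyMeasurable fun q : X × Spacetime d =>
      heatDeriv d j (τ q.1) (x q.1 - q.2) * v q.1 q.2 := by
    refine Measurable.stronglyMeasurable (Measurable.mul ?_ hv)
    exact measurable_heatDeriv_comp j (hτ.comp measurable_fst)
      ((hx.comp measurable_fst).sub measurable_snd)
  exact (h.integral_prod_right' (ν := volume)).measurable

lemma measurable_apply_heatAt (Λ : TempDist d) :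
    Measurable fun p : ℝ × Spacetime d => Λ (heatAt p.1 p.2) := by
  let s (n : ℕ) : ℝ := 1 / ((n : ℝ) + 1)
  have hs (n : ℕ) : 0 < s n := Nat.one_div_pos_of_nat
  have hm (n : ℕ) : Measurable fun p : ℝ × Spacetime d =>
      sconv (heatDeriv d 0 (p.1 - s n)) (fun y => Λ (heatAt (s n) y)) p.2 :=
    measurable_sconv_heatDeriv 0 (measurable_fst.sub_const _) measurable_snd
      ((polyBdd_apply_translate Λ (heatKernel d (s n))).1.comp measurable_snd)
  refine measurable_of_tendsto_metrizable hm (tendsto_pi_nhds.2 fun p => ?_)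
  rcases le_or_gt p.1 0 with hp | hp
  · rw [heatAt_of_nonpos hp, map_zero]
    refine tendsto_const_nhds.congr fun n => ?_
    rw [heatDeriv_of_nonpos (by linarith [hs n])]
    simp [sconv]
  · refine tendsto_const_nhds.congr' ?_
    have hlim : Filter.Tendsto s Filter.atTop (nhds 0) := tendsto_one_div_add_atTop_nhds_zero_nat
    filter_upwards [hlim.eventually (gt_mem_nhds hp)] with n hn
    rw [← apply_heatAt_add Λ (sub_pos.2 hn) (hs n), sub_add_cancel]

lemma one_add_norm_pow_mul_norm_le (k : ℕ) (y : Spacetime d) : (1 + ‖y‖) ^ k * ‖y‖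
    ≤ 2 * 3 ^ k * (pnorm y ^ (1 : ℝ) + pnorm y ^ ((2 * k + 2 : ℕ) : ℝ)) := by
  have hy := norm_le_pnorm y
  rw [Real.rpow_one, Real.rpow_natCast]
  set p := pnorm y
  have hp : 0 ≤ p := pnorm_nonneg y
  rcases le_total p 1 with hp1 | hp1
  · have hlin : ‖y‖ ≤ 2 * p := by nlinarith
    have hone : 1 + ‖y‖ ≤ 3 := by linarith
    calc (1 + ‖y‖) ^ k * ‖y‖ ≤ 3 ^ k * (2 * p) := by gcongr
      _ = 2 * 3 ^ k * p := by ring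
      _ ≤ _ := by gcongr; exact le_add_of_nonneg_right (by positivity)
  · have hquad : ‖y‖ ≤ 2 * p ^ 2 := by nlinarith
    have hone : 1 + ‖y‖ ≤ 3 * p ^ 2 := by nlinarith
    calc (1 + ‖y‖) ^ k * ‖y‖ ≤ (3 * p ^ 2) ^ k * (2 * p ^ 2) := by gcongr
      _ = 2 * 3 ^ k * p ^ (2 * k + 2) := by rw [mul_pow, ← pow_mul]; ring
      _ ≤ _ := by gcongr; exact le_add_of_nonneg_left hp

lemma integral_heatKernel_pnorm (a : ℝ) {t : ℝ} (ht : 0 < t) :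
    ∫ y, |heatKernel d t y| * pnorm y ^ a = heatMoment d 0 a * t ^ (a / 4) := by
  simpa only [Nat.cast_zero, sub_zero, heatDeriv_zero] using integral_heatDeriv_pnorm 0 a ht

lemma abs_integral_heatKernel_mul_le {w : Spacetime d → ℝ} {D : ℝ} (hD : 0 ≤ D) {k : ℕ}
    (hw : ∀ y, |w y| ≤ D * ((1 + ‖y‖) ^ k * ‖y‖)) {t : ℝ} (ht : 0 < t) :
    |∫ y, heatKernel d t y * w y| ≤ D * (2 * 3 ^ k) * (heatMoment d 0 1 * t ^ ((1 : ℝ) / 4)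
      + heatMoment d 0 ((2 * k + 2 : ℕ) : ℝ) * t ^ (((2 * k + 2 : ℕ) : ℝ) / 4)) := by
  have hint₁ := integrable_mul_pnorm_rpow (heatKernel d t) (zero_le_one (α := ℝ))
  have hint₂ := integrable_mul_pnorm_rpow (heatKernel d t) (Nat.cast_nonneg (α := ℝ) (2 * k + 2))
  rw [← integral_heatKernel_pnorm 1 ht, ← integral_heatKernel_pnorm _ ht,
    ← integral_add hint₁ hint₂, ← integral_const_mul]
  refine abs_integral_le_of_abs_le ((hint₁.add hint₂).const_mul _) fun y => ?_
  calc |heatKernel d t y * w y|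
      ≤ |heatKernel d t y| * (D * ((1 + ‖y‖) ^ k * ‖y‖)) := by
        rw [abs_mul]
        gcongr
        exact hw y
    _ ≤ |heatKernel d t y| * (D * (2 * 3 ^ k *
          (pnorm y ^ (1 : ℝ) + pnorm y ^ ((2 * k + 2 : ℕ) : ℝ)))) := by
        exact mul_le_mul_of_nonneg_left (mul_le_mul_of_nonneg_left
          (one_add_norm_pow_mul_norm_le k y) hD) (abs_nonneg _)
    _ = _ := by ring

lemma tendsto_rpow_nhdsGT_zero {c : ℝ} (hc : 0 < c) :
    Filter.Tendsto (fun t : ℝ => t ^ c) (nhdsWithin 0 (Set.Ioi 0)) (nhds 0) := by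
  have hcont := (Real.continuousAt_rpow_const 0 c (Or.inr hc.le)).tendsto
  rw [Real.zero_rpow hc.ne'] at hcont
  exact hcont.mono_left nhdsWithin_le_nhds

lemma apply_conv_heatKernel_sub (Λ : TempDist d) (φ : 𝓢(Spacetime d, ℝ)) {t : ℝ} (ht : 0 < t) :
    Λ (conv φ (heatKernel d t)) - Λ φ
      = ∫ y, heatKernel d t y * (Λ (translate y φ) - Λ φ) := by
  simp only [mul_sub]
  rw [integral_sub ((polyBdd_apply_translate Λ φ).integrable_mul _)
    (((heatKernel d t).integrable (μ := volume)).mul_const _), integral_mul_const,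
    integral_heatKernel ht, one_mul, conv_comm, apply_conv]

lemma tendsto_apply_conv_heatKernel (Λ : TempDist d) (φ : 𝓢(Spacetime d, ℝ)) :
    Filter.Tendsto (fun t => Λ (conv φ (heatKernel d t))) (nhdsWithin 0 (Set.Ioi 0))
      (nhds (Λ φ)) := by
  obtain ⟨D, k, hD, htranslate⟩ := exists_translate_sub_bound Λ φ
  have hw (y : Spacetime d) : |Λ (translate y φ) - Λ φ| ≤ D * ((1 + ‖y‖) ^ k * ‖y‖) := by
    simpa only [translate_zero, norm_zero, add_zero, sub_zero, mul_assoc] using htranslate y 0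
  have hbound := (((tendsto_rpow_nhdsGT_zero (c := 1 / 4) (by positivity)).const_mul
    (heatMoment d 0 1)).add ((tendsto_rpow_nhdsGT_zero (c := ((2 * k + 2 : ℕ) : ℝ) / 4)
      (by positivity)).const_mul (heatMoment d 0 ((2 * k + 2 : ℕ) : ℝ)))).const_mul
    (D * (2 * 3 ^ k))
  simp only [mul_zero, add_zero] at hbound
  refine tendsto_sub_nhds_zero_iff.1 (squeeze_zero_norm' ?_ hbound)
  filter_upwards [self_mem_nhdsWithin] with t ht
  rw [Real.norm_eq_abs, apply_conv_heatKernel_sub Λ φ ht]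
  exact abs_integral_heatKernel_mul_le hD hw ht

lemma eq_zero_of_heatAt_small (Λ : TempDist d) {C c : ℝ} (hc : 0 < c)
    (h : ∀ t : ℝ, 0 < t → t ≤ 1 → ∀ x, |Λ (heatAt t x)| ≤ C * t ^ c) : Λ = 0 := by
  ext φ
  have hsmall := ((tendsto_rpow_nhdsGT_zero hc).const_mul C).mul_const (∫ y, |φ y|)
  rw [mul_zero, zero_mul] at hsmall
  refine tendsto_nhds_unique (tendsto_apply_conv_heatKernel Λ φ)
    (squeeze_zero_norm' ?_ hsmall)
  filter_upwards [Ioc_mem_nhdsGT one_pos] with t ht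
  exact abs_apply_conv_le Λ φ _ fun y => h t ht.1 ht.2 y

/-! ### Taylor expansion in time -/

/-- The coefficient of `∂ₜʲ p_{t+1}` in the Taylor expansion of `pₜ` at time `t + 1`. -/
def taylorCoeff (j : ℕ) : ℝ := (-1) ^ j / (j.factorial : ℝ)

/-- The weight of `∂ₜⁿ⁺¹ p_{t+s}` in the integral remainder of the Taylor expansion of `pₜ` at
time `t + 1`. -/
def taylorWeight (n : ℕ) (s : ℝ) : ℝ := (-s) ^ n / (n.factorial : ℝ)

lemma continuous_taylorWeight (n : ℕ) : Continuous (taylorWeight n) := by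
  unfold taylorWeight
  fun_prop

lemma abs_taylorWeight_le (n : ℕ) {s : ℝ} (hs : 0 ≤ s) : |taylorWeight n s| ≤ s ^ n := by
  rw [taylorWeight, abs_div, abs_pow, abs_neg, abs_of_nonneg hs, Nat.abs_cast]
  exact div_le_self (by positivity) (by exact_mod_cast n.factorial_pos)

lemma hasDerivAt_taylorWeight (n : ℕ) (s : ℝ) :
    HasDerivAt (taylorWeight (n + 1)) (-taylorWeight n s) s := by
  refine (((hasDerivAt_neg s).pow (n + 1)).div_const ((n + 1).factorial : ℝ)).congr_deriv ?_
  have hfactorial : (n.factorial : ℝ) ≠ 0 := by positivity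
  have hsucc : (n : ℝ) + 1 ≠ 0 := by positivity
  rw [taylorWeight, Nat.factorial_succ]
  push_cast
  field_simp

lemma hasDerivAt_sum_taylor (n : ℕ) {t s : ℝ} (h : 0 < t + s) (y : Spacetime d) :
    HasDerivAt (fun s => ∑ j ∈ Finset.range (n + 1), taylorWeight j s * heatDeriv d j (t + s) y)
      (taylorWeight n s * heatDeriv d (n + 1) (t + s) y) s := by
  have hkernel (j : ℕ) : HasDerivAt (fun s => heatDeriv d j (t + s) y)
      (heatDeriv d (j + 1) (t + s) y) s := by
    simpa using (hasDerivAt_heatDeriv j h y).comp_const_add t s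
  induction n with
  | zero =>
    have hone : taylorWeight 0 = fun _ => (1 : ℝ) := by
      funext s
      simp [taylorWeight]
    simpa [hone] using hkernel 0
  | succ n ih =>
    simp_rw [Finset.sum_range_succ _ (n + 1)]
    refine (ih.add ((hasDerivAt_taylorWeight n s).mul (hkernel (n + 1)))).congr_deriv ?_
    ring

lemma continuousOn_heatDeriv (j : ℕ) {t : ℝ} (ht : 0 < t) (y : Spacetime d) :
    ContinuousOn (fun s => heatDeriv d j (t + s) y) (Set.Icc 0 1) := fun s hs => by
  have h : 0 < t + s := by linarith [hs.1]
  exact ((hasDerivAt_heatDeriv j h y).comp_const_add t s).continuousAt.continuousWithinAt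

lemma heatDeriv_taylor (n : ℕ) {t : ℝ} (ht : 0 < t) (y : Spacetime d) :
    heatDeriv d 0 t y
      = ∑ j ∈ Finset.range (n + 1), taylorCoeff j * heatDeriv d j (t + 1) y
        - ∫ s in Set.Ioc (0 : ℝ) 1, taylorWeight n s * heatDeriv d (n + 1) (t + s) y := by
  have hftc := intervalIntegral.integral_eq_sub_of_hasDerivAt (a := 0) (b := 1)
    (f := fun s => ∑ j ∈ Finset.range (n + 1), taylorWeight j s * heatDeriv d j (t + s) y)
    (f' := fun s => taylorWeight n s * heatDeriv d (n + 1) (t + s) y)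
    (fun s hs => by
      rw [Set.uIcc_of_le zero_le_one] at hs
      exact hasDerivAt_sum_taylor n (by linarith [hs.1]) y)
    (ContinuousOn.intervalIntegrable (by
      rw [Set.uIcc_of_le zero_le_one]
      exact (continuous_taylorWeight n).continuousOn.mul (continuousOn_heatDeriv _ ht y)))
  rw [intervalIntegral.integral_of_le zero_le_one] at hftc
  have hzero : ∑ j ∈ Finset.range (n + 1), taylorWeight j 0 * heatDeriv d j (t + 0) y
      = heatDeriv d 0 t y := by
    rw [Finset.sum_eq_single 0]
    · simp [taylorWeight]
    · intro j _ hj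
      simp [taylorWeight, hj]
    · simp
  rw [hftc, hzero]
  simp only [taylorCoeff, taylorWeight]
  ring

/-! ### Caloric families -/

lemma one_add_norm_pow_le (k : ℕ) (y : Spacetime d) :
    (1 + ‖y‖) ^ k ≤ 3 ^ k * (pnorm y ^ (0 : ℝ) + pnorm y ^ ((2 * k : ℕ) : ℝ)) := by
  have hy := norm_le_pnorm y
  rw [Real.rpow_zero, Real.rpow_natCast]
  set p := pnorm y
  have hp0 : 0 ≤ p := pnorm_nonneg y
  rcases le_total p 1 with hp1 | hp1
  · have hone : 1 + ‖y‖ ≤ 3 := by nlinarith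
    calc (1 + ‖y‖) ^ k ≤ 3 ^ k := by gcongr
      _ ≤ _ := le_mul_of_one_le_right (by positivity) (by linarith [pow_nonneg hp0 (2 * k)])
  · have hone : 1 + ‖y‖ ≤ 3 * p ^ 2 := by nlinarith
    calc (1 + ‖y‖) ^ k ≤ (3 * p ^ 2) ^ k := by gcongr
      _ = 3 ^ k * p ^ (2 * k) := by rw [mul_pow, ← pow_mul]
      _ ≤ _ := by gcongr; linarith

lemma rpow_le_endpoints {a b τ : ℝ} (ha : 0 < a) (haτ : a ≤ τ) (hτb : τ ≤ b) (e : ℝ) :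
    τ ^ e ≤ a ^ e + b ^ e := by
  have hτ : 0 < τ := ha.trans_le haτ
  rcases le_total 0 e with he | he
  · exact (Real.rpow_le_rpow hτ.le hτb he).trans
      (le_add_of_nonneg_left (Real.rpow_nonneg ha.le e))
  · exact (Real.rpow_le_rpow_of_nonpos ha haτ he).trans
      (le_add_of_nonneg_right (Real.rpow_nonneg (hτ.le.trans hτb) e))

lemma exists_integral_heatDeriv_poly_le (j k : ℕ) {a b : ℝ} (ha : 0 < a) :
    ∃ C : ℝ, ∀ τ, a ≤ τ → τ ≤ b → ∫ y, (1 + ‖y‖) ^ k * |heatDeriv d j τ y| ≤ C := by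
  refine ⟨3 ^ k * (heatMoment d j 0 * (a ^ ((0 : ℝ) / 4 - j) + b ^ ((0 : ℝ) / 4 - j))
    + heatMoment d j ((2 * k : ℕ) : ℝ)
      * (a ^ (((2 * k : ℕ) : ℝ) / 4 - j) + b ^ (((2 * k : ℕ) : ℝ) / 4 - j))),
    fun τ haτ hτb => ?_⟩
  have hτ : 0 < τ := ha.trans_le haτ
  have hint₁ := integrable_mul_pnorm_rpow (heatDeriv d j τ) (le_refl (0 : ℝ))
  have hint₂ := integrable_mul_pnorm_rpow (heatDeriv d j τ) (Nat.cast_nonneg (α := ℝ) (2 * k))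
  calc ∫ y, (1 + ‖y‖) ^ k * |heatDeriv d j τ y|
      ≤ ∫ y, 3 ^ k * (|heatDeriv d j τ y| * pnorm y ^ (0 : ℝ)
          + |heatDeriv d j τ y| * pnorm y ^ ((2 * k : ℕ) : ℝ)) := by
        refine integral_mono (integrable_one_add_norm_pow_mul (heatDeriv d j τ) k)
          ((hint₁.add hint₂).const_mul _) fun y => ?_
        calc (1 + ‖y‖) ^ k * |heatDeriv d j τ y|
            ≤ 3 ^ k * (pnorm y ^ (0 : ℝ) + pnorm y ^ ((2 * k : ℕ) : ℝ)) * |heatDeriv d j τ y| :=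
              mul_le_mul_of_nonneg_right (one_add_norm_pow_le k y) (abs_nonneg _)
          _ = _ := by ring
    _ = 3 ^ k * (heatMoment d j 0 * τ ^ ((0 : ℝ) / 4 - j)
        + heatMoment d j ((2 * k : ℕ) : ℝ) * τ ^ (((2 * k : ℕ) : ℝ) / 4 - j)) := by
        rw [integral_const_mul, integral_add hint₁ hint₂, integral_heatDeriv_pnorm _ _ hτ,
          integral_heatDeriv_pnorm _ _ hτ]
    _ ≤ _ := by
        have hmoment₁ := heatMoment_nonneg (d := d) j 0
        have hmoment₂ := heatMoment_nonneg (d := d) j ((2 * k : ℕ) : ℝ)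
        gcongr <;> exact rpow_le_endpoints ha haτ hτb _

/-- Families of functions that are propagated by the heat semigroup, such as the heat flow
`s ↦ Λ (heatAt s ·)` of a distribution. -/
structure IsCaloric (v : ℝ → Spacetime d → ℝ) : Prop where
  polyBdd : ∀ s, 0 < s → PolyBdd (v s)
  propagate : ∀ t s, 0 < t → 0 < s → ∀ x, v (t + s) x = sconv (heatDeriv d 0 t) (v s) x

lemma isCaloric_apply_heatAt (Λ : TempDist d) : IsCaloric fun s y => Λ (heatAt s y) :=
  ⟨fun s _ => polyBdd_apply_translate Λ (heatKernel d s),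
    fun _ _ ht hs x => apply_heatAt_add Λ ht hs x⟩

lemma sconv_heatDeriv_sconv (i j : ℕ) {r t : ℝ} (hr : 0 < r) (ht : 0 < t)
    {v : Spacetime d → ℝ} (hv : PolyBdd v) (x : Spacetime d) :
    sconv (heatDeriv d i r) (sconv (heatDeriv d j t) v) x
      = sconv (heatDeriv d (i + j) (r + t)) v x := by
  rw [sconv_sconv hv, conv_heatDeriv i j hr ht]

lemma IsCaloric.sconv_heatDeriv {v : ℝ → Spacetime d → ℝ} (hv : IsCaloric v) (j : ℕ)
    {r t s : ℝ} (hr : 0 < r) (ht : 0 < t) (hs : 0 < s) (x : Spacetime d) :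
    sconv (heatDeriv d j (r + t)) (v s) x = sconv (heatDeriv d j r) (v (t + s)) x := by
  have hpropagate : v (t + s) = sconv (heatDeriv d 0 t) (v s) := funext (hv.propagate t s ht hs)
  rw [hpropagate, sconv_heatDeriv_sconv j 0 hr ht (hv.polyBdd s hs), add_zero]

lemma IsCaloric.sconv_heatDeriv_half {v : ℝ → Spacetime d → ℝ} (hv : IsCaloric v) (j : ℕ)
    {t s : ℝ} (ht : 0 < t) (hs : 0 < s) (x : Spacetime d) :
    sconv (heatDeriv d j (t / 2 + s)) (v (t / 2)) x = sconv (heatDeriv d j t) (v s) x := by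
  rw [hv.sconv_heatDeriv j (half_pos ht) hs (half_pos ht), add_comm s,
    ← hv.sconv_heatDeriv j (half_pos ht) (half_pos ht) hs, add_halves]

lemma one_add_norm_le_mul {G : Type*} [SeminormedAddCommGroup G] (x y : G) :
    1 + ‖y‖ ≤ (1 + ‖x‖) * (1 + ‖x - y‖) := by
  have htriangle : ‖y‖ ≤ ‖x‖ + ‖x - y‖ := by
    simpa only [sub_sub_cancel] using norm_sub_le x (x - y)
  nlinarith [mul_nonneg (norm_nonneg x) (norm_nonneg (x - y))]

lemma PolyBdd.exists_integral_abs_heatDeriv_mul_le {v : Spacetime d → ℝ} (hv : PolyBdd v)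
    (j : ℕ) {a b : ℝ} (ha : 0 < a) (x : Spacetime d) :
    ∃ C : ℝ, ∀ τ, a ≤ τ → τ ≤ b → ∫ y, |heatDeriv d j τ (x - y) * v y| ≤ C := by
  obtain ⟨-, C, k, hC⟩ := hv
  have hC0 : 0 ≤ C := by simpa using (abs_nonneg _).trans (hC 0)
  obtain ⟨D, hD⟩ := exists_integral_heatDeriv_poly_le (d := d) j k (b := b) ha
  refine ⟨C * (1 + ‖x‖) ^ k * D, fun τ haτ hτb => ?_⟩
  have hint := (integrable_one_add_norm_pow_mul (heatDeriv d j τ) k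
    (μ := volume)).comp_sub_left x
  calc ∫ y, |heatDeriv d j τ (x - y) * v y|
      ≤ ∫ y, C * (1 + ‖x‖) ^ k * ((1 + ‖x - y‖) ^ k * |heatDeriv d j τ (x - y)|) := by
        refine integral_mono_of_nonneg (Filter.Eventually.of_forall fun y => abs_nonneg _)
          (hint.const_mul _) (Filter.Eventually.of_forall fun y => ?_)
        calc |heatDeriv d j τ (x - y) * v y|
            ≤ |heatDeriv d j τ (x - y)| * (C * ((1 + ‖x‖) * (1 + ‖x - y‖)) ^ k) := by
              rw [abs_mul]
              gcongr
              exact (hC y).trans (by gcongr; exact one_add_norm_le_mul x y)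
          _ = _ := by rw [mul_pow]; ring
    _ = C * (1 + ‖x‖) ^ k * ∫ y, (1 + ‖y‖) ^ k * |heatDeriv d j τ y| := by
        rw [integral_const_mul, integral_sub_left_eq_self
          (fun y => (1 + ‖y‖) ^ k * |heatDeriv d j τ y|) volume x]
    _ ≤ _ := by
        gcongr
        exact hD τ haτ hτb

lemma PolyBdd.integrable_taylor_prod {v : Spacetime d → ℝ} (hv : PolyBdd v) (n : ℕ) {t : ℝ}
    (ht : 0 < t) (x : Spacetime d) :
    Integrable (fun p : ℝ × Spacetime d =>
      taylorWeight n p.1 * (heatDeriv d (n + 1) (t + p.1) (x - p.2) * v p.2))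
      ((volume.restrict (Set.Ioc (0 : ℝ) 1)).prod volume) := by
  have hmeas : AEStronglyMeasurable (fun p : ℝ × Spacetime d =>
      taylorWeight n p.1 * (heatDeriv d (n + 1) (t + p.1) (x - p.2) * v p.2))
      ((volume.restrict (Set.Ioc (0 : ℝ) 1)).prod volume) := by
    have hkernel : Measurable fun p : ℝ × Spacetime d =>
        heatDeriv d (n + 1) (t + p.1) (x - p.2) :=
      measurable_heatDeriv_comp (n + 1) (measurable_fst.const_add t) (measurable_snd.const_sub x)
    exact (((continuous_taylorWeight n).measurable.comp measurable_fst).mul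
      (hkernel.mul (hv.1.comp measurable_snd))).aestronglyMeasurable
  obtain ⟨C, hC⟩ := hv.exists_integral_abs_heatDeriv_mul_le (n + 1) (b := t + 1) ht x
  rw [integrable_prod_iff hmeas]
  refine ⟨Filter.Eventually.of_forall fun s =>
    (hv.integrable_sconv (heatDeriv d (n + 1) (t + s)) x).const_mul (taylorWeight n s), ?_⟩
  refine Integrable.of_bound hmeas.norm.integral_prod_right' C ?_
  filter_upwards [ae_restrict_mem measurableSet_Ioc] with s hs
  have hweight : |taylorWeight n s| ≤ 1 :=
    (abs_taylorWeight_le n hs.1.le).trans (pow_le_one₀ hs.1.le hs.2)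
  rw [Real.norm_of_nonneg (integral_nonneg fun y => norm_nonneg _)]
  simp only [norm_mul (taylorWeight n s), integral_const_mul, Real.norm_eq_abs]
  exact (mul_le_of_le_one_left (integral_nonneg fun y => abs_nonneg _) hweight).trans
    (hC _ (by linarith [hs.1]) (by linarith [hs.2]))

lemma PolyBdd.integrableOn_sconv_taylor {v : Spacetime d → ℝ} (hv : PolyBdd v) (n : ℕ) {t : ℝ}
    (ht : 0 < t) (x : Spacetime d) :
    IntegrableOn (fun s => taylorWeight n s * sconv (heatDeriv d (n + 1) (t + s)) v x)
      (Set.Ioc 0 1) := by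
  simpa only [IntegrableOn, sconv, integral_const_mul]
    using (hv.integrable_taylor_prod n ht x).integral_prod_left

lemma PolyBdd.sconv_heatDeriv_taylor {v : Spacetime d → ℝ} (hv : PolyBdd v) (n : ℕ) {t : ℝ}
    (ht : 0 < t) (x : Spacetime d) :
    sconv (heatDeriv d 0 t) v x
      = ∑ j ∈ Finset.range (n + 1), taylorCoeff j * sconv (heatDeriv d j (t + 1)) v x
        - ∫ s in Set.Ioc (0 : ℝ) 1,
            taylorWeight n s * sconv (heatDeriv d (n + 1) (t + s)) v x := by
  have hprod := hv.integrable_taylor_prod n ht x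
  have hterm (j : ℕ) :
      Integrable fun y => taylorCoeff j * (heatDeriv d j (t + 1) (x - y) * v y) :=
    (hv.integrable_sconv _ x).const_mul _
  have hkernel (y : Spacetime d) : heatDeriv d 0 t (x - y) * v y
      = ∑ j ∈ Finset.range (n + 1), taylorCoeff j * (heatDeriv d j (t + 1) (x - y) * v y)
        - ∫ s in Set.Ioc (0 : ℝ) 1,
          taylorWeight n s * (heatDeriv d (n + 1) (t + s) (x - y) * v y) := by
    simp only [heatDeriv_taylor n ht, sub_mul, Finset.sum_mul, ← mul_assoc, integral_mul_const]
  simp only [sconv, hkernel, ← integral_const_mul]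
  rw [integral_sub (integrable_finsetSum _ fun j _ => hterm j) hprod.integral_prod_right,
    integral_finsetSum _ fun j _ => hterm j, integral_integral_swap (f := fun y s =>
      taylorWeight n s * (heatDeriv d (n + 1) (t + s) (x - y) * v y)) hprod.swap]

lemma IsCaloric.integrableOn_taylor {v : ℝ → Spacetime d → ℝ} (hv : IsCaloric v) (n : ℕ) {t : ℝ}
    (ht : 0 < t) (x : Spacetime d) :
    IntegrableOn (fun s => taylorWeight n s * sconv (heatDeriv d (n + 1) t) (v s) x)
      (Set.Ioc 0 1) := by
  refine ((hv.polyBdd _ (half_pos ht)).integrableOn_sconv_taylor n (half_pos ht) x).congr_fun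
    (fun s hs => ?_) measurableSet_Ioc
  beta_reduce
  rw [hv.sconv_heatDeriv_half _ ht hs.1]

lemma IsCaloric.taylor {v : ℝ → Spacetime d → ℝ} (hv : IsCaloric v) (n : ℕ) {t : ℝ}
    (ht : 0 < t) (x : Spacetime d) :
    v t x = ∑ j ∈ Finset.range (n + 1), taylorCoeff j * sconv (heatDeriv d j t) (v 1) x
      - ∫ s in Set.Ioc (0 : ℝ) 1,
          taylorWeight n s * sconv (heatDeriv d (n + 1) t) (v s) x := by
  have hhalf := half_pos ht
  have hstart := hv.propagate (t / 2) (t / 2) hhalf hhalf x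
  rw [add_halves, (hv.polyBdd _ hhalf).sconv_heatDeriv_taylor n hhalf] at hstart
  rw [hstart]
  congr 1
  · exact Finset.sum_congr rfl fun j _ => by rw [hv.sconv_heatDeriv_half j ht one_pos]
  · exact setIntegral_congr_fun measurableSet_Ioc fun s hs => by
      beta_reduce
      rw [hv.sconv_heatDeriv_half _ ht hs.1]

/-! ### Distributions given by families of functions -/

/-- The bounded measurable functions, the densities of `distOf`. -/
def boundedMeasurable (X : Type*) [MeasurableSpace X] : Submodule ℝ (X → ℝ) where
  carrier := {h | Measurable h ∧ ∃ C : ℝ, ∀ y, |h y| ≤ C}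
  add_mem' := by
    rintro a b ⟨ha, C, hC⟩ ⟨hb, D, hD⟩
    exact ⟨ha.add hb, C + D, fun y => (abs_add_le _ _).trans (add_le_add (hC y) (hD y))⟩
  zero_mem' := ⟨measurable_const, 0, fun y => by simp⟩
  smul_mem' := by
    rintro c a ⟨ha, C, hC⟩
    refine ⟨ha.const_smul c, |c| * C, fun y => ?_⟩
    rw [Pi.smul_apply, smul_eq_mul, abs_mul]
    exact mul_le_mul_of_nonneg_left (hC y) (abs_nonneg c)

section DistOf

variable {E : Type*} [NormedAddCommGroup E] [InnerProductSpace ℝ E] [FiniteDimensional ℝ E]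
  [MeasurableSpace E] [BorelSpace E]

lemma integrable_mul_of_mem_boundedMeasurable {h : E → ℝ} (hh : h ∈ boundedMeasurable E)
    (φ : 𝓢(E, ℝ)) : Integrable fun y => φ y * h y := by
  obtain ⟨hm, C, hC⟩ := hh
  exact (PolyBdd.of_bounded hm hC).integrable_mul φ

lemma abs_integral_mul_le_norm_toLpCLM {h : E → ℝ} {C : ℝ} (hC : ∀ y, |h y| ≤ C) (φ : 𝓢(E, ℝ)) :
    |∫ y, φ y * h y| ≤ C * ‖SchwartzMap.toLpCLM ℝ ℝ 1 (volume : Measure E) φ‖ := by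
  have hnorm : ‖SchwartzMap.toLpCLM ℝ ℝ 1 (volume : Measure E) φ‖ = ∫ y, ‖φ y‖ :=
    SchwartzMap.norm_toLp_one
  rw [hnorm, ← integral_const_mul]
  refine abs_integral_le_of_abs_le ((φ.integrable (μ := volume)).norm.const_mul C) fun y => ?_
  rw [abs_mul, mul_comm]
  exact mul_le_mul_of_nonneg_right (hC y) (abs_nonneg _)

/-- The pairing `(h, φ) ↦ ∫ φ h` underlying `distOf`. -/
def integralPairing : boundedMeasurable E →ₗ[ℝ] 𝓢(E, ℝ) →ₗ[ℝ] ℝ :=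
  LinearMap.mk₂ ℝ (fun h φ => ∫ y, φ y * h.1 y)
    (fun h h' φ => by
      rw [← integral_add (integrable_mul_of_mem_boundedMeasurable h.2 φ)
        (integrable_mul_of_mem_boundedMeasurable h'.2 φ)]
      exact integral_congr_ae (Filter.Eventually.of_forall fun y => mul_add _ _ _))
    (fun c h φ => by
      rw [smul_eq_mul, ← integral_const_mul]
      exact integral_congr_ae (Filter.Eventually.of_forall fun y => mul_left_comm _ _ _))
    (fun h φ χ => by
      simp only [add_apply, add_mul]
      exact integral_add (integrable_mul_of_mem_boundedMeasurable h.2 φ)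
        (integrable_mul_of_mem_boundedMeasurable h.2 χ))
    (fun c h φ => by simp only [smul_apply, smul_eq_mul, mul_assoc, integral_const_mul])

lemma continuous_integralPairing (h : boundedMeasurable E) :
    Continuous (integralPairing h) := by
  obtain ⟨-, C, hC⟩ := h.2
  obtain ⟨L, hL⟩ := exists_extension_of_bound
    (SchwartzMap.toLpCLM ℝ ℝ 1 (volume : Measure E)).toLinearMap (integralPairing h) C
    (abs_integral_mul_le_norm_toLpCLM hC)
  exact (L.continuous.comp (SchwartzMap.toLpCLM ℝ ℝ 1 volume).continuous).congr hL

/-- The tempered distribution of integration against a bounded measurable function. -/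
def distOf : boundedMeasurable E →ₗ[ℝ] 𝓢(E, ℝ) →L[ℝ] ℝ where
  toFun h := ⟨integralPairing h, continuous_integralPairing h⟩
  map_add' h h' := by
    ext φ
    exact LinearMap.congr_fun (map_add integralPairing h h') φ
  map_smul' c h := by
    ext φ
    exact LinearMap.congr_fun (map_smul integralPairing c h) φ

lemma distOf_apply (h : boundedMeasurable E) (φ : 𝓢(E, ℝ)) : distOf h φ = ∫ y, φ y * h.1 y := rfl

end DistOf

/-- The families of functions `(G_s)`, `0 < s ≤ 1`, that are bounded by a multiple of
`s ^ (α / 4)`, such as the heat flow of a distribution of regularity `α ≤ 0`. -/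
def familySpace (X : Type*) [MeasurableSpace X] (α : ℝ) : Submodule ℝ (ℝ → X → ℝ) where
  carrier := {G | Measurable (Function.uncurry G) ∧
    ∃ C : ℝ, ∀ s, 0 < s → s ≤ 1 → ∀ y, |G s y| ≤ C * s ^ (α / 4)}
  add_mem' := by
    rintro a b ⟨ha, C, hC⟩ ⟨hb, D, hD⟩
    refine ⟨ha.add hb, C + D, fun s hs hs1 y => (abs_add_le _ _).trans ?_⟩
    rw [add_mul]
    exact add_le_add (hC s hs hs1 y) (hD s hs hs1 y)
  zero_mem' := ⟨measurable_const, 0, fun s _ _ y => by simp⟩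
  smul_mem' := by
    rintro c a ⟨ha, C, hC⟩
    refine ⟨ha.const_smul c, |c| * C, fun s hs hs1 y => ?_⟩
    rw [Pi.smul_apply, Pi.smul_apply, smul_eq_mul, abs_mul, mul_assoc]
    exact mul_le_mul_of_nonneg_left (hC s hs hs1 y) (abs_nonneg c)

section Family

variable {X : Type*} {α : ℝ} {n : ℕ}

lemma abs_taylorWeight_mul_le (hn : 0 ≤ n + α / 4) {G : ℝ → X → ℝ} {C : ℝ}
    (hC : ∀ s, 0 < s → s ≤ 1 → ∀ y, |G s y| ≤ C * s ^ (α / 4)) {s : ℝ}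
    (hs : s ∈ Set.Ioc (0 : ℝ) 1) (y : X) : |taylorWeight n s * G s y| ≤ |C| := by
  have hpow_le : s ^ n * s ^ (α / 4) ≤ 1 := by
    rw [← Real.rpow_natCast, ← Real.rpow_add hs.1]
    exact Real.rpow_le_one hs.1.le hs.2 hn
  have hpow_nonneg : 0 ≤ s ^ (α / 4) := Real.rpow_nonneg hs.1.le _
  rw [abs_mul]
  calc |taylorWeight n s| * |G s y| ≤ s ^ n * (|C| * s ^ (α / 4)) := by
        refine mul_le_mul (abs_taylorWeight_le n hs.1.le) ((hC s hs.1 hs.2 y).trans ?_)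
          (abs_nonneg _) (pow_nonneg hs.1.le n)
        exact mul_le_mul_of_nonneg_right (le_abs_self C) hpow_nonneg
    _ = |C| * (s ^ n * s ^ (α / 4)) := by ring
    _ ≤ |C| := mul_le_of_le_one_right (abs_nonneg C) hpow_le

variable [MeasurableSpace X]

lemma integrableOn_taylorWeight_mul (hn : 0 ≤ n + α / 4) (G : familySpace X α) (y : X) :
    IntegrableOn (fun s => taylorWeight n s * G.1 s y) (Set.Ioc 0 1) := by
  obtain ⟨hm, C, hC⟩ := G.2
  refine Integrable.of_bound (Measurable.aestronglyMeasurable ?_) |C| ?_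
  · exact (continuous_taylorWeight n).measurable.mul hm.of_uncurry_right
  · filter_upwards [ae_restrict_mem measurableSet_Ioc] with s hs
    exact abs_taylorWeight_mul_le hn hC hs y

/-- The value at time `1` of a family. -/
def familyAtOne (α : ℝ) : familySpace X α →ₗ[ℝ] boundedMeasurable X where
  toFun G := ⟨G.1 1, G.2.1.of_uncurry_left, by
    obtain ⟨-, C, hC⟩ := G.2
    exact ⟨C, fun y => by simpa using hC 1 one_pos le_rfl y⟩⟩
  map_add' _ _ := rfl
  map_smul' _ _ := rfl

lemma setIntegral_taylorWeight_mul_mem (hn : 0 ≤ n + α / 4) (G : familySpace X α) :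
    (fun y => ∫ s in Set.Ioc (0 : ℝ) 1, taylorWeight n s * G.1 s y) ∈ boundedMeasurable X := by
  obtain ⟨hm, C, hC⟩ := G.2
  refine ⟨?_, |C|, fun y => ?_⟩
  · have hmeas : StronglyMeasurable fun q : X × ℝ => taylorWeight n q.2 * G.1 q.2 q.1 :=
      (((continuous_taylorWeight n).measurable.comp measurable_snd).mul
        (hm.comp measurable_swap)).stronglyMeasurable
    exact (hmeas.integral_prod_right' (ν := volume.restrict (Set.Ioc (0 : ℝ) 1))).measurable
  · simpa using norm_setIntegral_le_of_norm_le_const (μ := volume) (s := Set.Ioc (0 : ℝ) 1)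
      (f := fun s => taylorWeight n s * G.1 s y) (C := |C|) (by simp)
      fun s hs => abs_taylorWeight_mul_le hn hC hs y

/-- The weighted time integral of a family, which carries the remainder of its Taylor
expansion. -/
def familyIntegral (hn : 0 ≤ n + α / 4) : familySpace X α →ₗ[ℝ] boundedMeasurable X where
  toFun G := ⟨_, setIntegral_taylorWeight_mul_mem hn G⟩
  map_add' G G' := by
    ext y
    change ∫ s in Set.Ioc (0 : ℝ) 1, taylorWeight n s * (G.1 s y + G'.1 s y) = _
    simp only [mul_add]
    exact integral_add (integrableOn_taylorWeight_mul hn G y)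
      (integrableOn_taylorWeight_mul hn G' y)
  map_smul' c G := by
    ext y
    change ∫ s in Set.Ioc (0 : ℝ) 1, taylorWeight n s * (c * G.1 s y)
      = c * ∫ s in Set.Ioc (0 : ℝ) 1, taylorWeight n s * G.1 s y
    rw [← integral_const_mul]
    exact integral_congr_ae (Filter.Eventually.of_forall fun s => mul_left_comm _ _ _)

end Family

section FamilyDist

variable {α : ℝ} {n : ℕ} {E : Type*} [NormedAddCommGroup E] [InnerProductSpace ℝ E]
  [FiniteDimensional ℝ E] [MeasurableSpace E] [BorelSpace E]

lemma integrable_mul_taylorWeight_prod (hn : 0 ≤ n + α / 4) (G : familySpace E α)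
    (φ : 𝓢(E, ℝ)) (x : E) :
    Integrable (fun p : ℝ × E => φ (x - p.2) * (taylorWeight n p.1 * G.1 p.1 p.2))
      ((volume.restrict (Set.Ioc (0 : ℝ) 1)).prod volume) := by
  obtain ⟨hm, C, hC⟩ := G.2
  have hbound : Integrable (fun p : ℝ × E => |C| * |φ (x - p.2)|)
      ((volume.restrict (Set.Ioc (0 : ℝ) 1)).prod volume) :=
    (((φ.integrable (μ := volume)).norm.comp_sub_left x).comp_snd _).const_mul _
  have htime : ∀ᵐ p : ℝ × E
      ∂((volume.restrict (Set.Ioc (0 : ℝ) 1)).prod volume), p.1 ∈ Set.Ioc (0 : ℝ) 1 :=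
    Measure.quasiMeasurePreserving_fst.ae (ae_restrict_mem measurableSet_Ioc)
  refine hbound.mono' (Measurable.aestronglyMeasurable ?_) ?_
  · exact (φ.continuous.measurable.comp (measurable_snd.const_sub x)).mul
      (((continuous_taylorWeight n).measurable.comp measurable_fst).mul hm)
  · filter_upwards [htime] with p hp
    rw [Real.norm_eq_abs, abs_mul, mul_comm]
    exact mul_le_mul_of_nonneg_right (abs_taylorWeight_mul_le hn hC hp p.2) (abs_nonneg _)

lemma integrableOn_taylorWeight_mul_sconv (hn : 0 ≤ n + α / 4)
    (G : familySpace E α) (φ : 𝓢(E, ℝ)) (x : E) :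
    IntegrableOn (fun s => taylorWeight n s * sconv φ (G.1 s) x) (Set.Ioc 0 1) := by
  simp only [← sconv_const_mul]
  exact (integrable_mul_taylorWeight_prod hn G φ x).integral_prod_left

lemma sconv_familyIntegral (hn : 0 ≤ n + α / 4) (G : familySpace E α)
    (φ : 𝓢(E, ℝ)) (x : E) :
    sconv φ (familyIntegral hn G).1 x
      = ∫ s in Set.Ioc (0 : ℝ) 1, taylorWeight n s * sconv φ (G.1 s) x := by
  change ∫ y, φ (x - y) * ∫ s in Set.Ioc (0 : ℝ) 1, taylorWeight n s * G.1 s y = _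
  simp only [← sconv_const_mul, ← integral_const_mul]
  exact integral_integral_swap (f := fun y s => φ (x - y) * (taylorWeight n s * G.1 s y))
    (integrable_mul_taylorWeight_prod hn G φ x).swap

/-- The distribution obtained by integrating the Taylor expansion in time
`heatDeriv_taylor` against a family in place of a heat flow. -/
def familyDist (hn : 0 ≤ n + α / 4) : familySpace (Spacetime d) α →ₗ[ℝ] TempDist d where
  toFun G := ∑ j ∈ Finset.range (n + 1), taylorCoeff j • (distOf (familyAtOne α G) ∘L (opG d ^ j))
    - distOf (familyIntegral hn G) ∘L (opG d ^ (n + 1))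
  map_add' G G' := by
    simp only [map_add, ContinuousLinearMap.add_comp, smul_add, Finset.sum_add_distrib]
    abel
  map_smul' c G := by
    simp only [map_smul, ContinuousLinearMap.smul_comp, RingHom.id_apply, smul_sub,
      Finset.smul_sum, smul_comm c]

lemma integral_translate_heatDeriv_mul (j : ℕ) (t : ℝ) (x : Spacetime d) (h : Spacetime d → ℝ) :
    ∫ y, translate x (heatDeriv d j t) y * h y = sconv (heatDeriv d j t) h x := by
  simp only [translate_apply, sconv, heatDeriv_sub_comm j t x]

lemma familyDist_heatAt (hn : 0 ≤ n + α / 4) (G : familySpace (Spacetime d) α) (t : ℝ)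
    (x : Spacetime d) :
    familyDist hn G (heatAt t x)
      = ∑ j ∈ Finset.range (n + 1), taylorCoeff j * sconv (heatDeriv d j t) (G.1 1) x
        - ∫ s in Set.Ioc (0 : ℝ) 1,
            taylorWeight n s * sconv (heatDeriv d (n + 1) t) (G.1 s) x := by
  change (∑ j ∈ Finset.range (n + 1), taylorCoeff j • (distOf (familyAtOne α G) ∘L (opG d ^ j))
    - distOf (familyIntegral hn G) ∘L (opG d ^ (n + 1))) (heatAt t x) = _
  simp only [sub_apply, sum_apply, smul_apply, smul_eq_mul, ContinuousLinearMap.comp_apply,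
    opG_pow_heatAt, distOf_apply, integral_translate_heatDeriv_mul, sconv_familyIntegral]
  rfl

lemma familyDist_heatAt_of_isCaloric (hn : 0 ≤ n + α / 4) (G : familySpace (Spacetime d) α)
    (hG : IsCaloric G.1) {t : ℝ} (ht : 0 < t) (x : Spacetime d) :
    familyDist hn G (heatAt t x) = G.1 t x := by
  rw [familyDist_heatAt hn G t x, hG.taylor n ht x]

end FamilyDist

/-! ### Coherent germs of distributions -/

section Germ

variable {ι : Type*} [Fintype ι]

/-- The values `⟨Λ_y, p_s(y, ·)⟩` of a germ of distributions. -/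
def germVal (Λ : Spacetime d → TempDist d) (s : ℝ) (y : Spacetime d) : ℝ := Λ y (heatAt s y)

/-- A coherent germ of distributions: `Λ_y` and `Λ_x` agree up to order `γ` as `y` approaches `x`,
with a loss described by the exponents `β`, and the germ has regularity `α` on its diagonal. -/
structure IsGerm (β : ι → ℝ) (γ α A B : ℝ) (Λ : Spacetime d → TempDist d) : Prop where
  measurable : Measurable (Function.uncurry (germVal Λ))
  coherent : ∀ s, 0 < s → s ≤ 1 → ∀ x y,
    |(Λ y - Λ x) (heatAt s y)| ≤ A * ∑ i, s ^ (β i / 4) * pdist y x ^ (γ - β i)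
  bounded : ∀ s, 0 < s → s ≤ 1 → ∀ y, |germVal Λ s y| ≤ B * s ^ (α / 4)

/-- The coherent germs with given exponents, for some constants `A` and `B`. -/
def germSpace (d : ℕ) (β : ι → ℝ) (γ α : ℝ) : Submodule ℝ (Spacetime d → TempDist d) where
  carrier := {Λ | ∃ A B : ℝ, IsGerm β γ α A B Λ}
  add_mem' := by
    rintro Λ Λ' ⟨A, B, h⟩ ⟨A', B', h'⟩
    refine ⟨A + A', B + B', h.measurable.add h'.measurable, fun s hs hs1 x y => ?_,
      fun s hs hs1 y => ?_⟩
    · have hsum : ((Λ + Λ') y - (Λ + Λ') x) (heatAt s y)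
          = (Λ y - Λ x) (heatAt s y) + (Λ' y - Λ' x) (heatAt s y) := by
        simp only [Pi.add_apply, sub_apply, add_apply]
        ring
      rw [hsum, add_mul]
      exact (abs_add_le _ _).trans
        (add_le_add (h.coherent s hs hs1 x y) (h'.coherent s hs hs1 x y))
    · have hsum : germVal (Λ + Λ') s y = germVal Λ s y + germVal Λ' s y := rfl
      rw [hsum, add_mul]
      exact (abs_add_le _ _).trans (add_le_add (h.bounded s hs hs1 y) (h'.bounded s hs hs1 y))
  zero_mem' := ⟨0, 0, measurable_const, fun s _ _ x y => by simp, fun s _ _ y => by simp [germVal]⟩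
  smul_mem' := by
    rintro c Λ ⟨A, B, h⟩
    refine ⟨|c| * A, |c| * B, h.measurable.const_smul c, fun s hs hs1 x y => ?_,
      fun s hs hs1 y => ?_⟩
    · have hsmul : ((c • Λ) y - (c • Λ) x) (heatAt s y) = c * (Λ y - Λ x) (heatAt s y) := by
        simp only [Pi.smul_apply, sub_apply, smul_apply, smul_eq_mul]
        ring
      rw [hsmul, abs_mul, mul_assoc]
      exact mul_le_mul_of_nonneg_left (h.coherent s hs hs1 x y) (abs_nonneg c)
    · have hsmul : germVal (c • Λ) s y = c * germVal Λ s y := rfl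
      rw [hsmul, abs_mul, mul_assoc]
      exact mul_le_mul_of_nonneg_left (h.bounded s hs hs1 y) (abs_nonneg c)

variable {β : ι → ℝ} {γ α A B : ℝ} {Λ : Spacetime d → TempDist d}

lemma IsGerm.measurable_germVal (h : IsGerm β γ α A B Λ) (s : ℝ) : Measurable (germVal Λ s) :=
  h.measurable.of_uncurry_left

lemma IsGerm.polyBdd (h : IsGerm β γ α A B Λ) {s : ℝ} (hs : 0 < s) (hs1 : s ≤ 1) :
    PolyBdd (germVal Λ s) :=
  PolyBdd.of_bounded (h.measurable_germVal s) (h.bounded s hs hs1)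

lemma integral_abs_heatDeriv (j : ℕ) {t : ℝ} (ht : 0 < t) :
    ∫ y, |heatDeriv d j t y| = heatMoment d j 0 * t ^ (-(j : ℝ)) := by
  simpa using integral_heatDeriv_pnorm (d := d) j 0 ht

lemma IsGerm.abs_sconv_sub_le (h : IsGerm β γ α A B Λ) (hβ : ∀ i, β i < γ) (j : ℕ) {r s : ℝ}
    (hr : 0 < r) (hs : 0 < s) (hs1 : s ≤ 1) (x : Spacetime d) :
    |sconv (heatDeriv d j r) (fun y => germVal Λ s y - Λ x (heatAt s y)) x|
      ≤ A * ∑ i, heatMoment d j (γ - β i) * (s ^ (β i / 4) * r ^ ((γ - β i) / 4 - j)) := by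
  have hint (i : ι) : Integrable fun y =>
      s ^ (β i / 4) * (|heatDeriv d j r (x - y)| * pnorm (x - y) ^ (γ - β i)) :=
    ((integrable_mul_pnorm_rpow (heatDeriv d j r)
      (sub_nonneg.2 (hβ i).le)).comp_sub_left x).const_mul _
  calc |sconv (heatDeriv d j r) (fun y => germVal Λ s y - Λ x (heatAt s y)) x|
      ≤ ∫ y, A * ∑ i, s ^ (β i / 4) *
          (|heatDeriv d j r (x - y)| * pnorm (x - y) ^ (γ - β i)) := by
        refine abs_integral_le_of_abs_le
          ((integrable_finsetSum _ fun i _ => hint i).const_mul A) fun y => ?_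
        have hcoherent := h.coherent s hs hs1 x y
        rw [abs_mul]
        calc |heatDeriv d j r (x - y)| * |germVal Λ s y - Λ x (heatAt s y)|
            ≤ |heatDeriv d j r (x - y)| *
              (A * ∑ i, s ^ (β i / 4) * pdist y x ^ (γ - β i)) := by
              gcongr
              exact hcoherent
          _ = _ := by
              rw [pdist_eq, ← neg_sub, pnorm_neg, mul_left_comm, Finset.mul_sum]
              congr 1
              exact Finset.sum_congr rfl fun i _ => by ring
    _ = _ := by
        rw [integral_const_mul, integral_finsetSum _ fun i _ => hint i]
        congr 1
        refine Finset.sum_congr rfl fun i _ => ?_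
        rw [integral_const_mul, integral_sub_left_eq_self
          (fun y => |heatDeriv d j r y| * pnorm y ^ (γ - β i)) volume x,
          integral_heatDeriv_pnorm _ _ hr]
        ring

lemma IsGerm.abs_sconv_germVal_sub_le (h : IsGerm β γ α A B Λ) (hβ : ∀ i, β i < γ) {r s : ℝ}
    (hr : 0 < r) (hs : 0 < s) (hs1 : s ≤ 1) (x : Spacetime d) :
    |sconv (heatDeriv d 0 r) (germVal Λ s) x - germVal Λ (r + s) x|
      ≤ A * ∑ i, heatMoment d 0 (γ - β i) * (s ^ (β i / 4) * r ^ ((γ - β i) / 4)) := by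
  have hpropagate : germVal Λ (r + s) x
      = sconv (heatDeriv d 0 r) (fun y => Λ x (heatAt s y)) x := apply_heatAt_add (Λ x) hr hs x
  rw [hpropagate, ← sconv_sub (h.polyBdd hs hs1) ((isCaloric_apply_heatAt (Λ x)).polyBdd s hs)]
  simpa only [Nat.cast_zero, sub_zero] using h.abs_sconv_sub_le hβ 0 hr hs hs1 x

/-! ### Reconstruction of germs of positive order -/

/-- The dyadic times `2⁻ⁿ`. -/
def dyadic (n : ℕ) : ℝ := (1 / 2) ^ n

lemma dyadic_pos (n : ℕ) : 0 < dyadic n := by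
  unfold dyadic
  positivity

lemma dyadic_le_one (n : ℕ) : dyadic n ≤ 1 := pow_le_one₀ (by norm_num) (by norm_num)

lemma dyadic_succ_add_self (n : ℕ) : dyadic (n + 1) + dyadic (n + 1) = dyadic n := by
  unfold dyadic
  ring

lemma dyadic_antitone : Antitone dyadic := pow_right_anti₀ (by norm_num) (by norm_num)

lemma dyadic_rpow (n : ℕ) (e : ℝ) : dyadic n ^ e = ((1 / 2 : ℝ) ^ e) ^ n := by
  rw [dyadic, ← Real.rpow_natCast, ← Real.rpow_natCast, ← Real.rpow_mul (by norm_num),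
    ← Real.rpow_mul (by norm_num), mul_comm]

lemma half_rpow_lt_one {e : ℝ} (he : 0 < e) : (1 / 2 : ℝ) ^ e < 1 :=
  Real.rpow_lt_one (by norm_num) (by norm_num) he

lemma tendsto_dyadic_rpow {e : ℝ} (he : 0 < e) :
    Filter.Tendsto (fun n => dyadic n ^ e) Filter.atTop (nhds 0) := by
  simp only [dyadic_rpow]
  exact tendsto_pow_atTop_nhds_zero_of_lt_one (Real.rpow_nonneg (by norm_num) _)
    (half_rpow_lt_one he)

lemma exists_dyadic_lt {s : ℝ} (hs : 0 < s) : ∃ n, dyadic n < s :=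
  exists_pow_lt_of_lt_one hs (by norm_num)

lemma exists_dyadic_mem_Ico {t : ℝ} (ht : 0 < t) (ht1 : t ≤ 1) :
    ∃ n, dyadic n ∈ Set.Ico (t / 4) (t / 2) := by
  obtain ⟨n, hlt, hle⟩ := exists_nat_pow_near_of_lt_one (half_pos ht) (by linarith : t / 2 ≤ 1)
    (by norm_num : (0 : ℝ) < 1 / 2) (by norm_num : (1 / 2 : ℝ) < 1)
  change t / 2 ≤ dyadic n at hle
  exact ⟨n + 1, by linarith [dyadic_succ_add_self n], hlt⟩

/-- The approximations `p_{s - 2⁻ⁿ} ⋆ F_{2⁻ⁿ}` of the heat flow of the reconstruction, where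
`F_s = germVal Λ s`. They vanish for `s ≤ 2⁻ⁿ`, as `heatDeriv` does at nonpositive times. -/
def approx (Λ : Spacetime d → TempDist d) (n : ℕ) (s : ℝ) (x : Spacetime d) : ℝ :=
  sconv (heatDeriv d 0 (s - dyadic n)) (germVal Λ (dyadic n)) x

/-- The heat flow of the reconstruction of a germ of positive order. -/
def approxLim (Λ : Spacetime d → TempDist d) (s : ℝ) (x : Spacetime d) : ℝ :=
  Filter.limUnder Filter.atTop fun n => approx Λ n s x

/-- The constant in the distance between two successive approximations. -/
def stepConst (d : ℕ) (β : ι → ℝ) (γ : ℝ) : ℝ :=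
  heatMoment d 0 0 * ∑ i, heatMoment d 0 (γ - β i)

lemma stepConst_nonneg : 0 ≤ stepConst d β γ :=
  mul_nonneg (heatMoment_nonneg _ _) (Finset.sum_nonneg fun _ _ => heatMoment_nonneg _ _)

lemma IsGerm.polyBdd_sconv (h : IsGerm β γ α A B Λ) (χ : 𝓢(Spacetime d, ℝ)) {s : ℝ} (hs : 0 < s)
    (hs1 : s ≤ 1) : PolyBdd (sconv χ (germVal Λ s)) :=
  PolyBdd.of_bounded (measurable_sconv (h.measurable_germVal s) χ)
    (abs_sconv_le (h.bounded s hs hs1) χ)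

lemma IsGerm.polyBdd_approx (h : IsGerm β γ α A B Λ) (n : ℕ) (s : ℝ) : PolyBdd (approx Λ n s) :=
  h.polyBdd_sconv _ (dyadic_pos n) (dyadic_le_one n)

lemma IsGerm.approx_add (h : IsGerm β γ α A B Λ) {n : ℕ} {t s : ℝ} (ht : 0 < t)
    (hs : dyadic n < s) (x : Spacetime d) :
    approx Λ n (t + s) x = sconv (heatDeriv d 0 t) (approx Λ n s) x := by
  rw [approx, add_sub_assoc]
  exact (sconv_heatDeriv_sconv 0 0 ht (sub_pos.2 hs)
    (h.polyBdd (dyadic_pos n) (dyadic_le_one n)) x).symm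

lemma IsGerm.approx_succ (h : IsGerm β γ α A B Λ) {n : ℕ} {s : ℝ} (hs : dyadic n < s)
    (x : Spacetime d) :
    approx Λ (n + 1) s x = sconv (heatDeriv d 0 (s - dyadic n))
      (sconv (heatDeriv d 0 (dyadic (n + 1))) (germVal Λ (dyadic (n + 1)))) x := by
  rw [sconv_heatDeriv_sconv 0 0 (sub_pos.2 hs) (dyadic_pos _)
    (h.polyBdd (dyadic_pos _) (dyadic_le_one _)), approx, ← dyadic_succ_add_self n]
  congr 2
  ring

lemma IsGerm.abs_germVal_dyadic_sub_le (h : IsGerm β γ α A B Λ) (hβ : ∀ i, β i < γ) (n : ℕ)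
    (y : Spacetime d) :
    |germVal Λ (dyadic n) y
        - sconv (heatDeriv d 0 (dyadic (n + 1))) (germVal Λ (dyadic (n + 1))) y|
      ≤ A * (∑ i, heatMoment d 0 (γ - β i)) * dyadic (n + 1) ^ (γ / 4) := by
  have hε := dyadic_pos (n + 1)
  have hbound := h.abs_sconv_germVal_sub_le hβ hε hε (dyadic_le_one _) y
  rw [dyadic_succ_add_self, abs_sub_comm] at hbound
  refine hbound.trans_eq ?_
  rw [mul_assoc, Finset.sum_mul]
  congr 1
  refine Finset.sum_congr rfl fun i _ => ?_
  rw [← Real.rpow_add hε, ← add_div, add_sub_cancel]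

lemma IsGerm.abs_approx_sub_le (h : IsGerm β γ α A B Λ) (hβ : ∀ i, β i < γ) {n : ℕ} {s : ℝ}
    (hs : dyadic n < s) (x : Spacetime d) :
    |approx Λ n s x - approx Λ (n + 1) s x|
      ≤ stepConst d β γ * A * dyadic (n + 1) ^ (γ / 4) := by
  rw [h.approx_succ hs, approx, ← sconv_sub (h.polyBdd (dyadic_pos n) (dyadic_le_one n))
    (h.polyBdd_sconv _ (dyadic_pos _) (dyadic_le_one _))]
  refine (abs_sconv_le (h.abs_germVal_dyadic_sub_le hβ n) _ x).trans_eq ?_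
  rw [integral_abs_heatDeriv 0 (sub_pos.2 hs), stepConst, Nat.cast_zero, neg_zero, Real.rpow_zero]
  ring

lemma approx_of_nonpos (Λ : Spacetime d → TempDist d) (n : ℕ) {s : ℝ} (hs : s ≤ 0)
    (x : Spacetime d) : approx Λ n s x = 0 := by
  rw [approx, heatDeriv_of_nonpos (by linarith [dyadic_pos n])]
  simp [sconv]

/-- The constant in the distance from an approximation to the limit, which sums the geometric
series of the distances between successive approximations. -/
def limConst (d : ℕ) (β : ι → ℝ) (γ : ℝ) : ℝ :=
  stepConst d β γ * (1 / 2) ^ (γ / 4) / (1 - (1 / 2) ^ (γ / 4))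

lemma limConst_nonneg (hγ : 0 < γ) : 0 ≤ limConst d β γ :=
  div_nonneg (mul_nonneg stepConst_nonneg (by positivity))
    (sub_nonneg.2 (half_rpow_lt_one (by positivity)).le)

lemma IsGerm.exists_tendsto_approx (h : IsGerm β γ α A B Λ) (hβ : ∀ i, β i < γ) (hγ : 0 < γ)
    {n : ℕ} {s : ℝ} (hs : dyadic n < s) (x : Spacetime d) :
    ∃ l, Filter.Tendsto (fun k => approx Λ k s x) Filter.atTop (nhds l) ∧
      |approx Λ n s x - l| ≤ limConst d β γ * A * dyadic n ^ (γ / 4) := by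
  set q := (1 / 2 : ℝ) ^ (γ / 4) with hq
  have hq1 : q < 1 := half_rpow_lt_one (by positivity)
  set M := stepConst d β γ * A * q ^ (n + 1) with hM
  have hstep (k : ℕ) : dist (approx Λ (k + n) s x) (approx Λ (k + 1 + n) s x) ≤ M * q ^ k := by
    rw [Real.dist_eq, add_right_comm]
    refine (h.abs_approx_sub_le hβ ((dyadic_antitone (Nat.le_add_left n k)).trans_lt hs) x).trans_eq
      ?_
    rw [dyadic_rpow, ← hq, hM]
    ring
  obtain ⟨l, hl⟩ := cauchySeq_tendsto_of_complete (cauchySeq_of_le_geometric q M hq1 hstep)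
  refine ⟨l, (Filter.tendsto_add_atTop_iff_nat n).1 hl, ?_⟩
  have hdist := dist_le_of_le_geometric_of_tendsto₀ q M hq1 hstep hl
  rw [zero_add, Real.dist_eq] at hdist
  refine hdist.trans_eq ?_
  rw [dyadic_rpow, ← hq, hM, limConst, ← hq]
  ring

lemma IsGerm.abs_approx_sub_approxLim_le (h : IsGerm β γ α A B Λ) (hβ : ∀ i, β i < γ) (hγ : 0 < γ)
    {n : ℕ} {s : ℝ} (hs : dyadic n < s) (x : Spacetime d) :
    |approx Λ n s x - approxLim Λ s x| ≤ limConst d β γ * A * dyadic n ^ (γ / 4) := by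
  obtain ⟨l, hl, hbound⟩ := h.exists_tendsto_approx hβ hγ hs x
  rwa [approxLim, hl.limUnder_eq]

lemma IsGerm.tendsto_approx (h : IsGerm β γ α A B Λ) (hβ : ∀ i, β i < γ) (hγ : 0 < γ)
    (s : ℝ) (x : Spacetime d) :
    Filter.Tendsto (fun k => approx Λ k s x) Filter.atTop (nhds (approxLim Λ s x)) := by
  refine tendsto_nhds_limUnder ?_
  rcases le_or_gt s 0 with hs | hs
  · exact ⟨0, by simpa only [approx_of_nonpos Λ _ hs] using tendsto_const_nhds⟩
  · obtain ⟨n, hn⟩ := exists_dyadic_lt hs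
    obtain ⟨l, hl, -⟩ := h.exists_tendsto_approx hβ hγ hn x
    exact ⟨l, hl⟩

lemma IsGerm.measurable_approxLim (h : IsGerm β γ α A B Λ) (hβ : ∀ i, β i < γ) (hγ : 0 < γ) :
    Measurable (Function.uncurry (approxLim Λ)) := by
  have happrox (n : ℕ) : Measurable fun p : ℝ × Spacetime d => approx Λ n p.1 p.2 :=
    measurable_sconv_heatDeriv 0 (measurable_fst.sub_const _) measurable_snd
      ((h.measurable_germVal (dyadic n)).comp measurable_snd)
  exact measurable_of_tendsto_metrizable happrox
    (tendsto_pi_nhds.2 fun p => h.tendsto_approx hβ hγ p.1 p.2)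

lemma IsGerm.polyBdd_approxLim (h : IsGerm β γ α A B Λ) (hβ : ∀ i, β i < γ) (hγ : 0 < γ) {s : ℝ}
    (hs : 0 < s) : PolyBdd (approxLim Λ s) := by
  obtain ⟨n, hn⟩ := exists_dyadic_lt hs
  refine PolyBdd.of_bounded (h.measurable_approxLim hβ hγ).of_uncurry_left
    (C := B * dyadic n ^ (α / 4) * (∫ y, |heatDeriv d 0 (s - dyadic n) y|)
      + limConst d β γ * A * dyadic n ^ (γ / 4)) fun y => ?_
  have hlim := h.abs_approx_sub_approxLim_le hβ hγ hn y
  have happrox : |approx Λ n s y| ≤ _ :=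
    abs_sconv_le (h.bounded _ (dyadic_pos n) (dyadic_le_one n)) _ y
  rw [abs_sub_comm] at hlim
  linarith [abs_sub_abs_le_abs_sub (approxLim Λ s y) (approx Λ n s y)]

lemma IsGerm.abs_approx_add_sub_le (h : IsGerm β γ α A B Λ) (hβ : ∀ i, β i < γ) (hγ : 0 < γ)
    {n : ℕ} {t s : ℝ} (ht : 0 < t) (hs : dyadic n < s) (x : Spacetime d) :
    |approx Λ n (t + s) x - sconv (heatDeriv d 0 t) (approxLim Λ s) x|
      ≤ limConst d β γ * A * dyadic n ^ (γ / 4) * ∫ y, |heatDeriv d 0 t y| := by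
  rw [h.approx_add ht hs, ← sconv_sub (h.polyBdd_approx n s)
    (h.polyBdd_approxLim hβ hγ ((dyadic_pos n).trans hs))]
  exact abs_sconv_le (fun y => h.abs_approx_sub_approxLim_le hβ hγ hs y) _ x

lemma IsGerm.isCaloric_approxLim (h : IsGerm β γ α A B Λ) (hβ : ∀ i, β i < γ) (hγ : 0 < γ) :
    IsCaloric (approxLim Λ) := by
  refine ⟨fun s hs => h.polyBdd_approxLim hβ hγ hs, fun t s ht hs x =>
    tendsto_nhds_unique (h.tendsto_approx hβ hγ (t + s) x) ?_⟩
  obtain ⟨N, hN⟩ := exists_dyadic_lt hs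
  rw [tendsto_iff_norm_sub_tendsto_zero]
  refine squeeze_zero' (g := fun n => limConst d β γ * A * dyadic n ^ (γ / 4)
    * ∫ y, |heatDeriv d 0 t y|) (Filter.Eventually.of_forall fun n => norm_nonneg _) ?_ ?_
  · filter_upwards [Filter.eventually_ge_atTop N] with n hn
    exact h.abs_approx_add_sub_le hβ hγ ht ((dyadic_antitone hn).trans_lt hN) x
  · simpa using ((tendsto_dyadic_rpow (by positivity : 0 < γ / 4)).const_mul
      (limConst d β γ * A)).mul_const (∫ y, |heatDeriv d 0 t y|)

/-- The constant of the reconstruction bound for germs of positive order. -/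
def posConst (d : ℕ) (β : ι → ℝ) (γ : ℝ) : ℝ :=
  limConst d β γ + ∑ i, heatMoment d 0 (γ - β i) * 4 ^ |β i / 4|

lemma rpow_le_of_quarter_le {ε t : ℝ} (ht : 0 < t) (hle : t / 4 ≤ ε) (hεt : ε ≤ t) (e : ℝ) :
    ε ^ e ≤ 4 ^ |e| * t ^ e := by
  have hε : 0 < ε := by linarith
  rcases le_total 0 e with he | he
  · exact (Real.rpow_le_rpow hε.le hεt he).trans (le_mul_of_one_le_left (Real.rpow_nonneg ht.le e)
      (Real.one_le_rpow (by norm_num) (abs_nonneg e)))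
  · refine (Real.rpow_le_rpow_of_nonpos (by positivity) hle he).trans_eq ?_
    rw [Real.div_rpow ht.le (by norm_num), abs_of_nonpos he, Real.rpow_neg (by norm_num)]
    ring

lemma IsGerm.abs_sconv_germVal_sub_le_of_quarter_le (h : IsGerm β γ α A B Λ) (hA : 0 ≤ A)
    (hβ : ∀ i, β i < γ) {ε t : ℝ} (ht : 0 < t) (ht1 : t ≤ 1) (hle : t / 4 ≤ ε) (hεt : ε < t)
    (x : Spacetime d) :
    |sconv (heatDeriv d 0 (t - ε)) (germVal Λ ε) x - germVal Λ t x|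
      ≤ A * (∑ i, heatMoment d 0 (γ - β i) * 4 ^ |β i / 4|) * t ^ (γ / 4) := by
  have hε : 0 < ε := by linarith
  have hr : 0 < t - ε := sub_pos.2 hεt
  have hbound := h.abs_sconv_germVal_sub_le hβ hr hε (hεt.le.trans ht1) x
  rw [sub_add_cancel] at hbound
  refine hbound.trans ?_
  rw [mul_assoc, Finset.sum_mul]
  refine mul_le_mul_of_nonneg_left (Finset.sum_le_sum fun i _ => ?_) hA
  rw [mul_assoc]
  refine mul_le_mul_of_nonneg_left ?_ (heatMoment_nonneg _ _)
  have hsplit : t ^ (γ / 4) = t ^ (β i / 4) * t ^ ((γ - β i) / 4) := by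
    rw [← Real.rpow_add ht, ← add_div, add_sub_cancel]
  rw [hsplit, ← mul_assoc]
  exact mul_le_mul (rpow_le_of_quarter_le ht hle hεt.le _)
    (Real.rpow_le_rpow hr.le (by linarith) (by linarith [hβ i])) (Real.rpow_nonneg hr.le _)
    (mul_nonneg (by positivity) (Real.rpow_nonneg ht.le _))

lemma IsGerm.abs_approxLim_sub_le (h : IsGerm β γ α A B Λ) (hA : 0 ≤ A) (hβ : ∀ i, β i < γ)
    (hγ : 0 < γ) {t : ℝ} (ht : 0 < t) (ht1 : t ≤ 1) (x : Spacetime d) :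
    |approxLim Λ t x - germVal Λ t x| ≤ posConst d β γ * A * t ^ (γ / 4) := by
  obtain ⟨n, hle, hlt⟩ := exists_dyadic_mem_Ico ht ht1
  have hlt' : dyadic n < t := by linarith
  have hpow : dyadic n ^ (γ / 4) ≤ t ^ (γ / 4) :=
    Real.rpow_le_rpow (dyadic_pos n).le hlt'.le (by positivity)
  calc |approxLim Λ t x - germVal Λ t x|
      ≤ |approx Λ n t x - approxLim Λ t x| + |approx Λ n t x - germVal Λ t x| := by
        rw [abs_sub_comm (approx Λ n t x) (approxLim Λ t x)]
        exact abs_sub_le _ _ _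
    _ ≤ limConst d β γ * A * t ^ (γ / 4)
        + A * (∑ i, heatMoment d 0 (γ - β i) * 4 ^ |β i / 4|) * t ^ (γ / 4) :=
        add_le_add ((h.abs_approx_sub_approxLim_le hβ hγ hlt' x).trans
          (mul_le_mul_of_nonneg_left hpow (mul_nonneg (limConst_nonneg hγ) hA)))
          (h.abs_sconv_germVal_sub_le_of_quarter_le hA hβ ht ht1 hle hlt' x)
    _ = _ := by rw [posConst]; ring

lemma IsGerm.abs_const (h : IsGerm β γ α A B Λ) : IsGerm β γ α |A| B Λ := by
  refine ⟨h.measurable, fun s hs hs1 x y => (h.coherent s hs hs1 x y).trans ?_, h.bounded⟩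
  refine mul_le_mul_of_nonneg_right (le_abs_self A) (Finset.sum_nonneg fun i _ => ?_)
  rw [pdist_eq]
  exact mul_nonneg (Real.rpow_nonneg hs.le _) (Real.rpow_nonneg (pnorm_nonneg _) _)

lemma posConst_nonneg (hγ : 0 < γ) : 0 ≤ posConst d β γ :=
  add_nonneg (limConst_nonneg hγ) (Finset.sum_nonneg fun _ _ =>
    mul_nonneg (heatMoment_nonneg _ _) (by positivity))

lemma IsGerm.approxLim_mem (h : IsGerm β γ α A B Λ) (hβ : ∀ i, β i < γ) (hγ : 0 < γ)
    (hα : α ≤ 0) : approxLim Λ ∈ familySpace (Spacetime d) α := by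
  refine ⟨h.measurable_approxLim hβ hγ, posConst d β γ * |A| + B, fun s hs hs1 y => ?_⟩
  rw [add_mul]
  calc |approxLim Λ s y| ≤ |approxLim Λ s y - germVal Λ s y| + |germVal Λ s y| := by
        simpa only [sub_add_cancel] using
          abs_add_le (approxLim Λ s y - germVal Λ s y) (germVal Λ s y)
    _ ≤ posConst d β γ * |A| * s ^ (γ / 4) + B * s ^ (α / 4) :=
        add_le_add (h.abs_const.abs_approxLim_sub_le (abs_nonneg A) hβ hγ hs hs1 y)
          (h.bounded s hs hs1 y)
    _ ≤ posConst d β γ * |A| * s ^ (α / 4) + B * s ^ (α / 4) := by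
        refine add_le_add (mul_le_mul_of_nonneg_left ?_
          (mul_nonneg (posConst_nonneg hγ) (abs_nonneg A))) le_rfl
        exact Real.rpow_le_rpow_of_exponent_ge hs hs1 (by linarith)

lemma IsGerm.approxLim_add {A' B' A'' B'' : ℝ} {Λ' : Spacetime d → TempDist d}
    (h : IsGerm β γ α A B Λ) (h' : IsGerm β γ α A' B' Λ')
    (h'' : IsGerm β γ α A'' B'' (Λ + Λ')) (hβ : ∀ i, β i < γ) (hγ : 0 < γ) :
    approxLim (Λ + Λ') = approxLim Λ + approxLim Λ' := by
  funext s x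
  have happrox (n : ℕ) : approx Λ n s x + approx Λ' n s x = approx (Λ + Λ') n s x :=
    (sconv_add (h.polyBdd (dyadic_pos n) (dyadic_le_one n))
      (h'.polyBdd (dyadic_pos n) (dyadic_le_one n)) (heatDeriv d 0 (s - dyadic n)) x).symm
  have hsum := (h.tendsto_approx hβ hγ s x).add (h'.tendsto_approx hβ hγ s x)
  simp only [happrox] at hsum
  exact tendsto_nhds_unique (h''.tendsto_approx hβ hγ s x) hsum

lemma IsGerm.approxLim_smul {A'' B'' : ℝ} (c : ℝ) (h : IsGerm β γ α A B Λ)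
    (h'' : IsGerm β γ α A'' B'' (c • Λ)) (hβ : ∀ i, β i < γ) (hγ : 0 < γ) :
    approxLim (c • Λ) = c • approxLim Λ := by
  funext s x
  have happrox (n : ℕ) : c * approx Λ n s x = approx (c • Λ) n s x :=
    (sconv_const_mul c _ _ x).symm
  have hmul := (h.tendsto_approx hβ hγ s x).const_mul c
  simp only [happrox] at hmul
  exact tendsto_nhds_unique (h''.tendsto_approx hβ hγ s x) hmul

/-- The limits of the approximations, as an element of the space of families. -/
def approxFamily (hβ : ∀ i, β i < γ) (hγ : 0 < γ) (hα : α ≤ 0) :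
    germSpace d β γ α →ₗ[ℝ] familySpace (Spacetime d) α where
  toFun Λ := ⟨approxLim Λ.1, Λ.2.choose_spec.choose_spec.approxLim_mem hβ hγ hα⟩
  map_add' Λ Λ' := Subtype.ext (Λ.2.choose_spec.choose_spec.approxLim_add
    Λ'.2.choose_spec.choose_spec (Λ + Λ').2.choose_spec.choose_spec hβ hγ)
  map_smul' c Λ := Subtype.ext (Λ.2.choose_spec.choose_spec.approxLim_smul c
    (c • Λ).2.choose_spec.choose_spec hβ hγ)

lemma exists_reconstruction_of_pos (hβ : ∀ i, β i < γ) (hγ : 0 < γ) (hα : α ≤ 0) :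
    ∃ (C : ℝ) (R : germSpace d β γ α →ₗ[ℝ] TempDist d),
      ∀ (Λ : germSpace d β γ α) (A B : ℝ), 0 ≤ A → IsGerm β γ α A B Λ.1 →
        ∀ (x : Spacetime d) (t : ℝ), 0 < t → t ≤ 1 →
          |(R Λ - Λ.1 x) (heatAt t x)| ≤ C * A * t ^ (γ / 4) := by
  obtain ⟨n, hn⟩ := exists_nat_ge (-(α / 4))
  have hn' : 0 ≤ n + α / 4 := by linarith
  refine ⟨posConst d β γ, familyDist hn' ∘ₗ approxFamily hβ hγ hα,
    fun Λ A B hA h x t ht ht1 => ?_⟩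
  rw [sub_apply, LinearMap.comp_apply, familyDist_heatAt_of_isCaloric hn' _
    (h.isCaloric_approxLim hβ hγ) ht]
  exact h.abs_approxLim_sub_le hA hβ hγ ht ht1 x

/-! ### Reconstruction of germs of negative order -/

/-- The functions `x ↦ p_{s/2} ⋆ ⟨Λ_·, p_{s/2}(·, ·)⟩ (x)` for `s ≤ 1`. The time is truncated at `1`
since nothing is assumed on a germ at larger scales. -/
def halfFlow (Λ : Spacetime d → TempDist d) (s : ℝ) (x : Spacetime d) : ℝ :=
  sconv (heatDeriv d 0 (min s 1 / 2)) (germVal Λ (min s 1 / 2)) x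

lemma halfFlow_apply (Λ : Spacetime d → TempDist d) {s : ℝ} (hs : s ≤ 1) (x : Spacetime d) :
    halfFlow Λ s x = sconv (heatDeriv d 0 (s / 2)) (germVal Λ (s / 2)) x := by
  rw [halfFlow, min_eq_left hs]

lemma IsGerm.halfFlow_mem (h : IsGerm β γ α A B Λ) :
    halfFlow Λ ∈ familySpace (Spacetime d) α := by
  have hτ : Measurable fun p : ℝ × Spacetime d => min p.1 1 / 2 :=
    (measurable_fst.min measurable_const).div_const 2
  refine ⟨measurable_sconv_heatDeriv 0 hτ measurable_snd
    (v := fun p y => germVal Λ (min p.1 1 / 2) y)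
    (h.measurable.comp ((hτ.comp measurable_fst).prodMk measurable_snd)),
    B * heatMoment d 0 0 * (1 / 2) ^ (α / 4), fun s hs hs1 y => ?_⟩
  have hhalf : 0 < s / 2 := half_pos hs
  rw [halfFlow_apply Λ hs1]
  calc |sconv (heatDeriv d 0 (s / 2)) (germVal Λ (s / 2)) y|
      ≤ B * (s / 2) ^ (α / 4) * ∫ y, |heatDeriv d 0 (s / 2) y| :=
        abs_sconv_le (h.bounded _ hhalf (by linarith)) _ y
    _ = B * heatMoment d 0 0 * (1 / 2) ^ (α / 4) * s ^ (α / 4) := by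
        rw [integral_abs_heatDeriv 0 hhalf, Nat.cast_zero, neg_zero, Real.rpow_zero,
          div_eq_mul_one_div s 2, Real.mul_rpow hs.le (by norm_num)]
        ring

lemma IsGerm.halfFlow_add {A' B' : ℝ} {Λ' : Spacetime d → TempDist d}
    (h : IsGerm β γ α A B Λ) (h' : IsGerm β γ α A' B' Λ') :
    halfFlow (Λ + Λ') = halfFlow Λ + halfFlow Λ' := by
  funext s x
  rcases le_or_gt s 0 with hs | hs
  · have hτ : min s 1 / 2 ≤ 0 := by linarith [min_le_left s 1]
    simp [halfFlow, heatDeriv_of_nonpos hτ, sconv]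
  · have hτ : 0 < min s 1 / 2 := half_pos (lt_min hs one_pos)
    have hτ1 : min s 1 / 2 ≤ 1 := by linarith [min_le_right s 1]
    exact sconv_add (h.polyBdd hτ hτ1) (h'.polyBdd hτ hτ1) _ x

/-- The half-time flow of a germ, as an element of the space of families. -/
def halfFamily (β : ι → ℝ) (γ α : ℝ) :
    germSpace d β γ α →ₗ[ℝ] familySpace (Spacetime d) α where
  toFun Λ := ⟨halfFlow Λ.1, Λ.2.choose_spec.choose_spec.halfFlow_mem⟩
  map_add' Λ Λ' := Subtype.ext
    (Λ.2.choose_spec.choose_spec.halfFlow_add Λ'.2.choose_spec.choose_spec)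
  map_smul' c _ := Subtype.ext (funext fun _ => funext fun x => sconv_const_mul c _ _ x)

lemma IsGerm.sconv_halfFlow_sub (h : IsGerm β γ α A B Λ) (j : ℕ) {t s : ℝ} (ht : 0 < t)
    (hs : 0 < s) (hs1 : s ≤ 1) (x : Spacetime d) :
    sconv (heatDeriv d j t) (halfFlow Λ s) x
        - sconv (heatDeriv d j t) (fun y => Λ x (heatAt s y)) x
      = sconv (heatDeriv d j (t + s / 2))
        (fun y => germVal Λ (s / 2) y - Λ x (heatAt (s / 2) y)) x := by
  have hhalf : 0 < s / 2 := half_pos hs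
  have hgerm := h.polyBdd hhalf (by linarith)
  have hflow := (isCaloric_apply_heatAt (Λ x)).polyBdd _ hhalf
  have hhalfFlow : halfFlow Λ s = sconv (heatDeriv d 0 (s / 2)) (germVal Λ (s / 2)) :=
    funext (halfFlow_apply Λ hs1)
  have hsemigroup : (fun y => Λ x (heatAt s y))
      = sconv (heatDeriv d 0 (s / 2)) fun y => Λ x (heatAt (s / 2) y) := by
    funext y
    rw [← apply_heatAt_add (Λ x) hhalf hhalf, add_halves]
  rw [hhalfFlow, hsemigroup, sconv_heatDeriv_sconv j 0 ht hhalf hgerm,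
    sconv_heatDeriv_sconv j 0 ht hhalf hflow, add_zero, sconv_sub hgerm hflow]

/-- The constant of the boundary terms for negative exponent. -/
def boundaryConst (d : ℕ) (β : ι → ℝ) (γ : ℝ) (j : ℕ) : ℝ :=
  ∑ i, heatMoment d j (γ - β i) * ((1 / 2) ^ (β i / 4) *
    ((1 / 2) ^ ((γ - β i) / 4 - j) + (3 / 2) ^ ((γ - β i) / 4 - j)))

lemma IsGerm.abs_sconv_halfFlow_one_sub_le (h : IsGerm β γ α A B Λ) (hA : 0 ≤ A)
    (hβ : ∀ i, β i < γ) (j : ℕ) {t : ℝ} (ht : 0 < t) (ht1 : t ≤ 1) (x : Spacetime d) :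
    |sconv (heatDeriv d j t) (halfFlow Λ 1) x
        - sconv (heatDeriv d j t) (fun y => Λ x (heatAt 1 y)) x| ≤ boundaryConst d β γ j * A := by
  rw [h.sconv_halfFlow_sub j ht one_pos le_rfl, mul_comm, boundaryConst]
  refine (h.abs_sconv_sub_le hβ j (by linarith : 0 < t + 1 / 2)
    (by norm_num : (0 : ℝ) < 1 / 2) (by norm_num) x).trans ?_
  gcongr with i _
  · exact heatMoment_nonneg _ _
  · exact rpow_le_endpoints (by norm_num) (by linarith) (by linarith) _

lemma pow_mul_half_rpow_mul_le {n : ℕ} {b : ℝ} (hnb : 0 ≤ n + b / 4) (γ : ℝ) {t s : ℝ}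
    (ht : 0 < t) (hs : 0 < s) :
    s ^ n * ((s / 2) ^ (b / 4) * (t + s / 2) ^ ((γ - b) / 4 - ((n + 1 : ℕ) : ℝ)))
      ≤ 2 ^ n * (t + s / 2) ^ (γ / 4 - 1) := by
  have hhalf : 0 < s / 2 := half_pos hs
  have hts : 0 < t + s / 2 := by linarith
  have hpow : s ^ n * (s / 2) ^ (b / 4) = 2 ^ n * (s / 2) ^ (n + b / 4) := by
    rw [Real.rpow_add hhalf, Real.rpow_natCast, div_pow]
    field_simp
  rw [← mul_assoc, hpow, mul_assoc]
  refine mul_le_mul_of_nonneg_left ?_ (by positivity)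
  calc (s / 2) ^ (n + b / 4) * (t + s / 2) ^ ((γ - b) / 4 - ((n + 1 : ℕ) : ℝ))
      ≤ (t + s / 2) ^ (n + b / 4) * (t + s / 2) ^ ((γ - b) / 4 - ((n + 1 : ℕ) : ℝ)) :=
        mul_le_mul_of_nonneg_right (Real.rpow_le_rpow hhalf.le (by linarith) hnb)
          (Real.rpow_nonneg hts.le _)
    _ = (t + s / 2) ^ (γ / 4 - 1) := by
        rw [← Real.rpow_add hts]
        congr 1
        push_cast
        ring

lemma IsGerm.abs_taylorWeight_mul_sconv_halfFlow_sub_le (h : IsGerm β γ α A B Λ) (hA : 0 ≤ A)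
    (hβ : ∀ i, β i < γ) {n : ℕ} (hn : ∀ i, 0 ≤ n + β i / 4) {t s : ℝ} (ht : 0 < t)
    (hs : 0 < s) (hs1 : s ≤ 1) (x : Spacetime d) :
    |taylorWeight n s * (sconv (heatDeriv d (n + 1) t) (halfFlow Λ s) x
        - sconv (heatDeriv d (n + 1) t) (fun y => Λ x (heatAt s y)) x)|
      ≤ A * (∑ i, heatMoment d (n + 1) (γ - β i)) * 2 ^ n * (t + s / 2) ^ (γ / 4 - 1) := by
  have hhalf : 0 < s / 2 := half_pos hs
  rw [h.sconv_halfFlow_sub (n + 1) ht hs hs1, abs_mul]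
  calc _ ≤ s ^ n * (A * ∑ i, heatMoment d (n + 1) (γ - β i) *
        ((s / 2) ^ (β i / 4) * (t + s / 2) ^ ((γ - β i) / 4 - ((n + 1 : ℕ) : ℝ)))) :=
        mul_le_mul (abs_taylorWeight_le n hs.le)
          (h.abs_sconv_sub_le hβ (n + 1) (by linarith : 0 < t + s / 2) hhalf (by linarith) x)
          (abs_nonneg _) (by positivity)
    _ = A * ∑ i, heatMoment d (n + 1) (γ - β i) * (s ^ n *
        ((s / 2) ^ (β i / 4) * (t + s / 2) ^ ((γ - β i) / 4 - ((n + 1 : ℕ) : ℝ)))) := by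
        rw [mul_left_comm, Finset.mul_sum]
        simp only [mul_left_comm (s ^ n)]
    _ ≤ A * ∑ i, heatMoment d (n + 1) (γ - β i) * (2 ^ n * (t + s / 2) ^ (γ / 4 - 1)) := by
        refine mul_le_mul_of_nonneg_left (Finset.sum_le_sum fun i _ => ?_) hA
        exact mul_le_mul_of_nonneg_left (pow_mul_half_rpow_mul_le (hn i) γ ht hs)
          (heatMoment_nonneg _ _)
    _ = _ := by rw [← Finset.sum_mul]; ring

lemma continuousOn_half_rpow {t : ℝ} (ht : 0 < t) (e : ℝ) :
    ContinuousOn (fun s : ℝ => (t + s / 2) ^ e) (Set.Icc 0 1) :=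
  ContinuousOn.rpow_const (by fun_prop) fun s hs => Or.inl (by linarith [hs.1])

lemma integrableOn_half_rpow {t : ℝ} (ht : 0 < t) (e : ℝ) :
    IntegrableOn (fun s : ℝ => (t + s / 2) ^ e) (Set.Ioc 0 1) :=
  (continuousOn_half_rpow ht e).integrableOn_Icc.mono_set Set.Ioc_subset_Icc_self

lemma integral_half_rpow_le (hγ : γ < 0) {t : ℝ} (ht : 0 < t) :
    ∫ s in Set.Ioc (0 : ℝ) 1, (t + s / 2) ^ (γ / 4 - 1) ≤ 8 / (-γ) * t ^ (γ / 4) := by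
  have hderiv : ∀ s ∈ Set.uIcc (0 : ℝ) 1,
      HasDerivAt (fun s : ℝ => 8 / γ * (t + s / 2) ^ (γ / 4)) ((t + s / 2) ^ (γ / 4 - 1)) s := by
    intro s hs
    rw [Set.uIcc_of_le zero_le_one] at hs
    have hpos : t + s / 2 ≠ 0 := by linarith [hs.1]
    have hlin : HasDerivAt (fun s : ℝ => t + s / 2) (1 / 2) s :=
      ((hasDerivAt_id s).div_const 2).const_add t
    have hγ0 : γ ≠ 0 := hγ.ne
    refine ((hlin.rpow_const (p := γ / 4) (Or.inl hpos)).const_mul (8 / γ)).congr_deriv ?_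
    field_simp
    ring
  have hint : IntervalIntegrable (fun s : ℝ => (t + s / 2) ^ (γ / 4 - 1)) volume 0 1 :=
    (intervalIntegrable_iff_integrableOn_Ioc_of_le zero_le_one).2 (integrableOn_half_rpow ht _)
  rw [← intervalIntegral.integral_of_le zero_le_one,
    intervalIntegral.integral_eq_sub_of_hasDerivAt hderiv hint, zero_div, add_zero]
  have hnonneg : 0 ≤ 8 / (-γ) * (t + 1 / 2) ^ (γ / 4) :=
    mul_nonneg (div_nonneg (by norm_num) (by linarith)) (Real.rpow_nonneg (by linarith) _)
  rw [div_neg] at hnonneg ⊢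
  linarith

lemma IsGerm.abs_integral_taylorWeight_mul_sconv_halfFlow_sub_le (h : IsGerm β γ α A B Λ)
    (hA : 0 ≤ A) (hβ : ∀ i, β i < γ) (hγ : γ < 0) {n : ℕ} (hn : ∀ i, 0 ≤ n + β i / 4) {t : ℝ}
    (ht : 0 < t) (x : Spacetime d) :
    |∫ s in Set.Ioc (0 : ℝ) 1, taylorWeight n s * (sconv (heatDeriv d (n + 1) t) (halfFlow Λ s) x
        - sconv (heatDeriv d (n + 1) t) (fun y => Λ x (heatAt s y)) x)|
      ≤ (∑ i, heatMoment d (n + 1) (γ - β i)) * 2 ^ n * (8 / (-γ)) * A * t ^ (γ / 4) := by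
  set M := A * (∑ i, heatMoment d (n + 1) (γ - β i)) * 2 ^ n with hM
  have hM0 : 0 ≤ M := mul_nonneg (mul_nonneg hA
    (Finset.sum_nonneg fun i _ => heatMoment_nonneg _ _)) (by positivity)
  rw [← Real.norm_eq_abs]
  calc _ ≤ ∫ s in Set.Ioc (0 : ℝ) 1, M * (t + s / 2) ^ (γ / 4 - 1) := by
        refine norm_integral_le_of_norm_le ((integrableOn_half_rpow ht _).const_mul M) ?_
        filter_upwards [ae_restrict_mem measurableSet_Ioc] with s hs
        exact h.abs_taylorWeight_mul_sconv_halfFlow_sub_le hA hβ hn ht hs.1 hs.2 x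
    _ ≤ M * (8 / (-γ) * t ^ (γ / 4)) := by
        rw [integral_const_mul]
        exact mul_le_mul_of_nonneg_left (integral_half_rpow_le hγ ht) hM0
    _ = _ := by rw [hM]; ring

lemma familyDist_halfFamily_sub_apply {n : ℕ} (hn : 0 ≤ n + α / 4) (Λ : germSpace d β γ α)
    {t : ℝ} (ht : 0 < t) (x : Spacetime d) :
    (familyDist hn (halfFamily β γ α Λ) - Λ.1 x) (heatAt t x)
      = ∑ j ∈ Finset.range (n + 1), taylorCoeff j *
          (sconv (heatDeriv d j t) (halfFlow Λ.1 1) x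
            - sconv (heatDeriv d j t) (fun y => Λ.1 x (heatAt 1 y)) x)
        - ∫ s in Set.Ioc (0 : ℝ) 1, taylorWeight n s *
          (sconv (heatDeriv d (n + 1) t) (halfFlow Λ.1 s) x
            - sconv (heatDeriv d (n + 1) t) (fun y => Λ.1 x (heatAt s y)) x) := by
  have hcaloric := isCaloric_apply_heatAt (Λ.1 x)
  have hint : IntegrableOn (fun s => taylorWeight n s *
      sconv (heatDeriv d (n + 1) t) (halfFlow Λ.1 s) x) (Set.Ioc 0 1) :=
    integrableOn_taylorWeight_mul_sconv hn (halfFamily β γ α Λ) (heatDeriv d (n + 1) t) x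
  simp only [mul_sub, Finset.sum_sub_distrib]
  rw [integral_sub hint (hcaloric.integrableOn_taylor n ht x), sub_apply, familyDist_heatAt,
    hcaloric.taylor n ht x]
  exact sub_sub_sub_comm _ _ _ _

/-- The constant of the reconstruction bound for germs of negative order. -/
def negConst (d : ℕ) (β : ι → ℝ) (γ : ℝ) (n : ℕ) : ℝ :=
  ∑ j ∈ Finset.range (n + 1), |taylorCoeff j| * boundaryConst d β γ j
    + (∑ i, heatMoment d (n + 1) (γ - β i)) * 2 ^ n * (8 / (-γ))

lemma IsGerm.abs_familyDist_halfFamily_sub_le {Λ : germSpace d β γ α}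
    (h : IsGerm β γ α A B Λ.1) (hA : 0 ≤ A) (hβ : ∀ i, β i < γ) (hγ : γ < 0) {n : ℕ}
    (hn : 0 ≤ n + α / 4) (hnβ : ∀ i, 0 ≤ n + β i / 4) {t : ℝ} (ht : 0 < t) (ht1 : t ≤ 1)
    (x : Spacetime d) :
    |(familyDist hn (halfFamily β γ α Λ) - Λ.1 x) (heatAt t x)|
      ≤ negConst d β γ n * A * t ^ (γ / 4) := by
  have htγ : 1 ≤ t ^ (γ / 4) := Real.one_le_rpow_of_pos_of_le_one_of_nonpos ht ht1 (by linarith)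
  have hboundary (j : ℕ) : |sconv (heatDeriv d j t) (halfFlow Λ.1 1) x
      - sconv (heatDeriv d j t) (fun y => Λ.1 x (heatAt 1 y)) x|
      ≤ boundaryConst d β γ j * A * t ^ (γ / 4) := by
    have hone := h.abs_sconv_halfFlow_one_sub_le hA hβ j ht ht1 x
    exact hone.trans (le_mul_of_one_le_right ((abs_nonneg _).trans hone) htγ)
  rw [familyDist_halfFamily_sub_apply hn Λ ht x, negConst, add_mul, add_mul, Finset.sum_mul,
    Finset.sum_mul]
  refine (abs_sub _ _).trans (add_le_add ((Finset.abs_sum_le_sum_abs _ _).trans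
    (Finset.sum_le_sum fun j _ => ?_))
    (h.abs_integral_taylorWeight_mul_sconv_halfFlow_sub_le hA hβ hγ hnβ ht x))
  rw [abs_mul, mul_assoc |taylorCoeff j|, mul_assoc |taylorCoeff j|]
  exact mul_le_mul_of_nonneg_left (hboundary j) (abs_nonneg _)

lemma exists_reconstruction_of_neg (hβ : ∀ i, β i < γ) (hγ : γ < 0) :
    ∃ (C : ℝ) (R : germSpace d β γ α →ₗ[ℝ] TempDist d),
      ∀ (Λ : germSpace d β γ α) (A B : ℝ), 0 ≤ A → IsGerm β γ α A B Λ.1 →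
        ∀ (x : Spacetime d) (t : ℝ), 0 < t → t ≤ 1 →
          |(R Λ - Λ.1 x) (heatAt t x)| ≤ C * A * t ^ (γ / 4) := by
  obtain ⟨n, hn⟩ := exists_nat_ge (|α / 4| + ∑ i, |β i / 4|)
  have hsum : 0 ≤ ∑ i, |β i / 4| := Finset.sum_nonneg fun i _ => abs_nonneg _
  have hnα : 0 ≤ n + α / 4 := by linarith [neg_abs_le (α / 4)]
  have hnβ (i : ι) : 0 ≤ n + β i / 4 := by
    have hle := Finset.single_le_sum (f := fun i => |β i / 4|) (fun i _ => abs_nonneg _)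
      (Finset.mem_univ i)
    linarith [neg_abs_le (β i / 4), abs_nonneg (α / 4)]
  exact ⟨negConst d β γ n, familyDist hnα ∘ₗ halfFamily β γ α, fun Λ A B hA h x t ht ht1 =>
    h.abs_familyDist_halfFamily_sub_le hA hβ hγ hnα hnβ ht ht1 x⟩

theorem exists_reconstruction (d : ℕ) (hβ : ∀ i, β i < γ) (hγ : γ ≠ 0) (hα : α ≤ 0) :
    ∃ (C : ℝ) (R : germSpace d β γ α →ₗ[ℝ] TempDist d),
      ∀ (Λ : germSpace d β γ α) (A B : ℝ), 0 ≤ A → IsGerm β γ α A B Λ.1 →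
        ∀ (x : Spacetime d) (t : ℝ), 0 < t → t ≤ 1 →
          |(R Λ - Λ.1 x) (heatAt t x)| ≤ C * A * t ^ (γ / 4) := by
  rcases lt_or_gt_of_ne hγ with h | h
  · exact exists_reconstruction_of_neg hβ h
  · exact exists_reconstruction_of_pos hβ h hα

end Germ

/-! ### Hölder bounds -/

section Holder

/-- The constant in the bound of `Q_t^{(N)}` by the heat kernel. -/
def QAtConst (d N : ℕ) (α : ℝ) : ℝ := heatMoment d N 0 * 2 ^ N * (1 / 2) ^ (α / 4)

lemma QAtConst_nonneg (d N : ℕ) (α : ℝ) : 0 ≤ QAtConst d N α :=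
  mul_nonneg (mul_nonneg (heatMoment_nonneg _ _) (by positivity)) (by positivity)

variable {Λ : TempDist d} {α D : ℝ}

lemma abs_apply_QAt_le
    (h : ∀ (x : Spacetime d) (t : ℝ), 0 < t → t ≤ 1 → |Λ (heatAt t x)| ≤ D * t ^ (α / 4))
    (N : ℕ) {t : ℝ} (ht : 0 < t) (ht1 : t ≤ 1) (x : Spacetime d) :
    |Λ (QAt N t x)| ≤ QAtConst d N α * D * t ^ (α / 4) := by
  have hhalf : 0 < t / 2 := half_pos ht
  have hsplit := apply_translate_heatDeriv Λ N hhalf hhalf x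
  rw [add_halves] at hsplit
  rw [QAt_eq, map_smul, hsplit, smul_eq_mul, abs_mul, abs_pow, abs_neg, abs_of_pos ht]
  calc t ^ N * |sconv (heatDeriv d N (t / 2)) (fun y => Λ (heatAt (t / 2) y)) x|
      ≤ t ^ N * (D * (t / 2) ^ (α / 4) * (heatMoment d N 0 * (t / 2) ^ (-(N : ℝ)))) := by
        rw [← integral_abs_heatDeriv N hhalf]
        exact mul_le_mul_of_nonneg_left
          (abs_sconv_le (fun y => h y (t / 2) hhalf (by linarith)) _ x) (by positivity)
    _ = QAtConst d N α * D * t ^ (α / 4) := by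
        have hpow : (t / 2) ^ (α / 4) = t ^ (α / 4) * (1 / 2) ^ (α / 4) := by
          rw [div_eq_mul_one_div, Real.mul_rpow ht.le (by norm_num)]
        rw [QAtConst, hpow, Real.rpow_neg hhalf.le, Real.rpow_natCast, div_pow]
        field_simp

/-- The constant in the bound of `P_1^{(N)}` by the heat kernel. -/
def PAtConst (d N : ℕ) (α : ℝ) : ℝ :=
  ∑ k ∈ Finset.range N, ((N - 1).factorial : ℝ) / (k.factorial : ℝ) * QAtConst d k α

lemma PAtConst_nonneg (d N : ℕ) (α : ℝ) : 0 ≤ PAtConst d N α :=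
  Finset.sum_nonneg fun k _ => mul_nonneg (by positivity) (QAtConst_nonneg d k α)

lemma abs_apply_PAt_one_le
    (h : ∀ (x : Spacetime d) (t : ℝ), 0 < t → t ≤ 1 → |Λ (heatAt t x)| ≤ D * t ^ (α / 4))
    (N : ℕ) (x : Spacetime d) : |Λ (PAt N 1 x)| ≤ PAtConst d N α * D := by
  rw [PAt, map_sum, PAtConst, Finset.sum_mul]
  refine (Finset.abs_sum_le_sum_abs _ _).trans (Finset.sum_le_sum fun k _ => ?_)
  rw [map_smul, smul_eq_mul, abs_mul, abs_of_nonneg (by positivity), mul_assoc]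
  refine mul_le_mul_of_nonneg_left ?_ (by positivity)
  simpa only [Real.one_rpow, mul_one] using abs_apply_QAt_le h k one_pos le_rfl x

lemma holderENorm_le (hD : 0 ≤ D)
    (h : ∀ (x : Spacetime d) (t : ℝ), 0 < t → t ≤ 1 → |Λ (heatAt t x)| ≤ D * t ^ (α / 4))
    (N : ℕ) :
    holderENorm N α Λ ≤ ENNReal.ofReal ((PAtConst d N α + QAtConst d N α) * D) := by
  rw [add_mul, ENNReal.ofReal_add (mul_nonneg (PAtConst_nonneg d N α) hD)
    (mul_nonneg (QAtConst_nonneg d N α) hD)]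
  refine add_le_add (iSup_le fun x => ?_) (iSup₂_le fun t ht => ?_)
  · rw [← ofReal_norm, Real.norm_eq_abs]
    exact ENNReal.ofReal_le_ofReal (abs_apply_PAt_one_le h N x)
  · rw [ENNReal.mul_iSup]
    refine iSup_le fun x => ?_
    rw [← ofReal_norm, Real.norm_eq_abs, ← ENNReal.ofReal_mul (Real.rpow_nonneg ht.1.le _)]
    refine ENNReal.ofReal_le_ofReal ?_
    have hcancel : t ^ (-α / 4) * t ^ (α / 4) = 1 := by
      rw [← Real.rpow_add ht.1, neg_div, neg_add_cancel, Real.rpow_zero]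
    calc t ^ (-α / 4) * |Λ (QAt N t x)|
        ≤ t ^ (-α / 4) * (QAtConst d N α * D * t ^ (α / 4)) :=
          mul_le_mul_of_nonneg_left (abs_apply_QAt_le h N ht.1 ht.2 x) (Real.rpow_nonneg ht.1.le _)
      _ = QAtConst d N α * D := by rw [mul_left_comm, hcancel, mul_one]

end Holder

/-! ### Characters and the structure group -/

section Algebra

variable {Tp T Bp B : Type*} [Ring Tp] [Bialgebra ℝ Tp] [AddCommGroup T] [Module ℝ T]

lemma gradedPart_le_ker {V I W : Type*} [AddCommGroup V] [Module ℝ V] [AddCommGroup W]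
    [Module ℝ W] (b : Module.Basis I ℝ V) (deg : I → ℝ) (α : ℝ) (ℓ : V →ₗ[ℝ] W)
    (h : ∀ i, deg i = α → ℓ (b i) = 0) : gradedPart b deg α ≤ LinearMap.ker ℓ := by
  refine Submodule.span_le.2 ?_
  rintro _ ⟨i, hi, rfl⟩
  exact h i hi

lemma range_mapIncl_le_ker {V W X : Type*} [AddCommGroup V] [Module ℝ V] [AddCommGroup W]
    [Module ℝ W] [AddCommGroup X] [Module ℝ X] (p : Submodule ℝ V) (q : Submodule ℝ W)
    (Φ : V ⊗[ℝ] W →ₗ[ℝ] X) (h : ∀ v ∈ p, ∀ w ∈ q, Φ (v ⊗ₜ w) = 0) :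
    LinearMap.range (TensorProduct.mapIncl p q) ≤ LinearMap.ker Φ := by
  rw [LinearMap.range_le_ker_iff]
  refine TensorProduct.ext' fun v w => ?_
  simpa [TensorProduct.mapIncl] using h v.1 v.2 w.1 w.2

namespace ConcreteRegularityStructure

variable (𝒯 : ConcreteRegularityStructure Tp T Bp B)

lemma degp_nonneg (i : Bp) : 0 ≤ 𝒯.degp i := 𝒯.Ap_nonneg _ (𝒯.degp_mem i)

lemma exists_gap : ∃ a : ℝ, 0 < a ∧ ∀ i, 𝒯.degp i ≠ 0 → a ≤ 𝒯.degp i := by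
  have hfin : ((𝒯.Ap ∩ Set.Icc 0 1) \ {0}).Finite :=
    (𝒯.Ap_locallyFinite 0 1).subset Set.sdiff_subset
  by_cases hne : ((𝒯.Ap ∩ Set.Icc 0 1) \ {0}).Nonempty
  · obtain ⟨a, ha, hmin⟩ := Set.exists_min_image _ id hfin hne
    refine ⟨a, lt_of_le_of_ne ha.1.2.1 (Ne.symm ha.2), fun i hi => ?_⟩
    rcases le_total (𝒯.degp i) 1 with h | h
    · exact hmin _ ⟨⟨𝒯.degp_mem i, 𝒯.degp_nonneg i, h⟩, hi⟩
    · exact ha.1.2.2.trans h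
  · refine ⟨1, one_pos, fun i hi => ?_⟩
    by_contra hlt
    exact hne ⟨_, ⟨𝒯.degp_mem i, 𝒯.degp_nonneg i, (not_le.1 hlt).le⟩, hi⟩

lemma comul_mem_ker {X : Type*} [AddCommGroup X] [Module ℝ X] (Φ : Tp ⊗[ℝ] Tp →ₗ[ℝ] X) {α : ℝ}
    (h : ∀ i j, 𝒯.degp i + 𝒯.degp j = α → Φ (𝒯.basisp i ⊗ₜ 𝒯.basisp j) = 0) {τ : Tp}
    (hτ : τ ∈ gradedPart 𝒯.basisp 𝒯.degp α) : Φ (Coalgebra.comul (R := ℝ) τ) = 0 := by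
  suffices hle : (⨆ (μ : ℝ) (ν : ℝ) (_ : μ + ν = α), LinearMap.range (TensorProduct.mapIncl
      (gradedPart 𝒯.basisp 𝒯.degp μ) (gradedPart 𝒯.basisp 𝒯.degp ν))) ≤ LinearMap.ker Φ from
    hle (𝒯.comul_graded α τ hτ)
  refine iSup_le fun μ => iSup_le fun ν => iSup_le fun hμν => ?_
  refine range_mapIncl_le_ker _ _ _ fun v hv w hw => ?_
  have hbasis (i : Bp) (hi : 𝒯.degp i = μ) : Φ (𝒯.basisp i ⊗ₜ w) = 0 :=
    gradedPart_le_ker 𝒯.basisp 𝒯.degp ν (Φ ∘ₗ TensorProduct.mk ℝ Tp Tp (𝒯.basisp i))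
      (fun j hj => h i j (by rw [hi, hj, hμν])) hw
  exact gradedPart_le_ker 𝒯.basisp 𝒯.degp μ (Φ ∘ₗ (TensorProduct.mk ℝ Tp Tp).flip w) hbasis hv

lemma basisp_mem (i : Bp) : 𝒯.basisp i ∈ gradedPart 𝒯.basisp 𝒯.degp (𝒯.degp i) :=
  Submodule.subset_span ⟨i, rfl, rfl⟩

lemma convMul_apply_congr {f f' k k' : WithConv (Tp →ₗ[ℝ] ℝ)} {i : Bp}
    (h : ∀ j l, 𝒯.degp j + 𝒯.degp l = 𝒯.degp i →
      f.ofConv (𝒯.basisp j) * k.ofConv (𝒯.basisp l)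
        = f'.ofConv (𝒯.basisp j) * k'.ofConv (𝒯.basisp l)) :
    (f * k).ofConv (𝒯.basisp i) = (f' * k').ofConv (𝒯.basisp i) := by
  have hsub := 𝒯.comul_mem_ker (LinearMap.mul' ℝ ℝ ∘ₗ TensorProduct.map f.ofConv k.ofConv
    - LinearMap.mul' ℝ ℝ ∘ₗ TensorProduct.map f'.ofConv k'.ofConv)
    (fun j l hjl => by simpa [sub_eq_zero] using h j l hjl) (𝒯.basisp_mem i)
  rw [LinearMap.sub_apply, sub_eq_zero] at hsub
  exact hsub

lemma pow_apply_eq_zero {a : ℝ} (ha : ∀ i, 𝒯.degp i ≠ 0 → a ≤ 𝒯.degp i)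
    {n : WithConv (Tp →ₗ[ℝ] ℝ)} (hn : ∀ i, 𝒯.degp i = 0 → n.ofConv (𝒯.basisp i) = 0) (k : ℕ) :
    ∀ i, 𝒯.degp i < k * a → (n ^ k).ofConv (𝒯.basisp i) = 0 := by
  induction k with
  | zero => exact fun i hi => absurd (𝒯.degp_nonneg i) (by simpa using hi)
  | succ k ih =>
    intro i hi
    rw [pow_succ', 𝒯.convMul_apply_congr (f' := 0) (k' := 0) fun j l hjl => ?_, mul_zero,
      WithConv.ofConv_zero, LinearMap.zero_apply]
    rw [WithConv.ofConv_zero, LinearMap.zero_apply, zero_mul]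
    by_cases hj : 𝒯.degp j = 0
    · rw [hn j hj, zero_mul]
    · have hgap := ha j hj
      push_cast at hi
      rw [ih l (by linarith), mul_zero]

lemma geomSum_apply_congr {a : ℝ} (ha0 : 0 < a) {n : WithConv (Tp →ₗ[ℝ] ℝ)}
    (hpow : ∀ (k : ℕ) (i : Bp), 𝒯.degp i < k * a → (n ^ k).ofConv (𝒯.basisp i) = 0) {i : Bp}
    {m m' : ℕ} (hm : 𝒯.degp i < m * a) (hm' : 𝒯.degp i < m' * a) :
    (∑ k ∈ Finset.range m, n ^ k).ofConv (𝒯.basisp i)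
      = (∑ k ∈ Finset.range m', n ^ k).ofConv (𝒯.basisp i) := by
  wlog hle : m ≤ m' generalizing m m'
  · exact (this hm' hm (le_of_not_ge hle)).symm
  simp only [WithConv.ofConv_sum, LinearMap.sum_apply]
  refine Finset.sum_subset (Finset.range_mono hle) fun k _ hk => hpow k i (hm.trans_le ?_)
  have hmk : m ≤ k := not_lt.1 fun h => hk (Finset.mem_range.2 h)
  gcongr

/-- A convolution inverse is given by the Neumann series, which is a finite sum on each basis
element since the powers of `n` vanish in low degrees. -/
lemma isUnit_one_sub {a : ℝ} (ha0 : 0 < a) {n : WithConv (Tp →ₗ[ℝ] ℝ)}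
    (hpow : ∀ (k : ℕ) (i : Bp), 𝒯.degp i < k * a → (n ^ k).ofConv (𝒯.basisp i) = 0) :
    IsUnit (1 - n) := by
  choose K hK using fun i => exists_nat_gt (𝒯.degp i / a)
  have hdeg (i : Bp) : 𝒯.degp i < K i * a := (div_lt_iff₀ ha0).1 (hK i)
  let inv : WithConv (Tp →ₗ[ℝ] ℝ) := WithConv.toConv
    (𝒯.basisp.constr ℝ fun i => (∑ k ∈ Finset.range (K i), n ^ k).ofConv (𝒯.basisp i))
  have hinv {i : Bp} {m : ℕ} (hm : 𝒯.degp i < m * a) :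
      inv.ofConv (𝒯.basisp i) = (∑ k ∈ Finset.range m, n ^ k).ofConv (𝒯.basisp i) :=
    (𝒯.basisp.constr_basis ℝ _ i).trans (𝒯.geomSum_apply_congr ha0 hpow (hdeg i) hm)
  have hone (i : Bp) : (1 - n ^ K i).ofConv (𝒯.basisp i)
      = (1 : WithConv (Tp →ₗ[ℝ] ℝ)).ofConv (𝒯.basisp i) := by
    rw [WithConv.ofConv_sub, LinearMap.sub_apply, hpow (K i) i (hdeg i), sub_zero]
  have hext {u v : WithConv (Tp →ₗ[ℝ] ℝ)}
      (huv : ∀ i, u.ofConv (𝒯.basisp i) = v.ofConv (𝒯.basisp i)) : u = v :=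
    WithConv.ofConv_injective (𝒯.basisp.ext huv)
  have hright : (1 - n) * inv = 1 := hext fun i => by
    rw [← hone i, ← mul_neg_geom_sum]
    exact 𝒯.convMul_apply_congr fun j l hjl => by
      rw [hinv (m := K i) (by linarith [hdeg i, 𝒯.degp_nonneg j])]
  have hleft : inv * (1 - n) = 1 := hext fun i => by
    rw [← hone i, ← geom_sum_mul_neg]
    exact 𝒯.convMul_apply_congr fun j l hjl => by
      rw [hinv (m := K i) (by linarith [hdeg i, 𝒯.degp_nonneg l])]
  exact ⟨⟨1 - n, inv, hright, hleft⟩, rfl⟩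

lemma isUnit_of_degree_zero {f : WithConv (Tp →ₗ[ℝ] ℝ)}
    (hf : ∀ i, 𝒯.degp i = 0 → f.ofConv (𝒯.basisp i) = Coalgebra.counit (R := ℝ) (𝒯.basisp i)) :
    IsUnit f := by
  obtain ⟨a, ha0, ha⟩ := 𝒯.exists_gap
  have hzero (i : Bp) (hi : 𝒯.degp i = 0) : (1 - f).ofConv (𝒯.basisp i) = 0 := by
    change Coalgebra.counit (R := ℝ) (𝒯.basisp i) - f.ofConv (𝒯.basisp i) = 0
    rw [hf i hi, sub_self]
  simpa only [sub_sub_cancel] using 𝒯.isUnit_one_sub ha0 (𝒯.pow_apply_eq_zero ha hzero)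

lemma isUnit_character (𝒯 : ConcreteRegularityStructure Tp T Bp B) (g : Tp →ₐ[ℝ] ℝ) :
    IsUnit (WithConv.toConv g.toLinearMap) := by
  refine 𝒯.isUnit_of_degree_zero fun i hi => ?_
  have hmem : 𝒯.basisp i ∈ Submodule.span ℝ {(1 : Tp)} := by
    rw [← 𝒯.connected, ← hi]
    exact 𝒯.basisp_mem i
  obtain ⟨c, hc⟩ := Submodule.mem_span_singleton.1 hmem
  rw [← hc]
  simp

lemma charInv_mul (𝒯 : ConcreteRegularityStructure Tp T Bp B) (g : Tp →ₐ[ℝ] ℝ) :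
    WithConv.toConv (charInv g) * WithConv.toConv g.toLinearMap = 1 :=
  Ring.inverse_mul_cancel _ (𝒯.isUnit_character g)

lemma hat_hat (f k : WithConv (Tp →ₗ[ℝ] ℝ)) (τ : T) :
    𝒯.hat f.ofConv (𝒯.hat k.ofConv τ) = 𝒯.hat (f * k).ofConv τ := by
  let Ψ : T ⊗[ℝ] (Tp ⊗[ℝ] Tp) →ₗ[ℝ] T := (TensorProduct.rid ℝ T).toLinearMap ∘ₗ
    (LinearMap.mul' ℝ ℝ ∘ₗ TensorProduct.map f.ofConv k.ofConv).lTensor T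
  have htmul (z : T ⊗[ℝ] Tp) (ρ : Tp) :
      k.ofConv ρ • (TensorProduct.rid ℝ T) (f.ofConv.lTensor T z)
        = Ψ (TensorProduct.assoc ℝ T Tp Tp (z ⊗ₜ ρ)) := by
    induction z using TensorProduct.induction_on with
    | zero => simp
    | tmul x y => simp [Ψ, smul_smul, mul_comm]
    | add x y hx hy => simp only [map_add, smul_add, hx, hy, TensorProduct.add_tmul]
  have hleft : 𝒯.hat f.ofConv ∘ₗ (TensorProduct.rid ℝ T).toLinearMap ∘ₗ k.ofConv.lTensor T
      = Ψ ∘ₗ (TensorProduct.assoc ℝ T Tp Tp).toLinearMap ∘ₗ 𝒯.split.rTensor Tp :=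
    TensorProduct.ext' fun σ ρ => by simpa [hat] using htmul (𝒯.split σ) ρ
  calc 𝒯.hat f.ofConv (𝒯.hat k.ofConv τ)
      = Ψ (TensorProduct.assoc ℝ T Tp Tp (𝒯.split.rTensor Tp (𝒯.split τ))) :=
        LinearMap.congr_fun hleft (𝒯.split τ)
    _ = Ψ ((Coalgebra.comul (R := ℝ) (A := Tp)).lTensor T (𝒯.split τ)) :=
        congrArg (fun L => Ψ (L τ)) 𝒯.split_coassoc
    _ = 𝒯.hat (f * k).ofConv τ := by
        simp only [Ψ, LinearMap.comp_apply, ← LinearMap.lTensor_comp_apply]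
        rfl

lemma PiAt_eq (g : Spacetime d → Tp →ₐ[ℝ] ℝ) (P : T →ₗ[ℝ] TempDist d) (x : Spacetime d) (τ : T) :
    𝒯.PiAt g P x τ = P (𝒯.hat (charInv (g x)) τ) := by
  have htensor (z : T ⊗[ℝ] Tp) :
      TensorProduct.rid ℝ (TempDist d) (TensorProduct.map P (charInv (g x)) z)
        = P (TensorProduct.rid ℝ T ((charInv (g x)).lTensor T z)) := by
    induction z using TensorProduct.induction_on with
    | zero => simp
    | tmul x y => simp
    | add x y hx hy => simp only [map_add, hx, hy]
  exact htensor (𝒯.split τ)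

lemma PiAt_hat_transition (g : Spacetime d → Tp →ₐ[ℝ] ℝ) (P : T →ₗ[ℝ] TempDist d)
    (y x : Spacetime d) (τ : T) :
    𝒯.PiAt g P y (𝒯.hat (transition g y x) τ) = 𝒯.PiAt g P x τ := by
  rw [PiAt_eq, PiAt_eq, transition]
  have hcomp := 𝒯.hat_hat (WithConv.toConv (charInv (g y)))
    (WithConv.toConv (g y).toLinearMap * WithConv.toConv (charInv (g x))) τ
  rw [← mul_assoc, 𝒯.charInv_mul, one_mul] at hcomp
  exact congrArg P hcomp

lemma hat_transition_hat_transition (g : Spacetime d → Tp →ₐ[ℝ] ℝ) (z y x : Spacetime d) (τ : T) :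
    𝒯.hat (transition g z y) (𝒯.hat (transition g y x) τ) = 𝒯.hat (transition g z x) τ := by
  have hcomp := 𝒯.hat_hat (WithConv.toConv (g z).toLinearMap * WithConv.toConv (charInv (g y)))
    (WithConv.toConv (g y).toLinearMap * WithConv.toConv (charInv (g x))) τ
  rw [mul_assoc, ← mul_assoc (WithConv.toConv (charInv (g y))), 𝒯.charInv_mul, one_mul] at hcomp
  exact hcomp

/-! ### Expansions in the basis -/

lemma finite_deg_lt (γ : ℝ) : {i | 𝒯.deg i < γ}.Finite := by
  obtain ⟨m, hm⟩ := 𝒯.A_bddBelow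
  refine ((𝒯.A_locallyFinite m γ).biUnion fun β _ => 𝒯.deg_finite β).subset fun i hi => ?_
  exact Set.mem_biUnion ⟨𝒯.deg_mem i, hm (𝒯.deg_mem i), le_of_lt hi⟩ rfl

instance (γ : ℝ) : Fintype {i // 𝒯.deg i < γ} := (𝒯.finite_deg_lt γ).fintype

lemma minHom_le (i : B) : 𝒯.minHom ≤ 𝒯.deg i := csInf_le 𝒯.A_bddBelow (𝒯.deg_mem i)

lemma TLt_le_ker {X : Type*} [AddCommGroup X] [Module ℝ X] {γ : ℝ} (ℓ : T →ₗ[ℝ] X)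
    (h : ∀ i, 𝒯.deg i < γ → ℓ (𝒯.basis i) = 0) : 𝒯.TLt γ ≤ LinearMap.ker ℓ :=
  iSup₂_le fun _ hβ => gradedPart_le_ker _ _ _ _ fun i hi => h i (hi ▸ hβ)

lemma eq_sum_of_mem_TLt {γ : ℝ} {τ : T} (hτ : τ ∈ 𝒯.TLt γ) :
    τ = ∑ i : {i // 𝒯.deg i < γ}, 𝒯.basis.repr τ i • 𝒯.basis i := by
  classical
  let ℓ : T →ₗ[ℝ] T := LinearMap.id -
    ∑ i : {i // 𝒯.deg i < γ}, (𝒯.basis.coord i).smulRight (𝒯.basis i)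
  have hker : ℓ τ = 0 := by
    refine 𝒯.TLt_le_ker ℓ (fun j hj => ?_) hτ
    simp only [ℓ, LinearMap.sub_apply, LinearMap.id_apply, LinearMap.sum_apply,
      LinearMap.smulRight_apply, Module.Basis.coord_apply, Module.Basis.repr_self]
    rw [Finset.sum_eq_single ⟨j, hj⟩]
    · simp
    · intro i _ hij
      rw [Finsupp.single_eq_of_ne (fun heq => hij (Subtype.ext heq)), zero_smul]
    · simp
  simpa [ℓ, sub_eq_zero] using hker

lemma hat_mem_TLt (g : Tp →ₗ[ℝ] ℝ) {γ : ℝ} {τ : T} (hτ : τ ∈ 𝒯.TLt γ) :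
    𝒯.hat g τ ∈ 𝒯.TLt γ := by
  rw [← Submodule.ker_mkQ (𝒯.TLt γ)]
  refine 𝒯.TLt_le_ker ((𝒯.TLt γ).mkQ ∘ₗ 𝒯.hat g) (fun i hi => ?_) hτ
  have hsplit := 𝒯.split_graded (𝒯.deg i) (𝒯.basis i) (Submodule.subset_span ⟨i, rfl, rfl⟩)
  suffices hle : (⨆ (α : ℝ) (_ : 0 ≤ α), LinearMap.range (TensorProduct.mapIncl
      (gradedPart 𝒯.basis 𝒯.deg (𝒯.deg i - α)) (gradedPart 𝒯.basisp 𝒯.degp α)))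
      ≤ LinearMap.ker ((𝒯.TLt γ).mkQ ∘ₗ (TensorProduct.rid ℝ T).toLinearMap ∘ₗ g.lTensor T) from
    hle hsplit
  refine iSup₂_le fun α hα => range_mapIncl_le_ker _ _ _ fun v hv w _ => ?_
  have hvlt : v ∈ 𝒯.TLt γ :=
    le_iSup₂ (f := fun β (_ : β < γ) => gradedPart 𝒯.basis 𝒯.deg β) (𝒯.deg i - α)
      (by linarith) hv
  simpa using Or.inr hvlt

end ConcreteRegularityStructure

end Algebra

/-! ### The germ of a modelled distribution -/

lemma pdist_nonneg (x y : Spacetime d) : 0 ≤ pdist x y := by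
  rw [pdist_eq]
  exact pnorm_nonneg _

lemma pdist_self (x : Spacetime d) : pdist x x = 0 := by simp [pdist]

lemma continuous_pdist_rpow {a : ℝ} (ha : 0 ≤ a) {u v : Spacetime d → Spacetime d}
    (hu : Continuous u) (hv : Continuous v) : Continuous fun y => pdist (u y) (v y) ^ a := by
  simp only [pdist_eq]
  exact (continuous_pnorm_rpow ha).comp (hu.sub hv)

lemma abs_le_of_enorm_div_le {r b : ℝ} {K : ℝ≥0∞} (hb : 0 ≤ b) (hK : K < ⊤)
    (h : ‖r‖ₑ / ENNReal.ofReal b ≤ K) : |r| ≤ K.toReal * b := by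
  rw [ENNReal.div_le_iff_le_mul (Or.inr hK.ne) (Or.inl ENNReal.ofReal_ne_top)] at h
  have hreal := ENNReal.toReal_mono (ENNReal.mul_ne_top hK.ne ENNReal.ofReal_ne_top) h
  rwa [toReal_enorm, ENNReal.toReal_mul, ENNReal.toReal_ofReal hb, Real.norm_eq_abs] at hreal

section Modelled

variable {Tp T Bp B : Type*} [Ring Tp] [Bialgebra ℝ Tp] [AddCommGroup T] [Module ℝ T]

namespace ConcreteRegularityStructure

variable (𝒯 : ConcreteRegularityStructure Tp T Bp B)

lemma enorm_repr_le (i : B) (τ : T) :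
    ‖𝒯.basis.repr τ i‖ₑ ≤ 𝒯.compENorm (𝒯.deg i) τ :=
  le_iSup₂ (f := fun j (_ : 𝒯.deg j = 𝒯.deg i) => ‖𝒯.basis.repr τ j‖ₑ) i rfl

lemma repr_hat (g : Tp →ₗ[ℝ] ℝ) (τ : T) (i : B) :
    𝒯.basis.repr (𝒯.hat g τ) i
      = g (TensorProduct.lid ℝ Tp ((𝒯.basis.coord i).rTensor Tp (𝒯.split τ))) := by
  have htensor (z : T ⊗[ℝ] Tp) : 𝒯.basis.coord i (TensorProduct.rid ℝ T (g.lTensor T z))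
      = g (TensorProduct.lid ℝ Tp ((𝒯.basis.coord i).rTensor Tp z)) := by
    induction z using TensorProduct.induction_on with
    | zero => simp
    | tmul x y => simp [mul_comm]
    | add x y hx hy => simp only [map_add, hx, hy]
  exact htensor (𝒯.split τ)

end ConcreteRegularityStructure

namespace Model

variable {𝒯 : ConcreteRegularityStructure Tp T Bp B} (M : Model d 𝒯)

lemma abs_transition_le (i : Bp) (y x : Spacetime d) :
    |transition M.g y x (𝒯.basisp i)|
      ≤ (𝒯.gENorm M.g (𝒯.degp i + 1)).toReal * pdist y x ^ 𝒯.degp i := by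
  refine abs_le_of_enorm_div_le (Real.rpow_nonneg (pdist_nonneg y x) _) (M.g_bound _) ?_
  exact le_iSup₂_of_le (f := fun i (_ : 𝒯.degp i < _) => ⨆ (x) (y),
    ‖transition M.g y x (𝒯.basisp i)‖ₑ / ENNReal.ofReal (pdist y x ^ 𝒯.degp i)) i (lt_add_one _)
    (le_iSup₂ (f := fun x y => ‖transition M.g y x (𝒯.basisp i)‖ₑ
      / ENNReal.ofReal (pdist y x ^ 𝒯.degp i)) x y)

lemma exists_continuous_abs_transition_le (τ : Tp) (z : Spacetime d) : ∃ m : Spacetime d → ℝ,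
    Continuous m ∧ ∀ y, |transition M.g z y τ| ≤ m y := by
  refine ⟨fun y => ∑ i ∈ (𝒯.basisp.repr τ).support, |𝒯.basisp.repr τ i| *
    ((𝒯.gENorm M.g (𝒯.degp i + 1)).toReal * pdist z y ^ 𝒯.degp i), ?_, fun y => ?_⟩
  · exact continuous_finsetSum _ fun i _ => continuous_const.mul (continuous_const.mul
      (continuous_pdist_rpow (𝒯.degp_nonneg i) continuous_const continuous_id))
  · conv_lhs => rw [← 𝒯.basisp.linearCombination_repr τ, Finsupp.linearCombination_apply,
      Finsupp.sum, map_sum]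
    refine (Finset.abs_sum_le_sum_abs _ _).trans (Finset.sum_le_sum fun i _ => ?_)
    rw [map_smul, smul_eq_mul, abs_mul]
    exact mul_le_mul_of_nonneg_left (M.abs_transition_le i z y) (abs_nonneg _)

lemma exists_continuous_abs_repr_hat_le (τ : T) (i : B) (z : Spacetime d) :
    ∃ m : Spacetime d → ℝ, Continuous m ∧
      ∀ y, |𝒯.basis.repr (𝒯.hat (transition M.g z y) τ) i| ≤ m y := by
  simpa only [𝒯.repr_hat] using M.exists_continuous_abs_transition_le
    (TensorProduct.lid ℝ Tp ((𝒯.basis.coord i).rTensor Tp (𝒯.split τ))) z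

lemma PiNorm_nonneg (γ : ℝ) : 0 ≤ M.PiNorm γ := ENNReal.toReal_nonneg

lemma abs_PiX_basis_le {γ : ℝ} {i : B} (hi : 𝒯.deg i < γ) (x : Spacetime d) {t : ℝ} (ht : 0 < t)
    (ht1 : t ≤ 1) : |M.PiX x (𝒯.basis i) (heatAt t x)| ≤ M.PiNorm γ * t ^ (𝒯.deg i / 4) := by
  have h : ENNReal.ofReal (t ^ (-𝒯.deg i / 4)) * ‖M.PiX x (𝒯.basis i) (heatAt t x)‖ₑ
      ≤ 𝒯.PiENorm M.g M.P γ :=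
    le_iSup₂_of_le (f := fun i (_ : 𝒯.deg i < γ) => ⨆ (x : Spacetime d) (t : ℝ)
      (_ : t ∈ Set.Ioc (0 : ℝ) 1), ENNReal.ofReal (t ^ (-𝒯.deg i / 4)) *
        ‖𝒯.PiAt M.g M.P x (𝒯.basis i) (heatAt t x)‖ₑ) i hi
      (le_iSup_of_le x (le_iSup₂ (f := fun t (_ : t ∈ Set.Ioc (0 : ℝ) 1) =>
        ENNReal.ofReal (t ^ (-𝒯.deg i / 4)) *
          ‖𝒯.PiAt M.g M.P x (𝒯.basis i) (heatAt t x)‖ₑ) t ⟨ht, ht1⟩))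
  have hreal := ENNReal.toReal_mono (M.P_bound γ).ne h
  rw [ENNReal.toReal_mul, ENNReal.toReal_ofReal (Real.rpow_nonneg ht.le _), toReal_enorm,
    Real.norm_eq_abs, neg_div, Real.rpow_neg ht.le, inv_mul_le_iff₀ (Real.rpow_pos_of_pos ht _),
    mul_comm] at hreal
  exact hreal

lemma PiX_apply_of_mem_TLt {γ : ℝ} {τ : T} (hτ : τ ∈ 𝒯.TLt γ) (x : Spacetime d)
    (φ : 𝓢(Spacetime d, ℝ)) :
    M.PiX x τ φ = ∑ i : {i // 𝒯.deg i < γ}, 𝒯.basis.repr τ i * M.PiX x (𝒯.basis i) φ := by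
  conv_lhs => rw [𝒯.eq_sum_of_mem_TLt hτ]
  simp only [map_sum, map_smul, sum_apply, smul_apply, smul_eq_mul]

end Model

namespace ModelledDistribution

variable {𝒯 : ConcreteRegularityStructure Tp T Bp B} {M : Model d 𝒯} {γ : ℝ}
  (f : ModelledDistribution 𝒯 M.g γ)

lemma mem_TLt (x : Spacetime d) : f.toFun x ∈ 𝒯.TLt γ := (Subtype.property f).1 x

lemma incr_mem_TLt (y x : Spacetime d) :
    f.toFun y - 𝒯.hat (transition M.g y x) (f.toFun x) ∈ 𝒯.TLt γ :=
  sub_mem (f.mem_TLt y) (𝒯.hat_mem_TLt _ (f.mem_TLt x))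

/-- The supremum part `⟦f⟧_{𝒟^γ}` of the norm of `f`. -/
def supNorm : ℝ := (𝒯.supENorm γ f.toFun).toReal

lemma incrNorm_nonneg : 0 ≤ f.incrNorm := ENNReal.toReal_nonneg

lemma supNorm_nonneg : 0 ≤ f.supNorm := ENNReal.toReal_nonneg

lemma norm_eq_add : ‖f‖ = f.supNorm + f.incrNorm := rfl

lemma abs_repr_le {i : B} (hi : 𝒯.deg i < γ) (x : Spacetime d) :
    |𝒯.basis.repr (f.toFun x) i| ≤ f.supNorm := by
  have h : ‖𝒯.basis.repr (f.toFun x) i‖ₑ ≤ 𝒯.supENorm γ f.toFun :=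
    (𝒯.enorm_repr_le i _).trans (le_iSup₂_of_le (f := fun β (_ : β < γ) =>
      ⨆ x, 𝒯.compENorm β (f.toFun x)) (𝒯.deg i) hi
      (le_iSup (fun x => 𝒯.compENorm (𝒯.deg i) (f.toFun x)) x))
  have hreal := ENNReal.toReal_mono (Subtype.property f).2.1.ne h
  rwa [toReal_enorm, Real.norm_eq_abs] at hreal

lemma abs_repr_incr_le {i : B} (hi : 𝒯.deg i < γ) (y x : Spacetime d) :
    |𝒯.basis.repr (f.toFun y - 𝒯.hat (transition M.g y x) (f.toFun x)) i|
      ≤ f.incrNorm * pdist y x ^ (γ - 𝒯.deg i) := by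
  refine abs_le_of_enorm_div_le (Real.rpow_nonneg (pdist_nonneg y x) _)
    (Subtype.property f).2.2 ?_
  refine (ENNReal.div_le_div_right (𝒯.enorm_repr_le i _) _).trans ?_
  exact le_iSup₂_of_le (f := fun β (_ : β < γ) => ⨆ (x) (y),
      𝒯.compENorm β (f.toFun y - 𝒯.hat (transition M.g y x) (f.toFun x))
        / ENNReal.ofReal (pdist y x ^ (γ - β))) (𝒯.deg i) hi
      (le_iSup₂ (f := fun x y =>
        𝒯.compENorm (𝒯.deg i) (f.toFun y - 𝒯.hat (transition M.g y x) (f.toFun x))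
        / ENNReal.ofReal (pdist y x ^ (γ - 𝒯.deg i))) x y)

lemma exists_continuous_repr_transport_bound (z : Spacetime d) (i : B) :
    ∃ m : {j // 𝒯.deg j < γ} → Spacetime d → ℝ, (∀ j, Continuous (m j)) ∧ ∀ x y,
      |𝒯.basis.repr (𝒯.hat (transition M.g z y) (f.toFun y)) i
        - 𝒯.basis.repr (𝒯.hat (transition M.g z x) (f.toFun x)) i|
      ≤ ∑ j : {j // 𝒯.deg j < γ}, f.incrNorm * pdist y x ^ (γ - 𝒯.deg j) * m j y := by
  choose m hm hle using
    fun j : {j // 𝒯.deg j < γ} => M.exists_continuous_abs_repr_hat_le (𝒯.basis j) i z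
  refine ⟨m, hm, fun x y => ?_⟩
  rw [← 𝒯.hat_transition_hat_transition M.g z y x, ← Finsupp.sub_apply, ← map_sub, ← map_sub]
  conv_lhs => rw [𝒯.eq_sum_of_mem_TLt (f.incr_mem_TLt y x)]
  rw [map_sum, map_sum, Finsupp.finsetSum_apply]
  refine (Finset.abs_sum_le_sum_abs _ _).trans (Finset.sum_le_sum fun j _ => ?_)
  rw [map_smul, map_smul, Finsupp.smul_apply, smul_eq_mul, abs_mul]
  exact mul_le_mul (f.abs_repr_incr_le j.2 y x) (hle j y) (abs_nonneg _)
    (mul_nonneg f.incrNorm_nonneg (Real.rpow_nonneg (pdist_nonneg y x) _))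

lemma continuous_repr_transport (z : Spacetime d) (i : B) :
    Continuous fun y => 𝒯.basis.repr (𝒯.hat (transition M.g z y) (f.toFun y)) i := by
  obtain ⟨m, hm, hle⟩ := f.exists_continuous_repr_transport_bound z i
  rw [continuous_iff_continuousAt]
  intro x
  have hcont : Continuous fun y => ∑ j : {j // 𝒯.deg j < γ},
      f.incrNorm * pdist y x ^ (γ - 𝒯.deg j) * m j y :=
    continuous_finsetSum _ fun j _ => (continuous_const.mul
      (continuous_pdist_rpow (sub_nonneg.2 j.2.le) continuous_id continuous_const)).mul (hm j)
  have hzero : ∑ j : {j // 𝒯.deg j < γ}, f.incrNorm * pdist x x ^ (γ - 𝒯.deg j) * m j x = 0 :=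
    Finset.sum_eq_zero fun j _ => by
      rw [pdist_self, Real.zero_rpow (sub_pos.2 j.2).ne', mul_zero, zero_mul]
  have hlim := hcont.tendsto x
  rw [hzero] at hlim
  exact tendsto_iff_norm_sub_tendsto_zero.2 (squeeze_zero (fun y => norm_nonneg _) (hle x) hlim)

/-- The germ `x ↦ Π_x^g f(x)` of local approximations described by `f`. -/
def germ (x : Spacetime d) : TempDist d := M.PiX x (f.toFun x)

lemma measurable_germVal : Measurable (Function.uncurry (germVal f.germ)) := by
  -- After transport to the base point `0` only the coefficients depend on the point, continuously.
  have hexpand : Function.uncurry (germVal f.germ) = fun p : ℝ × Spacetime d =>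
      ∑ i : {i // 𝒯.deg i < γ}, 𝒯.basis.repr (𝒯.hat (transition M.g 0 p.2) (f.toFun p.2)) i
        * M.PiX 0 (𝒯.basis i) (heatAt p.1 p.2) := by
    funext p
    rw [← M.PiX_apply_of_mem_TLt (𝒯.hat_mem_TLt _ (f.mem_TLt p.2))]
    exact congrArg (fun Λ : TempDist d => Λ (heatAt p.1 p.2))
      (𝒯.PiAt_hat_transition M.g M.P 0 p.2 (f.toFun p.2)).symm
  rw [hexpand]
  exact Finset.measurable_fun_sum _ fun i _ =>
    ((f.continuous_repr_transport 0 i).measurable.comp measurable_snd).mul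
      (measurable_apply_heatAt _)

lemma germ_sub (y x : Spacetime d) : f.germ y - f.germ x
    = M.PiX y (f.toFun y - 𝒯.hat (transition M.g y x) (f.toFun x)) := by
  rw [map_sub]
  exact congrArg (f.germ y - ·) (𝒯.PiAt_hat_transition M.g M.P y x (f.toFun x)).symm

variable {s : ℝ}

lemma abs_germ_sub_apply_heatAt_le (hs : 0 < s) (hs1 : s ≤ 1) (x y : Spacetime d) :
    |(f.germ y - f.germ x) (heatAt s y)| ≤ M.PiNorm γ * f.incrNorm *
      ∑ i : {i // 𝒯.deg i < γ}, s ^ (𝒯.deg i / 4) * pdist y x ^ (γ - 𝒯.deg i) := by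
  rw [germ_sub, M.PiX_apply_of_mem_TLt (f.incr_mem_TLt y x), Finset.mul_sum]
  refine (Finset.abs_sum_le_sum_abs _ _).trans (Finset.sum_le_sum fun i _ => ?_)
  rw [abs_mul]
  refine (mul_le_mul (f.abs_repr_incr_le i.2 y x) (M.abs_PiX_basis_le i.2 y hs hs1)
    (abs_nonneg _) (mul_nonneg f.incrNorm_nonneg
      (Real.rpow_nonneg (pdist_nonneg y x) _))).trans (le_of_eq ?_)
  ring

lemma abs_germ_apply_heatAt_le (hs : 0 < s) (hs1 : s ≤ 1) (y : Spacetime d) :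
    |f.germ y (heatAt s y)| ≤ Fintype.card {i // 𝒯.deg i < γ} * M.PiNorm γ * f.supNorm
      * s ^ (min 𝒯.minHom 0 / 4) := by
  have hterm (i : {i // 𝒯.deg i < γ}) :
      |𝒯.basis.repr (f.toFun y) i * M.PiX y (𝒯.basis i) (heatAt s y)|
        ≤ f.supNorm * (M.PiNorm γ * s ^ (min 𝒯.minHom 0 / 4)) := by
    have hexp : min 𝒯.minHom 0 / 4 ≤ 𝒯.deg i / 4 := by
      linarith [(min_le_left 𝒯.minHom 0).trans (𝒯.minHom_le i)]
    rw [abs_mul]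
    exact mul_le_mul (f.abs_repr_le i.2 y) ((M.abs_PiX_basis_le i.2 y hs hs1).trans
      (mul_le_mul_of_nonneg_left (Real.rpow_le_rpow_of_exponent_ge hs hs1 hexp)
        (M.PiNorm_nonneg γ))) (abs_nonneg _) f.supNorm_nonneg
  rw [germ, M.PiX_apply_of_mem_TLt (f.mem_TLt y)]
  refine (Finset.abs_sum_le_sum_abs _ _).trans
    ((Finset.sum_le_sum fun i _ => hterm i).trans (le_of_eq ?_))
  rw [Finset.sum_const, Finset.card_univ, nsmul_eq_mul]
  ring

lemma isGerm_germ : IsGerm (fun i : {i // 𝒯.deg i < γ} => 𝒯.deg i) γ (min 𝒯.minHom 0)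
    (M.PiNorm γ * f.incrNorm)
    (Fintype.card {i // 𝒯.deg i < γ} * M.PiNorm γ * f.supNorm) f.germ :=
  ⟨f.measurable_germVal, fun _ hs hs1 x y => f.abs_germ_sub_apply_heatAt_le hs hs1 x y,
    fun _ hs hs1 y => f.abs_germ_apply_heatAt_le hs hs1 y⟩

variable (𝒯 M γ) in
/-- The linear map that sends a modelled distribution to its germ. -/
def germMap : ModelledDistribution 𝒯 M.g γ →ₗ[ℝ]
    germSpace d (fun i : {i // 𝒯.deg i < γ} => 𝒯.deg i) γ (min 𝒯.minHom 0) where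
  toFun f := ⟨f.germ, _, _, f.isGerm_germ⟩
  map_add' f k := Subtype.ext (funext fun x => (M.PiX x).map_add (f.toFun x) (k.toFun x))
  map_smul' c f := Subtype.ext (funext fun x => (M.PiX x).map_smul c (f.toFun x))

lemma eq_zero_of_isEmpty [IsEmpty {i // 𝒯.deg i < γ}] : f = 0 := by
  refine Subtype.ext (funext fun x => ?_)
  change f.toFun x = 0
  rw [𝒯.eq_sum_of_mem_TLt (f.mem_TLt x), Finset.univ_eq_empty, Finset.sum_empty]

lemma abs_apply_heatAt_le_of_abs_sub_germ_le {Λ : TempDist d} {C : ℝ} (hC : 0 ≤ C)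
    (h : ∀ (x : Spacetime d) (t : ℝ), 0 < t → t ≤ 1 →
      |(Λ - f.germ x) (heatAt t x)| ≤ C * (M.PiNorm γ * f.incrNorm) * t ^ (γ / 4))
    (hγ : min 𝒯.minHom 0 ≤ γ) {t : ℝ} (ht : 0 < t) (ht1 : t ≤ 1) (x : Spacetime d) :
    |Λ (heatAt t x)| ≤ (C + Fintype.card {i // 𝒯.deg i < γ}) * M.PiNorm γ * ‖f‖
      * t ^ (min 𝒯.minHom 0 / 4) := by
  have hP := M.PiNorm_nonneg γ
  have hincr := f.incrNorm_nonneg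
  have hsup := f.supNorm_nonneg
  have hpow : t ^ (γ / 4) ≤ t ^ (min 𝒯.minHom 0 / 4) :=
    Real.rpow_le_rpow_of_exponent_ge ht ht1 (by linarith)
  set n : ℝ := (Fintype.card {i // 𝒯.deg i < γ} : ℝ)
  calc |Λ (heatAt t x)|
      = |(Λ - f.germ x) (heatAt t x) + f.germ x (heatAt t x)| := by
        rw [sub_apply, sub_add_cancel]
    _ ≤ C * (M.PiNorm γ * f.incrNorm) * t ^ (γ / 4)
          + n * M.PiNorm γ * f.supNorm * t ^ (min 𝒯.minHom 0 / 4) :=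
        (abs_add_le _ _).trans (add_le_add (h x t ht ht1) (f.abs_germ_apply_heatAt_le ht ht1 x))
    _ ≤ (C * (M.PiNorm γ * f.incrNorm) + n * M.PiNorm γ * f.supNorm)
          * t ^ (min 𝒯.minHom 0 / 4) := by
        rw [add_mul]
        gcongr
    _ ≤ (C + n) * M.PiNorm γ * ‖f‖ * t ^ (min 𝒯.minHom 0 / 4) := by
        rw [f.norm_eq_add]
        gcongr
        have hcross : 0 ≤ C * (M.PiNorm γ * f.supNorm) + n * (M.PiNorm γ * f.incrNorm) := by
          positivity
        linarith

end ModelledDistribution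

/-! ### Reconstruction of modelled distributions -/

lemma HolderSpace.exists_continuousLinearMap {E : Type*} [SeminormedAddCommGroup E]
    [NormedSpace ℝ E] {N : ℕ} {α K : ℝ} (hK : 0 ≤ K) (R : E →ₗ[ℝ] TempDist d)
    (h : ∀ f, holderENorm N α (R f) ≤ ENNReal.ofReal (K * ‖f‖)) :
    ∃ S : E →L[ℝ] HolderSpace d N α, ∀ f, (S f).toDist = R f := by
  let S : E →ₗ[ℝ] HolderSpace d N α :=
    { toFun := fun f => ⟨R f, (h f).trans_lt ENNReal.ofReal_lt_top⟩
      map_add' := fun f k => Subtype.ext (R.map_add f k)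
      map_smul' := fun c f => Subtype.ext (R.map_smul c f) }
  refine ⟨S.mkContinuous K fun f => ?_, fun f => rfl⟩
  exact ENNReal.toReal_le_of_le_ofReal (mul_nonneg hK (norm_nonneg f)) (h f)

lemma Model.exists_reconstructionBound {𝒯 : ConcreteRegularityStructure Tp T Bp B} {γ C : ℝ}
    (N : ℕ) (M : Model d 𝒯) (R : ModelledDistribution 𝒯 M.g γ →ₗ[ℝ] TempDist d)
    (hR : ∀ (f : ModelledDistribution 𝒯 M.g γ) (x : Spacetime d) (t : ℝ), 0 < t → t ≤ 1 →
      |(R f - f.germ x) (heatAt t x)| ≤ C * (M.PiNorm γ * f.incrNorm) * t ^ (γ / 4)) :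
    ∃ S : ModelledDistribution 𝒯 M.g γ →L[ℝ] HolderSpace d N (min 𝒯.minHom 0),
      M.ReconstructionBound S C := by
  have hP := M.PiNorm_nonneg γ
  set D : ℝ := (|C| + Fintype.card {i // 𝒯.deg i < γ}) * M.PiNorm γ
  have hD : 0 ≤ D := by positivity
  have hbound (f : ModelledDistribution 𝒯 M.g γ) (x : Spacetime d) (t : ℝ) (ht : 0 < t)
      (ht1 : t ≤ 1) : |R f (heatAt t x)| ≤ D * ‖f‖ * t ^ (min 𝒯.minHom 0 / 4) := by
    rcases isEmpty_or_nonempty {i // 𝒯.deg i < γ} with hE | ⟨⟨i, hi⟩⟩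
    · rw [f.eq_zero_of_isEmpty, map_zero, zero_apply, abs_zero]
      positivity
    · refine f.abs_apply_heatAt_le_of_abs_sub_germ_le (abs_nonneg C) (fun x t ht ht1 => ?_)
        ((min_le_left _ _).trans ((𝒯.minHom_le i).trans hi.le)) ht ht1 x
      have hincr := f.incrNorm_nonneg
      refine (hR f x t ht ht1).trans ?_
      gcongr
      exact le_abs_self C
  obtain ⟨S, hS⟩ := HolderSpace.exists_continuousLinearMap (N := N)
    (mul_nonneg (add_nonneg (PAtConst_nonneg d N _) (QAtConst_nonneg d N _)) hD) R fun f => by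
      rw [mul_assoc]
      exact holderENorm_le (by positivity) (hbound f) N
  refine ⟨S, fun f x t ht ht1 => ?_⟩
  rw [hS, mul_assoc C]
  exact hR f x t ht ht1

lemma Model.ReconstructionBound.eq {𝒯 : ConcreteRegularityStructure Tp T Bp B} {M : Model d 𝒯}
    {γ α : ℝ} {N : ℕ} {R R' : ModelledDistribution 𝒯 M.g γ →L[ℝ] HolderSpace d N α} {C C' : ℝ}
    (hγ : 0 < γ) (hR : M.ReconstructionBound R C) (hR' : M.ReconstructionBound R' C') :
    R = R' := by
  refine ContinuousLinearMap.ext fun f => Subtype.ext (sub_eq_zero.1 ?_)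
  refine eq_zero_of_heatAt_small ((R f).toDist - (R' f).toDist) (c := γ / 4) (by linarith)
    (C := C * M.PiNorm γ * f.incrNorm + C' * M.PiNorm γ * f.incrNorm) fun t ht ht1 x => ?_
  rw [← sub_sub_sub_cancel_right _ _ (M.PiX x (f.toFun x)), sub_apply, add_mul]
  exact (abs_sub _ _).trans (add_le_add (hR f x t ht ht1) (hR' f x t ht ht1))

end Modelled

end RegStruct

end

theorem mainTheorem1 {d N : ℕ} (hN : 1 ≤ N) {Tp T Bp B : Type*}
    [Ring Tp] [Bialgebra ℝ Tp] [AddCommGroup T] [Module ℝ T]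
    (𝒯 : RegStruct.ConcreteRegularityStructure Tp T Bp B) (γ : ℝ) (hγ : γ ≠ 0) :
    (∃ C : ℝ, ∀ M : RegStruct.Model d 𝒯,
      ∃ R : RegStruct.ModelledDistribution 𝒯 M.g γ →L[ℝ]
          RegStruct.HolderSpace d N (min 𝒯.minHom 0),
        M.ReconstructionBound R C) ∧
    (0 < γ → ∀ (M : RegStruct.Model d 𝒯)
      (R R' : RegStruct.ModelledDistribution 𝒯 M.g γ →L[ℝ]
          RegStruct.HolderSpace d N (min 𝒯.minHom 0)) (C C' : ℝ),
        M.ReconstructionBound R C → M.ReconstructionBound R' C' → R = R') := by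
  refine ⟨?_, fun hpos M R R' C C' hR hR' => hR.eq hpos hR'⟩
  obtain ⟨C, R, hR⟩ := RegStruct.exists_reconstruction d
    (β := fun i : {i // 𝒯.deg i < γ} => 𝒯.deg i) (fun i => i.2) hγ (min_le_right 𝒯.minHom 0)
  exact ⟨C, fun M => M.exists_reconstructionBound N
    (R ∘ₗ RegStruct.ModelledDistribution.germMap 𝒯 M γ) fun f =>
      hR _ _ _ (mul_nonneg (M.PiNorm_nonneg γ) f.incrNorm_nonneg) f.isGerm_germ⟩
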